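/- Let $n\in\{2,3\}$, $d=n-1$, and let $\Gamma$ be a bounded, relatively open subset of the hyperplane $\Gamma_\infty=\{x\in\mathbb{R}^n:x_n=0\}$ (a planar screen), identified with the open set $\tilde\Gamma=\{\tilde x\in\mathbb{R}^{d}:(\tilde x,0)\in\Gamma\}$. Let $k>0$. For tempered distributions $u$ on $\mathbb{R}^d$ put $\|u\|_{H^s_k(\mathbb{R}^d)}^2=\int_{\mathbb{R}^d}(k^2+|\xi|^2)^s|\hat u(\xi)|^2\,d\xi$, where $\hat u(\xi)=(2\pi)^{-d/2}\int e^{-i\xi\cdot x}u(x)\,dx$. Let $H^s(\mathbb{R}^d)$ be the Sobolev space of those $u$ with $\hat u$ locally integrable and $\|u\|_{H^s_1(\mathbb{R}^d)}<\infty$; let $\tilde H^s(\Gamma)$ be the closure of $C_0^\infty(\tilde\Gamma)$ in $H^s(\mathbb{R}^d)$, with the norm $\|\cdot\|_{\tilde H^s_k(\Gamma)}=\|\cdot\|_{H^s_k(\mathbb{R}^d)}$; and let $H^s(\Gamma)$ be the space of restrictions to $\tilde\Gamma$ of elements of $H^s(\mathbb{R}^d)$, with the norm $\|u\|_{H^s_k(\Gamma)}=\inf\{\|U\|_{H^s_k(\mathbb{R}^d)}:U|_{\tilde\Gamma}=u\}$.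 For $u\in H^s(\Gamma)$ and $v\in\tilde H^{-s}(\Gamma)$ let $\langle u,v\rangle_{H^{s}(\Gamma)\times\tilde H^{-s}(\Gamma)}=\int_{\mathbb{R}^d}\hat U(\xi)\overline{\hat v(\xi)}\,d\xi$, where $U\in H^s(\mathbb{R}^d)$ is any extension of $u$. Let $\Phi(x,y)=\dfrac{e^{ik|x-y|}}{4\pi|x-y|}$ if $n=3$ and $\Phi(x,y)=\dfrac{i}{4}H_0^{(1)}(k|x-y|)$ if $n=2$. Then there is a unique bounded linear operator $S_k:\tilde H^{-1/2}(\Gamma)\to H^{1/2}(\Gamma)$, the single-layer operator, such that $$S_k\phi(x)=\int_\Gamma\Phi(x,y)\,\phi(y)\,ds(y),\qquad x\in\Gamma,\ \phi\in C_0^\infty(\Gamma),$$ and the sesquilinear form $a_{\mathsf D}(\phi,\psi)=\langle S_k\phi,\psi\rangle_{H^{1/2}(\Gamma)\times\tilde H^{-1/2}(\Gamma)}$ on $\tilde H^{-1/2}(\Gamma)\times\tilde H^{-1/2}(\Gamma)$ satisfies the coercivity estimate $$|a_{\mathsf D}(\phi,\phi)|\ \ge\ \frac{1}{2\sqrt2}\,\|\phi\|_{\tilde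 H^{-1/2}_k(\Gamma)}^2\qquad\text{for all }\phi\in\tilde H^{-1/2}(\Gamma).$$ The constant $1/(2\sqrt2)$ depends neither on $k>0$ nor on $\Gamma$. -/

import Mathlib

open MeasureTheory TopologicalSpace
open scoped Distributions SchwartzMap FourierTransform ENNReal

noncomputable section

/-! ### Sobolev (Bessel potential) spaces on `ℝ^d` -/

/-- `f` is a function representing the Fourier transform `𝓕 u` of the tempered distribution `u`
(with Mathlib's kernel `exp (-2 π i x · ξ)`): it is locally integrable, and `𝓕 u` acts on Schwartz
functions by integration against `f`. Such an `f` is unique almost everywhere. -/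
def IsFourierDensity {d : ℕ} (u : 𝓢'(EuclideanSpace ℝ (Fin d), ℂ))
    (f : EuclideanSpace ℝ (Fin d) → ℂ) : Prop :=
  LocallyIntegrable f ∧ ∀ g : 𝓢(EuclideanSpace ℝ (Fin d), ℂ),
    Integrable (fun ξ => g ξ * f ξ) ∧ 𝓕 u g = ∫ ξ, g ξ * f ξ

open Classical in
/-- A function representing `𝓕 u`, if there is one (and `0` otherwise). -/
def fourierDensity {d : ℕ} (u : 𝓢'(EuclideanSpace ℝ (Fin d), ℂ)) :
    EuclideanSpace ℝ (Fin d) → ℂ :=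
  if h : ∃ f, IsFourierDensity u f then h.choose else 0

/-- The Fourier transform `û`, as a function, in the normalization
`û(ξ) = (2π)^(-d/2) ∫ exp (-i ξ · x) u(x) dx`, i.e. `û(ξ) = (2π)^(-d/2) (𝓕 u)(ξ / (2π))`. -/
def fourierHat {d : ℕ} (u : 𝓢'(EuclideanSpace ℝ (Fin d), ℂ)) (ξ : EuclideanSpace ℝ (Fin d)) : ℂ :=
  (((2 * Real.pi) ^ (-(d : ℝ) / 2) : ℝ) : ℂ) * fourierDensity u ((2 * Real.pi)⁻¹ • ξ)

/-- The Sobolev space `H^s(ℝ^d)`. -/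
def sobolevSpace (d : ℕ) (s : ℝ) : Submodule ℂ 𝓢'(EuclideanSpace ℝ (Fin d), ℂ) where
  carrier := {u | TemperedDistribution.MemSobolev s 2 u}
  add_mem' := fun hu hv => hu.add hv
  zero_mem' := TemperedDistribution.memSobolev_fun_zero _ _ s 2
  smul_mem' := fun c _ hu => hu.smul c

/-- The wavenumber-dependent norm
`‖u‖_{H^s_k} = (∫ (k² + |ξ|²)^s |û(ξ)|² dξ)^(1/2)` on `H^s(ℝ^d)`. -/
def sobolevNorm {d : ℕ} (k s : ℝ) (u : 𝓢'(EuclideanSpace ℝ (Fin d), ℂ)) : ℝ :=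
  √(∫ ξ, (k ^ 2 + ‖ξ‖ ^ 2) ^ s * ‖fourierHat u ξ‖ ^ 2)

/-- The duality pairing `⟨u, v⟩ = ∫ û(ξ) conj (v̂(ξ)) dξ` of `H^s(ℝ^d)` and `H^{-s}(ℝ^d)`. -/
def sobolevPairing {d : ℕ} (u v : 𝓢'(EuclideanSpace ℝ (Fin d), ℂ)) : ℂ :=
  ∫ ξ, fourierHat u ξ * starRingEnd ℂ (fourierHat v ξ)

/-! Facts needed to see that the closure of the test functions below is a linear subspace. -/

theorem exists_isFourierDensity {d : ℕ} {s : ℝ} {u : 𝓢'(EuclideanSpace ℝ (Fin d), ℂ)}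
    (hu : u ∈ sobolevSpace d s) :
    ∃ f, IsFourierDensity u f ∧
      MemLp (fun x => (((1 + ‖x‖ ^ 2) ^ (s / 2) : ℝ) : ℂ) * f x) 2 := by
  obtain ⟨f', hf'⟩ :=
    TemperedDistribution.memSobolev_iff_exists_smulLeftCLM_fourier.1 hu
  have hF : MemLp (fun x => f' x) 2 := Lp.memLp f'
  set w : EuclideanSpace ℝ (Fin d) → ℂ := fun x => (((1 + ‖x‖ ^ 2) ^ (-s / 2) : ℝ) : ℂ) with hw
  have hwg : w.HasTemperateGrowth := by
    rw [hw]; fun_prop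
  have hwc : Continuous w := hwg.1.continuous
  have hg : ∀ g : 𝓢(EuclideanSpace ℝ (Fin d), ℂ), ∀ x,
      g x * (w x * f' x) = (SchwartzMap.smulLeftCLM ℂ w g) x * f' x := by
    intro g x
    rw [SchwartzMap.smulLeftCLM_apply_apply hwg, smul_eq_mul]
    ring
  refine ⟨fun x => w x * f' x, ⟨?_, fun g => ⟨?_, ?_⟩⟩, ?_⟩
  · have := (hF.locallyIntegrable (by norm_num)).smul_continuous hwc
    simpa only [smul_eq_mul, mul_comm] using this
  · simp_rw [hg]
    exact ((SchwartzMap.smulLeftCLM ℂ w g).memLp 2).integrable_mul hF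
  · simp_rw [hg]
    have h2 := congrArg (fun T : 𝓢'(EuclideanSpace ℝ (Fin d), ℂ) =>
      T (SchwartzMap.smulLeftCLM ℂ w g)) hf'
    simp only [Lp.toTemperedDistribution_apply, smul_eq_mul] at h2
    rw [← h2, TemperedDistribution.smulLeftCLM_apply_apply,
      SchwartzMap.smulLeftCLM_smulLeftCLM_apply (by fun_prop) hwg]
    congr 1
    ext x
    rw [SchwartzMap.smulLeftCLM_apply_apply (by fun_prop)]
    simp only [Pi.mul_apply, hw, smul_eq_mul]
    rw [← Complex.ofReal_mul, ← Real.rpow_add (by positivity)]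
    simp [neg_div]
  · refine hF.ae_eq (Filter.Eventually.of_forall fun x => ?_)
    simp only []
    rw [← mul_assoc, hw, ← Complex.ofReal_mul, ← Real.rpow_add (by positivity)]
    simp [neg_div]

theorem IsFourierDensity.ae_eq {d : ℕ} {u : 𝓢'(EuclideanSpace ℝ (Fin d), ℂ)}
    {f g : EuclideanSpace ℝ (Fin d) → ℂ} (hf : IsFourierDensity u f)
    (hg : IsFourierDensity u g) : f =ᵐ[volume] g := by
  have h := ae_eq_zero_of_integral_contDiff_smul_eq_zero (hf.1.sub hg.1) (fun φ hφ hc => ?_)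
  · filter_upwards [h] with x hx
    simpa [sub_eq_zero] using hx
  · have hφ' : ContDiff ℝ (⊤ : ℕ∞) (fun x => (φ x : ℂ)) := Complex.ofRealCLM.contDiff.comp hφ
    have hc' : HasCompactSupport (fun x => (φ x : ℂ)) :=
      hc.comp_left (g := fun r : ℝ => (r : ℂ)) (by simp)
    obtain ⟨i1, e1⟩ := hf.2 (hc'.toSchwartzMap hφ')
    obtain ⟨i2, e2⟩ := hg.2 (hc'.toSchwartzMap hφ')
    have h3 := e1.symm.trans e2
    rw [← sub_eq_zero, ← integral_sub i1 i2] at h3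
    rw [← h3]
    congr 1
    ext x
    simp [mul_sub]

theorem isFourierDensity_fourierDensity {d : ℕ} {s : ℝ}
    {u : 𝓢'(EuclideanSpace ℝ (Fin d), ℂ)} (hu : u ∈ sobolevSpace d s) :
    IsFourierDensity u (fourierDensity u) := by
  obtain ⟨f, hf, _⟩ := exists_isFourierDensity hu
  have h : ∃ f, IsFourierDensity u f := ⟨f, hf⟩
  rw [fourierDensity, dif_pos h]
  exact h.choose_spec

theorem ae_comp_smul {d : ℕ} {r : ℝ} (hr : r ≠ 0) {f g : EuclideanSpace ℝ (Fin d) → ℂ}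
    (h : f =ᵐ[volume] g) : ∀ᵐ x : EuclideanSpace ℝ (Fin d), f (r • x) = g (r • x) := by
  have hq : Measure.QuasiMeasurePreserving (fun x : EuclideanSpace ℝ (Fin d) => r • x) := by
    refine ⟨by fun_prop, ?_⟩
    rw [Measure.map_addHaar_smul _ hr]
    exact Measure.smul_absolutelyContinuous
  exact hq.ae h

theorem fourierHat_add {d : ℕ} {s : ℝ} {u v : 𝓢'(EuclideanSpace ℝ (Fin d), ℂ)}
    (hu : u ∈ sobolevSpace d s) (hv : v ∈ sobolevSpace d s) :
    fourierHat (u + v) =ᵐ[volume] fun ξ => fourierHat u ξ + fourierHat v ξ := by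
  have hu' := isFourierDensity_fourierDensity hu
  have hv' := isFourierDensity_fourierDensity hv
  have h : IsFourierDensity (u + v) (fun x => fourierDensity u x + fourierDensity v x) := by
    refine ⟨hu'.1.add hv'.1, fun g => ?_⟩
    simp only [mul_add]
    refine ⟨(hu'.2 g).1.add (hv'.2 g).1, ?_⟩
    rw [integral_add (hu'.2 g).1 (hv'.2 g).1, ← (hu'.2 g).2, ← (hv'.2 g).2]
    simp [FourierTransform.fourier_add]
  have h2 := (isFourierDensity_fourierDensity (add_mem hu hv)).ae_eq h
  filter_upwards [ae_comp_smul (inv_ne_zero Real.two_pi_pos.ne') h2] with ξ hξ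
  simp only [fourierHat]
  rw [hξ, mul_add]

theorem fourierHat_smul {d : ℕ} {s : ℝ} {u : 𝓢'(EuclideanSpace ℝ (Fin d), ℂ)}
    (c : ℂ) (hu : u ∈ sobolevSpace d s) :
    fourierHat (c • u) =ᵐ[volume] fun ξ => c * fourierHat u ξ := by
  have hu' := isFourierDensity_fourierDensity hu
  have h : IsFourierDensity (c • u) (fun x => c * fourierDensity u x) := by
    refine ⟨hu'.1.smul c, fun g => ?_⟩
    simp only [mul_left_comm _ c]
    refine ⟨(hu'.2 g).1.const_mul c, ?_⟩
    rw [integral_const_mul, ← (hu'.2 g).2]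
    simp [FourierTransform.fourier_smul]
  have h2 := (isFourierDensity_fourierDensity (Submodule.smul_mem _ c hu)).ae_eq h
  filter_upwards [ae_comp_smul (inv_ne_zero Real.two_pi_pos.ne') h2] with ξ hξ
  simp only [fourierHat]
  rw [hξ, mul_left_comm]

theorem integrable_sobolev {d : ℕ} {s : ℝ} {u : 𝓢'(EuclideanSpace ℝ (Fin d), ℂ)}
    (hu : u ∈ sobolevSpace d s) :
    Integrable (fun ξ => ((1 : ℝ) ^ 2 + ‖ξ‖ ^ 2) ^ s * ‖fourierHat u ξ‖ ^ 2) := by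
  obtain ⟨f, hf, hf2⟩ := exists_isFourierDensity hu
  have hae := (isFourierDensity_fourierDensity hu).ae_eq hf
  have h1 : Integrable (fun x => (1 + ‖x‖ ^ 2) ^ s * ‖fourierDensity u x‖ ^ 2) := by
    refine ((memLp_two_iff_integrable_sq_norm hf2.1).1 hf2).congr ?_
    filter_upwards [hae] with x hx
    rw [hx, norm_mul, mul_pow, Complex.norm_real, Real.norm_eq_abs, sq_abs,
      ← Real.rpow_mul_natCast (by positivity)]
    norm_num
  set b : ℝ := 2 * Real.pi with hb
  have hb1 : 1 ≤ b := by have := Real.two_le_pi; rw [hb]; linarith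
  have h2 : Integrable (fun x => (1 + (b * ‖x‖) ^ 2) ^ s * ‖fourierDensity u x‖ ^ 2) := by
    have hm : AEStronglyMeasurable (fourierDensity u) :=
      (isFourierDensity_fourierDensity hu).1.aestronglyMeasurable
    refine (h1.const_mul ((b ^ 2) ^ |s|)).mono' ?_ ?_
    · refine AEStronglyMeasurable.mul (Continuous.aestronglyMeasurable ?_) (hm.norm.pow 2)
      exact Continuous.rpow_const (by fun_prop) fun x => Or.inl (by positivity)
    · refine Filter.Eventually.of_forall fun x => ?_
      rw [Real.norm_of_nonneg (by positivity), ← mul_assoc]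
      refine mul_le_mul_of_nonneg_right ?_ (by positivity)
      have l1 : 1 + ‖x‖ ^ 2 ≤ 1 + (b * ‖x‖) ^ 2 := by
        rw [mul_pow]; nlinarith [mul_nonneg (sub_nonneg.2 hb1) (sq_nonneg ‖x‖),
          mul_nonneg (mul_nonneg (sub_nonneg.2 hb1) (sub_nonneg.2 hb1)) (sq_nonneg ‖x‖)]
      have l2 : 1 + (b * ‖x‖) ^ 2 ≤ b ^ 2 * (1 + ‖x‖ ^ 2) := by
        rw [mul_pow]; nlinarith [sq_nonneg ‖x‖, sq_nonneg b]
      rcases le_total 0 s with hs | hs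
      · rw [abs_of_nonneg hs, ← Real.mul_rpow (by positivity) (by positivity)]
        exact Real.rpow_le_rpow (by positivity) l2 hs
      · calc (1 + (b * ‖x‖) ^ 2) ^ s ≤ (1 + ‖x‖ ^ 2) ^ s :=
              Real.rpow_le_rpow_of_nonpos (by positivity) l1 hs
          _ ≤ (b ^ 2) ^ |s| * (1 + ‖x‖ ^ 2) ^ s :=
              le_mul_of_one_le_left (by positivity)
                (Real.one_le_rpow (by nlinarith) (abs_nonneg s))
  have h3 := (h2.comp_smul (inv_ne_zero (zero_lt_one.trans_le hb1).ne')).const_mul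
    ((b ^ (-(d : ℝ) / 2)) ^ 2)
  refine h3.congr (Filter.Eventually.of_forall fun ξ => ?_)
  have hb0 : 0 < b := by linarith
  simp only [fourierHat, ← hb, norm_smul, norm_mul, Complex.norm_real, Real.norm_eq_abs]
  rw [abs_of_pos (inv_pos.2 hb0), mul_inv_cancel_left₀ hb0.ne', mul_pow, sq_abs, one_pow]
  ring

theorem sobolevNorm_add_le {d : ℕ} {s : ℝ} {u v : 𝓢'(EuclideanSpace ℝ (Fin d), ℂ)}
    (hu : u ∈ sobolevSpace d s) (hv : v ∈ sobolevSpace d s) :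
    sobolevNorm 1 s (u + v) ≤ 2 * (sobolevNorm 1 s u + sobolevNorm 1 s v) := by
  have iu := integrable_sobolev hu
  have iv := integrable_sobolev hv
  have h : ∫ ξ, ((1 : ℝ) ^ 2 + ‖ξ‖ ^ 2) ^ s * ‖fourierHat (u + v) ξ‖ ^ 2 ≤
      2 * (∫ ξ, ((1 : ℝ) ^ 2 + ‖ξ‖ ^ 2) ^ s * ‖fourierHat u ξ‖ ^ 2) +
      2 * ∫ ξ, ((1 : ℝ) ^ 2 + ‖ξ‖ ^ 2) ^ s * ‖fourierHat v ξ‖ ^ 2 := by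
    rw [← integral_const_mul, ← integral_const_mul,
      ← integral_add (iu.const_mul 2) (iv.const_mul 2)]
    refine integral_mono_ae (integrable_sobolev (add_mem hu hv))
      ((iu.const_mul 2).add (iv.const_mul 2)) ?_
    filter_upwards [fourierHat_add hu hv] with ξ hξ
    have hw : 0 ≤ ((1 : ℝ) ^ 2 + ‖ξ‖ ^ 2) ^ s := by positivity
    have ht : ‖fourierHat u ξ + fourierHat v ξ‖ ^ 2 ≤
        2 * ‖fourierHat u ξ‖ ^ 2 + 2 * ‖fourierHat v ξ‖ ^ 2 := by
      have := norm_add_le (fourierHat u ξ) (fourierHat v ξ)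
      nlinarith [norm_nonneg (fourierHat u ξ + fourierHat v ξ),
        sq_nonneg (‖fourierHat u ξ‖ - ‖fourierHat v ξ‖)]
    rw [hξ]
    nlinarith [mul_le_mul_of_nonneg_left ht hw]
  have hu0 : 0 ≤ ∫ ξ, ((1 : ℝ) ^ 2 + ‖ξ‖ ^ 2) ^ s * ‖fourierHat u ξ‖ ^ 2 :=
    integral_nonneg fun ξ => by positivity
  have hv0 : 0 ≤ ∫ ξ, ((1 : ℝ) ^ 2 + ‖ξ‖ ^ 2) ^ s * ‖fourierHat v ξ‖ ^ 2 :=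
    integral_nonneg fun ξ => by positivity
  refine Real.sqrt_le_iff.2 ⟨mul_nonneg zero_le_two
    (add_nonneg (Real.sqrt_nonneg _) (Real.sqrt_nonneg _)), h.trans ?_⟩
  simp only [sobolevNorm]
  nlinarith [Real.sq_sqrt hu0, Real.sq_sqrt hv0, Real.sqrt_nonneg
    (∫ ξ, ((1 : ℝ) ^ 2 + ‖ξ‖ ^ 2) ^ s * ‖fourierHat u ξ‖ ^ 2), Real.sqrt_nonneg
    (∫ ξ, ((1 : ℝ) ^ 2 + ‖ξ‖ ^ 2) ^ s * ‖fourierHat v ξ‖ ^ 2), mul_nonneg (Real.sqrt_nonneg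
    (∫ ξ, ((1 : ℝ) ^ 2 + ‖ξ‖ ^ 2) ^ s * ‖fourierHat u ξ‖ ^ 2)) (Real.sqrt_nonneg
    (∫ ξ, ((1 : ℝ) ^ 2 + ‖ξ‖ ^ 2) ^ s * ‖fourierHat v ξ‖ ^ 2))]

theorem sobolevNorm_smul {d : ℕ} {s : ℝ} {u : 𝓢'(EuclideanSpace ℝ (Fin d), ℂ)}
    (c : ℂ) (hu : u ∈ sobolevSpace d s) :
    sobolevNorm 1 s (c • u) = ‖c‖ * sobolevNorm 1 s u := by
  have h : ∫ ξ, ((1 : ℝ) ^ 2 + ‖ξ‖ ^ 2) ^ s * ‖fourierHat (c • u) ξ‖ ^ 2 =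
      ‖c‖ ^ 2 * ∫ ξ, ((1 : ℝ) ^ 2 + ‖ξ‖ ^ 2) ^ s * ‖fourierHat u ξ‖ ^ 2 := by
    rw [← integral_const_mul]
    refine integral_congr_ae ?_
    filter_upwards [fourierHat_smul c hu] with ξ hξ
    rw [hξ, norm_mul, mul_pow]
    ring
  rw [sobolevNorm, h, Real.sqrt_mul (sq_nonneg _), Real.sqrt_sq (norm_nonneg c), sobolevNorm]

/-! ### Sobolev spaces on an open set `Ω ⊆ ℝ^d` -/

/-- A test function on `Ω`, extended by zero, as a Schwartz function on `ℝ^d`. -/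
def testToSchwartz {d : ℕ} (Ω : Opens (EuclideanSpace ℝ (Fin d))) :
    𝓓(Ω, ℂ) →ₗ[ℂ] 𝓢(EuclideanSpace ℝ (Fin d), ℂ) where
  toFun φ := φ.hasCompactSupport.toSchwartzMap φ.contDiff
  map_add' _ _ := by ext; simp
  map_smul' _ _ := by ext; simp

/-- A test function on `Ω`, extended by zero, as a tempered distribution on `ℝ^d`. -/
def testToTempered {d : ℕ} (Ω : Opens (EuclideanSpace ℝ (Fin d))) :
    𝓓(Ω, ℂ) →ₗ[ℂ] 𝓢'(EuclideanSpace ℝ (Fin d), ℂ) :=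
  (SchwartzMap.toTemperedDistributionCLM (EuclideanSpace ℝ (Fin d)) ℂ volume).toLinearMap ∘ₗ
    testToSchwartz Ω

theorem testToTempered_mem {d : ℕ} (s : ℝ) (Ω : Opens (EuclideanSpace ℝ (Fin d)))
    (φ : 𝓓(Ω, ℂ)) : testToTempered Ω φ ∈ sobolevSpace d s :=
  (testToSchwartz Ω φ).memSobolev

/-- The space `H̃^s(Ω)`: the closure of the test functions on `Ω` in `H^s(ℝ^d)`.
It carries the norms `sobolevNorm k s` of `H^s(ℝ^d)`. -/
def sobolevTilde {d : ℕ} (s : ℝ) (Ω : Opens (EuclideanSpace ℝ (Fin d))) :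
    Submodule ℂ 𝓢'(EuclideanSpace ℝ (Fin d), ℂ) where
  carrier := {u | u ∈ sobolevSpace d s ∧
    ∀ ε : ℝ, 0 < ε → ∃ φ : 𝓓(Ω, ℂ), sobolevNorm 1 s (u - testToTempered Ω φ) < ε}
  add_mem' := by
    rintro u v ⟨hu, hu'⟩ ⟨hv, hv'⟩
    refine ⟨add_mem hu hv, fun ε hε => ?_⟩
    obtain ⟨φ, hφ⟩ := hu' (ε / 4) (by positivity)
    obtain ⟨ψ, hψ⟩ := hv' (ε / 4) (by positivity)
    refine ⟨φ + ψ, ?_⟩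
    have h := sobolevNorm_add_le (sub_mem hu (testToTempered_mem s Ω φ))
      (sub_mem hv (testToTempered_mem s Ω ψ))
    rw [map_add, add_sub_add_comm]
    linarith
  zero_mem' := by
    refine ⟨zero_mem _, fun ε hε => ⟨0, ?_⟩⟩
    have h := sobolevNorm_smul (s := s) (0 : ℂ) (zero_mem (sobolevSpace d s))
    simp only [smul_zero, norm_zero, zero_mul] at h
    simpa [h] using hε
  smul_mem' := by
    rintro c u ⟨hu, hu'⟩
    refine ⟨Submodule.smul_mem _ c hu, fun ε hε => ?_⟩
    obtain ⟨φ, hφ⟩ := hu' (ε / (‖c‖ + 1)) (by positivity)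
    refine ⟨c • φ, ?_⟩
    rw [map_smul, ← smul_sub, sobolevNorm_smul c (sub_mem hu (testToTempered_mem s Ω φ))]
    rw [lt_div_iff₀ (by positivity)] at hφ
    have : 0 ≤ sobolevNorm 1 s (u - testToTempered Ω φ) := Real.sqrt_nonneg _
    nlinarith

theorem testToTempered_mem_tilde {d : ℕ} (s : ℝ) (Ω : Opens (EuclideanSpace ℝ (Fin d)))
    (φ : 𝓓(Ω, ℂ)) : testToTempered Ω φ ∈ sobolevTilde s Ω := by
  refine ⟨testToTempered_mem s Ω φ, fun ε hε => ⟨φ, ?_⟩⟩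
  have h := sobolevNorm_smul (s := s) (0 : ℂ) (zero_mem (sobolevSpace d s))
  simp only [smul_zero, norm_zero, zero_mul] at h
  simpa [h] using hε

/-- A test function on `Ω` as an element of `H̃^s(Ω)`. -/
def testToTilde {d : ℕ} (s : ℝ) (Ω : Opens (EuclideanSpace ℝ (Fin d))) (φ : 𝓓(Ω, ℂ)) :
    sobolevTilde s Ω :=
  ⟨testToTempered Ω φ, testToTempered_mem_tilde s Ω φ⟩

/-- The restriction `U|_Ω` of a tempered distribution to `Ω`, as a functional on test functions. -/
def restrictDistribution {d : ℕ} (Ω : Opens (EuclideanSpace ℝ (Fin d))) :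
    𝓢'(EuclideanSpace ℝ (Fin d), ℂ) →ₗ[ℂ] (𝓓(Ω, ℂ) →ₗ[ℂ] ℂ) where
  toFun U :=
    { toFun := fun φ => U (testToSchwartz Ω φ)
      map_add' := fun _ _ => by simp
      map_smul' := fun _ _ => by simp }
  map_add' _ _ := by ext; rfl
  map_smul' _ _ := by ext; rfl

/-- The space `H^s(Ω)` of distributions on `Ω` that are restrictions of elements of `H^s(ℝ^d)`.
(A functional on test functions that is the restriction of a tempered distribution is
automatically continuous, so nothing is lost by viewing distributions as linear functionals.) -/
def sobolevOn {d : ℕ} (s : ℝ) (Ω : Opens (EuclideanSpace ℝ (Fin d))) :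
    Submodule ℂ (𝓓(Ω, ℂ) →ₗ[ℂ] ℂ) :=
  (sobolevSpace d s).map (restrictDistribution Ω)

/-- The norm `‖u‖_{H^s_k(Ω)} = inf {‖U‖_{H^s_k(ℝ^d)} : U ∈ H^s(ℝ^d), U|_Ω = u}`. -/
def sobolevOnNorm {d : ℕ} {Ω : Opens (EuclideanSpace ℝ (Fin d))} (k s : ℝ)
    (u : sobolevOn s Ω) : ℝ :=
  sInf {r | ∃ U ∈ sobolevSpace d s, restrictDistribution Ω U = u ∧ r = sobolevNorm k s U}

/-- The duality pairing `⟨u, v⟩_{H^s(Ω) × H̃^{-s}(Ω)} = ⟨U, v⟩`, where `U ∈ H^s(ℝ^d)` is an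
extension of `u` (the value does not depend on which). Linear in `u`, antilinear in `v`. -/
def sobolevOnPairing {d : ℕ} {Ω : Opens (EuclideanSpace ℝ (Fin d))} {s : ℝ}
    (u : sobolevOn s Ω) (v : sobolevTilde (-s) Ω) : ℂ :=
  sobolevPairing (Submodule.mem_map.1 u.2).choose (v : 𝓢'(EuclideanSpace ℝ (Fin d), ℂ))

/-! ### The fundamental solution of the Helmholtz equation -/

/-- The Bessel function `J₀`, by its power series. -/
def besselJZero (x : ℝ) : ℝ :=
  ∑' m : ℕ, (-1) ^ m * (x ^ 2 / 4) ^ m / (m.factorial : ℝ) ^ 2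

/-- The Bessel function of the second kind
`Y₀(x) = (2/π) (log (x/2) + γ) J₀(x) - (2/π) ∑ (-1)^m (1 + 1/2 + ⋯ + 1/m) (x²/4)^m / (m!)²`,
for `x > 0`. -/
def besselYZero (x : ℝ) : ℝ :=
  2 / Real.pi * (Real.log (x / 2) + Real.eulerMascheroniConstant) * besselJZero x -
    2 / Real.pi * ∑' m : ℕ, (-1) ^ m * ((harmonic m : ℚ) : ℝ) * (x ^ 2 / 4) ^ m /
      (m.factorial : ℝ) ^ 2

/-- The Hankel function `H₀⁽¹⁾(x) = J₀(x) + i Y₀(x)`, for `x > 0`. -/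
def hankelZero (x : ℝ) : ℂ :=
  (besselJZero x : ℂ) + Complex.I * (besselYZero x : ℂ)

/-- The fundamental solution `Φ(x, y)` of the Helmholtz equation in `ℝ^n`, for `n = 3` and
`n = 2`. -/
def helmholtzFundamental {n : ℕ} (k : ℝ) (x y : EuclideanSpace ℝ (Fin n)) : ℂ :=
  if n = 3 then
    Complex.exp (Complex.I * ((k * ‖x - y‖ : ℝ) : ℂ)) / ((4 * Real.pi * ‖x - y‖ : ℝ) : ℂ)
  else
    Complex.I / 4 * hankelZero (k * ‖x - y‖)

/-! ### Planar screens and the single-layer operator -/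

/-- The hyperplane `Γ_∞ = {x ∈ ℝ^{d+1} : x_{d+1} = 0}`. -/
def screenPlane (d : ℕ) : Set (EuclideanSpace ℝ (Fin (d + 1))) :=
  {x | x (Fin.last d) = 0}

/-- The identification `x̃ ↦ (x̃, 0)` of `ℝ^d` with `Γ_∞ ⊆ ℝ^{d+1}`. -/
def planeEmbedding {d : ℕ} (x : EuclideanSpace ℝ (Fin d)) : EuclideanSpace ℝ (Fin (d + 1)) :=
  WithLp.toLp 2 (Fin.snoc (fun i => x i) 0)

theorem continuous_planeEmbedding {d : ℕ} :
    Continuous (planeEmbedding : EuclideanSpace ℝ (Fin d) → EuclideanSpace ℝ (Fin (d + 1))) := by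
  refine (PiLp.continuous_toLp 2 _).comp (continuous_pi fun i => ?_)
  refine Fin.lastCases ?_ (fun j => ?_) i
  · simpa using continuous_const
  · simp only [Fin.snoc_castSucc]
    fun_prop

theorem planeEmbedding_mem {d : ℕ} (x : EuclideanSpace ℝ (Fin d)) :
    planeEmbedding x ∈ screenPlane d := by
  simp [planeEmbedding, screenPlane]

/-- A planar screen in `ℝ^{d+1}`: a bounded, relatively open subset of the hyperplane `Γ_∞`. -/
structure PlanarScreen (d : ℕ) where
  /-- The underlying subset `Γ` of `ℝ^{d+1}`. -/
  carrier : Set (EuclideanSpace ℝ (Fin (d + 1)))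
  isBounded : Bornology.IsBounded carrier
  relativelyOpen : ∃ U, IsOpen U ∧ carrier = U ∩ screenPlane d

/-- The open set `Γ̃ = {x̃ ∈ ℝ^d : (x̃, 0) ∈ Γ}` identified with the screen `Γ`. -/
def PlanarScreen.chart {d : ℕ} (Γ : PlanarScreen d) : Opens (EuclideanSpace ℝ (Fin d)) where
  carrier := {x | planeEmbedding x ∈ Γ.carrier}
  is_open' := by
    obtain ⟨U, hU, h⟩ := Γ.relativelyOpen
    have : {x | planeEmbedding x ∈ Γ.carrier} = planeEmbedding ⁻¹' U := by
      ext x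
      simp [h, planeEmbedding_mem]
    rw [this]
    exact hU.preimage continuous_planeEmbedding

/-- The integral `∫_Γ Φ(x, y) φ(y) ds(y)`, at the point `x = (x̃, 0)`, for a test function `φ`
on the screen. -/
def singleLayerIntegral {d : ℕ} (k : ℝ) (Γ : PlanarScreen d) (φ : 𝓓(Γ.chart, ℂ))
    (x : EuclideanSpace ℝ (Fin d)) : ℂ :=
  ∫ y in (Γ.chart : Set (EuclideanSpace ℝ (Fin d))),
    helmholtzFundamental k (planeEmbedding x) (planeEmbedding y) * φ y

/-- `S` is the single-layer operator `S_k : H̃^{-1/2}(Γ) → H^{1/2}(Γ)`: a bounded linear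
operator that on (the dense subspace of) test functions is given by
`S_k φ(x) = ∫_Γ Φ(x, y) φ(y) ds(y)`, `x ∈ Γ`. -/
structure IsSingleLayerOperator {d : ℕ} (k : ℝ) (Γ : PlanarScreen d)
    (S : sobolevTilde (-(1 / 2)) Γ.chart →ₗ[ℂ] sobolevOn (1 / 2) Γ.chart) : Prop where
  bounded : ∃ C : ℝ, ∀ φ : sobolevTilde (-(1 / 2)) Γ.chart,
    sobolevOnNorm k (1 / 2) (S φ) ≤ C * sobolevNorm k (-(1 / 2)) φ.1
  apply_test : ∀ φ ψ : 𝓓(Γ.chart, ℂ),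
    (S (testToTilde (-(1 / 2)) Γ.chart φ) : 𝓓(Γ.chart, ℂ) →ₗ[ℂ] ℂ) ψ =
      ∫ x in (Γ.chart : Set (EuclideanSpace ℝ (Fin d))), singleLayerIntegral k Γ φ x * ψ x

end

/-!
# Coercivity of the single-layer operator on a planar screen

On a screen contained in a hyperplane, the single-layer operator is the convolution on `ℝ^d` with
the trace of the fundamental solution, `x ↦ Φ(|x|)`. For the operator `-Δ + z` on `ℝ^(d+1)`, with `z
> 0`, the fundamental solution is an integral of heat kernels (`heatIntegral`), and convolution with
its trace on the hyperplane has the symbol `½ (|ξ|² + z)^(-1/2)` (`fourier_heatIntegral`). The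
closed form `yukawaKernel` of this kernel is holomorphic in `z ∈ ℂ \ (-∞, 0]`, and it tends to the
Helmholtz kernel as `z` tends to `-k²` from the lower half plane
(`tendsto_yukawaKernel_limitingPoint`).

**Coercivity.** For test functions `φ`, `ψ` the form is `∫ Φ(|x|) c(x) dx`, where `c` is the
correlation of `φ` and `ψ`, a continuous function of compact support. With `yukawaKernel d z` in
place of `Φ`, it equals `½ ∫ (|ξ|² + z)^(-1/2) φ̂(ξ) ψ̂(-ξ) dξ` for `z > 0`, hence for all `z` off
the cut, by the identity theorem (`integral_yukawaKernel_mul_correlation`). For `ψ = φ̄`, `Im z < 0`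
and `|z| = k²` the factor `(|ξ|² + z)^(-1/2)` lies in the first quadrant and has modulus at least
`(|ξ|² + k²)^(-1/2)`, while the remaining factor is `|φ̂|² ≥ 0`. Since `√2 |w| ≥ Re w + Im w`, the
form is at least `½ · 2^(-1/2) ‖φ‖²` in modulus (`le_norm_integral_cpow`), uniformly in `z`, and
dominated convergence gives the bound for `Φ` itself (`le_norm_integral_helmholtzRadial`). In this
way the Fourier transform of the oscillating kernel `Φ`, which is not integrable and has an
unbounded symbol `½ (|ξ|² - k²)^(-1/2)`, is never needed.

**Boundedness.** As the screen is bounded, `Φ` may be changed at large distances. It differs from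
the kernel for `z = k²` by a `C¹` function of the distance (`exists_contDiff_helmholtzRadial_eq`);
with this difference cut off, the kernel becomes integrable, and its Fourier transform is bounded by
a multiple of `(k² + |ξ|²)^(-1/2)` (`exists_integrable_eq_helmholtzRadial`). Hence it defines a
bounded Fourier multiplier from `H^(-1/2)` to `H^(1/2)`; the maps `sobolevToL2` turn it into a
bounded operator `M` on `L²`, and the form into `⟨h, M h⟩`, so that the estimate extends from test
functions to `H̃^(-1/2)` by density.

For `d = 1` the kernel is `K₀(r √z) / (2π)`. The Hankel function is given by its power series, so
the series of `K₀` is derived from the integral representation, by the uniqueness of solutions of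
the Bessel equation with given behaviour at the origin (`macdonaldIntegral_zero_eq_series`).
-/

noncomputable section

/-! ### Sobolev spaces as weighted `L²` spaces -/

/-- The weight `(k² + |2πη|²)^(s/2)` of the `H^s_k` norm, in the frequency variable `η = ξ / (2π)`
of Mathlib's Fourier transform. -/
def sobolevWeight {d : ℕ} (k s : ℝ) (η : EuclideanSpace ℝ (Fin d)) : ℝ :=
  (k ^ 2 + (2 * Real.pi * ‖η‖) ^ 2) ^ (s / 2)

theorem sobolevWeight_pos {d : ℕ} {k : ℝ} (hk : 0 < k) (s : ℝ) (η : EuclideanSpace ℝ (Fin d)) :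
    0 < sobolevWeight k s η := by
  unfold sobolevWeight; positivity

theorem continuous_sobolevWeight {d : ℕ} {k : ℝ} (hk : 0 < k) (s : ℝ) :
    Continuous (sobolevWeight k s : EuclideanSpace ℝ (Fin d) → ℝ) := by
  unfold sobolevWeight
  exact Continuous.rpow_const (by fun_prop) fun x => Or.inl (by positivity)

theorem sobolevWeight_add {d : ℕ} {k : ℝ} (hk : 0 < k) (s t : ℝ)
    (η : EuclideanSpace ℝ (Fin d)) :
    sobolevWeight k (s + t) η = sobolevWeight k s η * sobolevWeight k t η := by
  unfold sobolevWeight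
  rw [← Real.rpow_add (by positivity), add_div]

theorem sobolevWeight_mul_neg {d : ℕ} {k : ℝ} (hk : 0 < k) (s : ℝ)
    (η : EuclideanSpace ℝ (Fin d)) : sobolevWeight k s η * sobolevWeight k (-s) η = 1 := by
  rw [← sobolevWeight_add hk, add_neg_cancel]
  simp [sobolevWeight]

/-- All the weights `(a + b |η|²)^t`, with `a, b > 0` and `t` fixed, are comparable. -/
theorem exists_rpow_le_mul_rpow {a b a' b' : ℝ} (ha : 0 < a) (hb : 0 < b) (ha' : 0 < a')
    (hb' : 0 < b') (t : ℝ) :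
    ∃ C, 0 < C ∧ ∀ x : ℝ, 0 ≤ x → (a + b * x) ^ t ≤ C * (a' + b' * x) ^ t := by
  refine ⟨max (max (a / a') (b / b') ^ t) (min (a / a') (b / b') ^ t), by positivity,
    fun x hx => ?_⟩
  have h1 : a + b * x ≤ max (a / a') (b / b') * (a' + b' * x) := by
    have e1 : a = a / a' * a' := by field_simp
    have e2 : b * x = b / b' * (b' * x) := by field_simp
    calc a + b * x = a / a' * a' + b / b' * (b' * x) := by rw [← e1, ← e2]
      _ ≤ max (a / a') (b / b') * a' + max (a / a') (b / b') * (b' * x) := by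
        gcongr
        · exact le_max_left _ _
        · exact le_max_right _ _
      _ = _ := by ring
  have h2 : min (a / a') (b / b') * (a' + b' * x) ≤ a + b * x := by
    have e1 : a = a / a' * a' := by field_simp
    have e2 : b * x = b / b' * (b' * x) := by field_simp
    calc _ = min (a / a') (b / b') * a' + min (a / a') (b / b') * (b' * x) := by ring
      _ ≤ a / a' * a' + b / b' * (b' * x) := by
        gcongr
        · exact min_le_left _ _
        · exact min_le_right _ _
      _ = _ := by rw [← e1, ← e2]
  rcases le_total 0 t with ht | ht
  · calc (a + b * x) ^ t ≤ (max (a / a') (b / b') * (a' + b' * x)) ^ t :=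
          Real.rpow_le_rpow (by positivity) h1 ht
      _ = max (a / a') (b / b') ^ t * (a' + b' * x) ^ t :=
          Real.mul_rpow (by positivity) (by positivity)
      _ ≤ _ := by gcongr; exact le_max_left _ _
  · calc (a + b * x) ^ t ≤ (min (a / a') (b / b') * (a' + b' * x)) ^ t :=
          Real.rpow_le_rpow_of_nonpos (by positivity) h2 ht
      _ = min (a / a') (b / b') ^ t * (a' + b' * x) ^ t :=
          Real.mul_rpow (by positivity) (by positivity)
      _ ≤ _ := by gcongr; exact le_max_right _ _

theorem exists_sobolevWeight_le {k k' : ℝ} (hk : 0 < k) (hk' : 0 < k') (d : ℕ) (s : ℝ) :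
    ∃ C, 0 < C ∧ ∀ η : EuclideanSpace ℝ (Fin d),
      sobolevWeight k s η ≤ C * sobolevWeight k' s η := by
  obtain ⟨C, hC, h⟩ := exists_rpow_le_mul_rpow (a := k ^ 2) (b := (2 * Real.pi) ^ 2)
    (a' := k' ^ 2) (b' := (2 * Real.pi) ^ 2) (by positivity) (by positivity) (by positivity)
    (by positivity) (s / 2)
  refine ⟨C, hC, fun η => ?_⟩
  simpa only [sobolevWeight, mul_pow] using h (‖η‖ ^ 2) (by positivity)

theorem memLp_sobolevWeight_mul {d : ℕ} {k s : ℝ} (hk : 0 < k)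
    {u : 𝓢'(EuclideanSpace ℝ (Fin d), ℂ)} (hu : u ∈ sobolevSpace d s) :
    MemLp (fun η => (sobolevWeight k s η : ℂ) * fourierDensity u η) 2 := by
  obtain ⟨f, hf, hf2⟩ := exists_isFourierDensity hu
  have hae := (isFourierDensity_fourierDensity hu).ae_eq hf
  obtain ⟨C, hC, h⟩ := exists_rpow_le_mul_rpow (a := k ^ 2) (b := (2 * Real.pi) ^ 2)
    (a' := 1) (b' := 1) (by positivity) (by positivity) (by positivity)
    (by positivity) (s / 2)
  refine MemLp.of_le_mul (c := C) hf2 ?_ ?_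
  · exact (Complex.continuous_ofReal.comp
      (continuous_sobolevWeight hk s)).aestronglyMeasurable.mul
      (isFourierDensity_fourierDensity hu).1.aestronglyMeasurable
  · filter_upwards [hae] with η hη
    rw [hη, norm_mul, norm_mul, ← mul_assoc, Complex.norm_real, Complex.norm_real,
      Real.norm_of_nonneg (sobolevWeight_pos hk s η).le, Real.norm_of_nonneg (by positivity)]
    gcongr
    simpa only [sobolevWeight, mul_pow, one_mul] using h (‖η‖ ^ 2) (by positivity)

theorem fourierDensity_add {d : ℕ} {s : ℝ} {u v : 𝓢'(EuclideanSpace ℝ (Fin d), ℂ)}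
    (hu : u ∈ sobolevSpace d s) (hv : v ∈ sobolevSpace d s) :
    fourierDensity (u + v) =ᵐ[volume] fun ξ => fourierDensity u ξ + fourierDensity v ξ := by
  have hu' := isFourierDensity_fourierDensity hu
  have hv' := isFourierDensity_fourierDensity hv
  refine (isFourierDensity_fourierDensity (add_mem hu hv)).ae_eq ⟨hu'.1.add hv'.1, fun g => ?_⟩
  simp only [mul_add]
  refine ⟨(hu'.2 g).1.add (hv'.2 g).1, ?_⟩
  rw [integral_add (hu'.2 g).1 (hv'.2 g).1, ← (hu'.2 g).2, ← (hv'.2 g).2]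
  simp [FourierTransform.fourier_add]

theorem fourierDensity_smul {d : ℕ} {s : ℝ} {u : 𝓢'(EuclideanSpace ℝ (Fin d), ℂ)}
    (c : ℂ) (hu : u ∈ sobolevSpace d s) :
    fourierDensity (c • u) =ᵐ[volume] fun ξ => c * fourierDensity u ξ := by
  have hu' := isFourierDensity_fourierDensity hu
  refine (isFourierDensity_fourierDensity (Submodule.smul_mem _ c hu)).ae_eq
    ⟨hu'.1.smul c, fun g => ?_⟩
  simp only [mul_left_comm _ c]
  refine ⟨(hu'.2 g).1.const_mul c, ?_⟩
  rw [integral_const_mul, ← (hu'.2 g).2]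
  simp [FourierTransform.fourier_smul]

/-- The map `u ↦ (k² + |2πη|²)^(s/2) 𝓕u(η)`, an isometry of `H^s(ℝ^d)` with the norm
`‖·‖_{H^s_k}` into `L²(ℝ^d)`. -/
def sobolevToL2 {d : ℕ} {k : ℝ} (hk : 0 < k) (s : ℝ) :
    sobolevSpace d s →ₗ[ℂ] Lp ℂ 2 (volume : Measure (EuclideanSpace ℝ (Fin d))) where
  toFun u := (memLp_sobolevWeight_mul hk u.2).toLp
  map_add' u v := by
    rw [← MemLp.toLp_add]
    refine MemLp.toLp_congr _ _ ?_
    filter_upwards [fourierDensity_add u.2 v.2] with η hη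
    simp only [Submodule.coe_add, Pi.add_apply, hη, mul_add]
  map_smul' c u := by
    rw [← MemLp.toLp_const_smul]
    refine MemLp.toLp_congr _ _ ?_
    filter_upwards [fourierDensity_smul c u.2] with η hη
    simp only [Submodule.coe_smul, Pi.smul_apply, hη, smul_eq_mul, RingHom.id_apply]
    ring

theorem coeFn_sobolevToL2 {d : ℕ} {k : ℝ} (hk : 0 < k) {s : ℝ} (u : sobolevSpace d s) :
    sobolevToL2 hk s u =ᵐ[volume]
      fun η => (sobolevWeight k s η : ℂ) * fourierDensity u.1 η :=
  (memLp_sobolevWeight_mul hk u.2).coeFn_toLp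

/-- The change of variables `ξ = 2πη` between the unitary Fourier transform `fourierHat` and
Mathlib's. -/
theorem integral_comp_two_pi_inv_smul {d : ℕ} {F : Type*} [NormedAddCommGroup F] [NormedSpace ℝ F]
    (f : EuclideanSpace ℝ (Fin d) → F) :
    ∫ ξ, (((2 * Real.pi) ^ (-(d : ℝ) / 2) : ℝ) ^ 2) • f ((2 * Real.pi)⁻¹ • ξ) = ∫ η, f η := by
  have hp := Real.two_pi_pos
  rw [integral_smul, Measure.integral_comp_smul]
  simp only [finrank_euclideanSpace, Fintype.card_fin, inv_pow, inv_inv]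
  rw [abs_of_pos (by positivity), smul_smul, ← Real.rpow_natCast (2 * Real.pi) d,
    ← Real.rpow_mul_natCast hp.le, ← Real.rpow_add hp]
  simp

theorem norm_sobolevToL2 {d : ℕ} {k : ℝ} (hk : 0 < k) {s : ℝ} (u : sobolevSpace d s) :
    ‖sobolevToL2 hk s u‖ = sobolevNorm k s u.1 := by
  have hp := Real.two_pi_pos
  have h1 : ‖sobolevToL2 hk s u‖ ^ 2 =
      ∫ η, (k ^ 2 + (2 * Real.pi * ‖η‖) ^ 2) ^ s * ‖fourierDensity u.1 η‖ ^ 2 := by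
    have h := (L2.inner_def (𝕜 := ℂ) (sobolevToL2 hk s u) (sobolevToL2 hk s u))
    rw [inner_self_eq_norm_sq_to_K] at h
    have h2 : (∫ η, inner ℂ (sobolevToL2 hk s u η) (sobolevToL2 hk s u η)) =
        ((∫ η, (k ^ 2 + (2 * Real.pi * ‖η‖) ^ 2) ^ s * ‖fourierDensity u.1 η‖ ^ 2 : ℝ) : ℂ) := by
      rw [← integral_complex_ofReal]
      refine integral_congr_ae ?_
      filter_upwards [coeFn_sobolevToL2 hk u] with η hη
      rw [hη, inner_self_eq_norm_sq_to_K, norm_mul, Complex.norm_real, Real.norm_eq_abs,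
        sobolevWeight]
      have e : ((k ^ 2 + (2 * Real.pi * ‖η‖) ^ 2) ^ (s / 2)) ^ 2 =
          (k ^ 2 + (2 * Real.pi * ‖η‖) ^ 2) ^ s := by
        rw [← Real.rpow_mul_natCast (by positivity)]
        norm_num
      rw [← e, ← sq_abs ((k ^ 2 + (2 * Real.pi * ‖η‖) ^ 2) ^ (s / 2)), ← mul_pow]
      push_cast
      rfl
    rw [h2] at h
    exact Complex.ofReal_injective (by simpa using h)
  have h2 : ∫ ξ, (k ^ 2 + ‖ξ‖ ^ 2) ^ s * ‖fourierHat u.1 ξ‖ ^ 2 = ‖sobolevToL2 hk s u‖ ^ 2 := by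
    rw [h1]
    rw [← integral_comp_two_pi_inv_smul (fun η =>
      (k ^ 2 + (2 * Real.pi * ‖η‖) ^ 2) ^ s * ‖fourierDensity u.1 η‖ ^ 2)]
    congr 1
    ext ξ
    simp only [fourierHat, norm_smul, norm_mul, Complex.norm_real, Real.norm_eq_abs]
    rw [abs_of_pos (inv_pos.2 hp), mul_inv_cancel_left₀ hp.ne', mul_pow, sq_abs, smul_eq_mul]
    ring
  rw [sobolevNorm, h2, Real.sqrt_sq (norm_nonneg _)]

theorem sobolevPairing_eq_integral {d : ℕ} (u v : 𝓢'(EuclideanSpace ℝ (Fin d), ℂ)) :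
    sobolevPairing u v = ∫ η, fourierDensity u η * starRingEnd ℂ (fourierDensity v η) := by
  have hp := Real.two_pi_pos
  rw [← integral_comp_two_pi_inv_smul (fun η =>
    fourierDensity u η * starRingEnd ℂ (fourierDensity v η)), sobolevPairing]
  congr 1
  ext ξ
  simp only [fourierHat, map_mul, Complex.conj_ofReal, Complex.real_smul, Complex.ofReal_pow]
  ring

theorem sobolevPairing_eq_inner {d : ℕ} {k : ℝ} (hk : 0 < k) {s : ℝ} (u : sobolevSpace d s)
    (v : sobolevSpace d (-s)) :
    sobolevPairing u.1 v.1 = inner ℂ (sobolevToL2 hk (-s) v) (sobolevToL2 hk s u) := by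
  rw [sobolevPairing_eq_integral, L2.inner_def]
  refine integral_congr_ae ?_
  filter_upwards [coeFn_sobolevToL2 hk u, coeFn_sobolevToL2 hk v] with η h1 h2
  rw [h1, h2, RCLike.inner_apply, map_mul, Complex.conj_ofReal]
  have h3 : (sobolevWeight k s η : ℂ) * (sobolevWeight k (-s) η : ℂ) = 1 := by
    exact_mod_cast sobolevWeight_mul_neg hk s η
  linear_combination (-(fourierDensity u.1 η * starRingEnd ℂ (fourierDensity v.1 η))) * h3

theorem eq_zero_of_sobolevToL2_eq_zero {d : ℕ} {k : ℝ} (hk : 0 < k) {s : ℝ} (u : sobolevSpace d s)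
    (h : sobolevToL2 hk s u = 0) : u = 0 := by
  have h1 : fourierDensity u.1 =ᵐ[volume] 0 := by
    filter_upwards [coeFn_sobolevToL2 hk u, (Lp.eq_zero_iff_ae_eq_zero).1 h] with η h1 h2
    rw [h2] at h1
    have := (sobolevWeight_pos hk s η).ne'
    simpa [this] using h1.symm
  have h2 : 𝓕 u.1 = 0 := by
    ext g
    rw [((isFourierDensity_fourierDensity u.2).2 g).2]
    rw [integral_eq_zero_of_ae]
    · rfl
    · filter_upwards [h1] with η hη
      simp [hη]
  ext1
  have h3 : 𝓕⁻ (𝓕 u.1) = u.1 := FourierTransform.fourierInv_fourier_eq u.1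
  rw [← h3, h2]
  ext g
  simp

/-- For `s ≥ 0` every `h ∈ L²` is the image of the distribution with Fourier transform
`(k² + |2πη|²)^(-s/2) h`. -/
theorem exists_sobolevToL2_eq {d : ℕ} {k : ℝ} (hk : 0 < k) {s : ℝ} (hs : 0 ≤ s)
    (h : Lp ℂ 2 (volume : Measure (EuclideanSpace ℝ (Fin d)))) :
    ∃ u : sobolevSpace d s, sobolevToL2 hk s u = h := by
  have hw : ∀ η : EuclideanSpace ℝ (Fin d), sobolevWeight k (-s) η ≤ (k ^ 2) ^ (-s / 2) :=
    fun η => Real.rpow_le_rpow_of_nonpos (by positivity)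
      (le_add_of_nonneg_right (sq_nonneg _)) (by linarith)
  have hcw : Continuous (fun η : EuclideanSpace ℝ (Fin d) => (sobolevWeight k (-s) η : ℂ)) :=
    Complex.continuous_ofReal.comp (continuous_sobolevWeight hk _)
  have hm : MemLp (fun η => (sobolevWeight k (-s) η : ℂ) * h η) 2 := by
    refine MemLp.of_le_mul (c := (k ^ 2) ^ (-s / 2)) (Lp.memLp h)
      (hcw.aestronglyMeasurable.mul (Lp.aestronglyMeasurable h))
      (Filter.Eventually.of_forall fun η => ?_)
    rw [norm_mul, Complex.norm_real, Real.norm_of_nonneg (sobolevWeight_pos hk _ η).le]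
    gcongr
    exact hw η
  set U : 𝓢'(EuclideanSpace ℝ (Fin d), ℂ) := 𝓕⁻ (Lp.toTemperedDistribution hm.toLp) with hU
  have hFU : 𝓕 U = Lp.toTemperedDistribution hm.toLp := FourierTransform.fourier_fourierInv_eq _
  have hdens : IsFourierDensity U (fun η => (sobolevWeight k (-s) η : ℂ) * h η) := by
    refine ⟨hm.locallyIntegrable (by norm_num), fun g => ⟨(g.memLp 2).integrable_mul hm, ?_⟩⟩
    rw [hFU, Lp.toTemperedDistribution_apply]
    refine integral_congr_ae ?_
    filter_upwards [hm.coeFn_toLp] with η hη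
    rw [hη, smul_eq_mul]
  obtain ⟨C, hC, hCle⟩ := exists_rpow_le_mul_rpow (a := 1) (b := 1)
    (a' := k ^ 2) (b' := (2 * Real.pi) ^ 2) (by positivity) (by positivity) (by positivity)
    (by positivity) (s / 2)
  have hcb : Continuous (fun η : EuclideanSpace ℝ (Fin d) =>
      (((1 + ‖η‖ ^ 2) ^ (s / 2) : ℝ) : ℂ)) :=
    Complex.continuous_ofReal.comp
      (Continuous.rpow_const (by fun_prop) fun x => Or.inl (by positivity))
  have hm2 : MemLp (fun η => (((1 + ‖η‖ ^ 2) ^ (s / 2) : ℝ) : ℂ) *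
      ((sobolevWeight k (-s) η : ℂ) * h η)) 2 := by
    refine MemLp.of_le_mul (c := C) (Lp.memLp h)
      (hcb.aestronglyMeasurable.mul hm.1) (Filter.Eventually.of_forall fun η => ?_)
    rw [← mul_assoc, norm_mul, norm_mul, Complex.norm_real, Complex.norm_real,
      Real.norm_of_nonneg (sobolevWeight_pos hk _ η).le, Real.norm_of_nonneg (by positivity)]
    gcongr
    have h1 := hCle (‖η‖ ^ 2) (by positivity)
    calc (1 + ‖η‖ ^ 2) ^ (s / 2) * sobolevWeight k (-s) η
        ≤ C * sobolevWeight k s η * sobolevWeight k (-s) η := by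
          gcongr
          · exact (sobolevWeight_pos hk _ η).le
          · simpa only [sobolevWeight, mul_pow, one_mul] using h1
      _ = C := by rw [mul_assoc, sobolevWeight_mul_neg hk, mul_one]
  have hUmem : U ∈ sobolevSpace d s := by
    refine TemperedDistribution.memSobolev_iff_exists_smulLeftCLM_fourier.2 ⟨hm2.toLp, ?_⟩
    ext g
    rw [hFU, TemperedDistribution.smulLeftCLM_apply_apply, Lp.toTemperedDistribution_apply,
      Lp.toTemperedDistribution_apply]
    refine integral_congr_ae ?_
    filter_upwards [hm.coeFn_toLp, hm2.coeFn_toLp] with η h1 h2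
    rw [h1, h2, SchwartzMap.smulLeftCLM_apply_apply (by fun_prop)]
    simp only [smul_eq_mul]
    ring
  refine ⟨⟨U, hUmem⟩, Lp.ext ?_⟩
  filter_upwards [coeFn_sobolevToL2 hk ⟨U, hUmem⟩,
    (isFourierDensity_fourierDensity hUmem).ae_eq hdens] with η h1 h2
  rw [h1, h2, ← mul_assoc, ← Complex.ofReal_mul, sobolevWeight_mul_neg hk, Complex.ofReal_one,
    one_mul]

/-- For `s ≥ 0`, the identification of `H^s(ℝ^d)` with `L²(ℝ^d)` given by `sobolevToL2`. -/
def sobolevEquivL2 {d : ℕ} {k : ℝ} (hk : 0 < k) {s : ℝ} (hs : 0 ≤ s) :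
    sobolevSpace d s ≃ₗ[ℂ] Lp ℂ 2 (volume : Measure (EuclideanSpace ℝ (Fin d))) :=
  LinearEquiv.ofBijective (sobolevToL2 hk s)
    ⟨(injective_iff_map_eq_zero _).2 (eq_zero_of_sobolevToL2_eq_zero hk),
      exists_sobolevToL2_eq hk hs⟩

theorem sobolevToL2_sobolevEquivL2_symm {d : ℕ} {k : ℝ} (hk : 0 < k) {s : ℝ} (hs : 0 ≤ s)
    (h : Lp ℂ 2 (volume : Measure (EuclideanSpace ℝ (Fin d)))) :
    sobolevToL2 hk s ((sobolevEquivL2 hk hs).symm h) = h :=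
  (sobolevEquivL2 hk hs).apply_symm_apply h

/-- The norms `‖·‖_{H^s_k}` for different `k` are equivalent. -/
theorem exists_norm_sobolevToL2_le {k k' : ℝ} (hk : 0 < k) (hk' : 0 < k') (d : ℕ) (s : ℝ) :
    ∃ C, 0 < C ∧ ∀ u : sobolevSpace d s, ‖sobolevToL2 hk s u‖ ≤ C * ‖sobolevToL2 hk' s u‖ := by
  obtain ⟨C, hC, h⟩ := exists_sobolevWeight_le hk hk' d s
  refine ⟨C, hC, fun u => ?_⟩
  refine Lp.norm_le_mul_norm_of_ae_le_mul ?_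
  filter_upwards [coeFn_sobolevToL2 hk u, coeFn_sobolevToL2 hk' u] with η h1 h2
  rw [h1, h2, norm_mul, norm_mul, ← mul_assoc, Complex.norm_real, Complex.norm_real,
      Real.norm_of_nonneg (sobolevWeight_pos hk s η).le,
      Real.norm_of_nonneg (sobolevWeight_pos hk' s η).le]
  gcongr
  exact h η

/-! ### Test functions -/

theorem isFourierDensity_schwartz {d : ℕ} (φ : 𝓢(EuclideanSpace ℝ (Fin d), ℂ)) :
    IsFourierDensity (SchwartzMap.toTemperedDistributionCLM _ ℂ volume φ) (𝓕 φ : 𝓢(_, ℂ)) := by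
  refine ⟨(𝓕 φ : 𝓢(_, ℂ)).integrable.locallyIntegrable, fun g =>
    ⟨(g.memLp 2).integrable_mul ((𝓕 φ : 𝓢(_, ℂ)).memLp 2), ?_⟩⟩
  rw [TemperedDistribution.fourier_toTemperedDistributionCLM_eq]
  exact SchwartzMap.toTemperedDistributionCLM_apply_apply _ _ _

theorem fourierDensity_testToTempered {d : ℕ} {Ω : Opens (EuclideanSpace ℝ (Fin d))}
    (φ : 𝓓(Ω, ℂ)) :
    fourierDensity (testToTempered Ω φ) =ᵐ[volume] (𝓕 (testToSchwartz Ω φ) : 𝓢(_, ℂ)) :=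
  (isFourierDensity_fourierDensity (testToTempered_mem 0 Ω φ)).ae_eq
    (isFourierDensity_schwartz (testToSchwartz Ω φ))

/-- The complex conjugate of a test function. -/
def conjTest {d : ℕ} {Ω : Opens (EuclideanSpace ℝ (Fin d))} (φ : 𝓓(Ω, ℂ)) : 𝓓(Ω, ℂ) where
  toFun x := starRingEnd ℂ (φ x)
  contDiff' := Complex.conjCLE.contDiff.comp φ.contDiff
  hasCompactSupport' := φ.hasCompactSupport.comp_left (map_zero _)
  tsupport_subset' := (closure_mono (Function.support_comp_subset (map_zero _) φ)).trans
    φ.tsupport_subset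

@[simp]
theorem conjTest_apply {d : ℕ} {Ω : Opens (EuclideanSpace ℝ (Fin d))} (φ : 𝓓(Ω, ℂ))
    (x : EuclideanSpace ℝ (Fin d)) : conjTest φ x = starRingEnd ℂ (φ x) := rfl

@[simp]
theorem testToSchwartz_apply {d : ℕ} {Ω : Opens (EuclideanSpace ℝ (Fin d))} (φ : 𝓓(Ω, ℂ))
    (x : EuclideanSpace ℝ (Fin d)) : testToSchwartz Ω φ x = φ x := rfl

@[simp]
theorem conjTest_conjTest {d : ℕ} {Ω : Opens (EuclideanSpace ℝ (Fin d))} (φ : 𝓓(Ω, ℂ)) :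
    conjTest (conjTest φ) = φ := by
  ext x; simp

theorem conj_fourier_conjTest {d : ℕ} {Ω : Opens (EuclideanSpace ℝ (Fin d))} (φ : 𝓓(Ω, ℂ))
    (ξ : EuclideanSpace ℝ (Fin d)) :
    starRingEnd ℂ (𝓕 (testToSchwartz Ω (conjTest φ)) ξ) = 𝓕⁻ (testToSchwartz Ω φ) ξ := by
  rw [SchwartzMap.fourier_coe, SchwartzMap.fourierInv_coe, Real.fourier_eq, Real.fourierInv_eq,
    ← integral_conj]
  congr 1
  ext x
  simp [Circle.smul_def, ← Circle.coe_inv_eq_conj, ← AddChar.map_neg_eq_inv]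

theorem apply_testToSchwartz_eq_integral {d : ℕ} {s : ℝ} (U : sobolevSpace d s)
    {Ω : Opens (EuclideanSpace ℝ (Fin d))} (ψ : 𝓓(Ω, ℂ)) :
    U.1 (testToSchwartz Ω ψ) = ∫ η, 𝓕⁻ (testToSchwartz Ω ψ) η * fourierDensity U.1 η := by
  rw [← ((isFourierDensity_fourierDensity U.2).2 _).2, TemperedDistribution.fourier_apply,
    FourierTransform.fourier_fourierInv_eq]

/-- A test function on `Ω` as an element of `H^s(ℝ^d)`. -/
def testToSobolev {d : ℕ} (s : ℝ) {Ω : Opens (EuclideanSpace ℝ (Fin d))} (φ : 𝓓(Ω, ℂ)) :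
    sobolevSpace d s :=
  ⟨testToTempered Ω φ, testToTempered_mem s Ω φ⟩

/-- The value of a distribution at a test function is a duality pairing. -/
theorem apply_testToSchwartz_eq_sobolevPairing {d : ℕ} {s : ℝ} (U : sobolevSpace d s)
    {Ω : Opens (EuclideanSpace ℝ (Fin d))} (ψ : 𝓓(Ω, ℂ)) :
    U.1 (testToSchwartz Ω ψ) = sobolevPairing U.1 (testToTempered Ω (conjTest ψ)) := by
  rw [apply_testToSchwartz_eq_integral, sobolevPairing_eq_integral]
  refine integral_congr_ae ?_
  filter_upwards [fourierDensity_testToTempered (conjTest ψ)] with η hη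
  rw [hη, conj_fourier_conjTest, mul_comm]

theorem sobolevToL2_testToSobolev {d : ℕ} {k : ℝ} (hk : 0 < k) (s : ℝ)
    {Ω : Opens (EuclideanSpace ℝ (Fin d))} (φ : 𝓓(Ω, ℂ)) :
    sobolevToL2 hk s (testToSobolev s φ) =ᵐ[volume]
      fun η => (sobolevWeight k s η : ℂ) * 𝓕 (testToSchwartz Ω φ) η := by
  filter_upwards [coeFn_sobolevToL2 hk (testToSobolev s φ), fourierDensity_testToTempered φ]
    with η h1 h2
  rw [h1, ← h2]
  rfl

theorem sobolevTilde_le {d : ℕ} (s : ℝ) (Ω : Opens (EuclideanSpace ℝ (Fin d))) :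
    sobolevTilde s Ω ≤ sobolevSpace d s := fun _ hu => hu.1

/-- The isometry `sobolevToL2` on the subspace `H̃^s(Ω)`. -/
def tildeToL2 {d : ℕ} {k : ℝ} (hk : 0 < k) (s : ℝ) (Ω : Opens (EuclideanSpace ℝ (Fin d))) :
    sobolevTilde s Ω →ₗ[ℂ] Lp ℂ 2 (volume : Measure (EuclideanSpace ℝ (Fin d))) :=
  sobolevToL2 hk s ∘ₗ Submodule.inclusion (sobolevTilde_le s Ω)

theorem norm_tildeToL2 {d : ℕ} {k : ℝ} (hk : 0 < k) {s : ℝ}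
    {Ω : Opens (EuclideanSpace ℝ (Fin d))} (u : sobolevTilde s Ω) :
    ‖tildeToL2 hk s Ω u‖ = sobolevNorm k s u.1 :=
  norm_sobolevToL2 hk (Submodule.inclusion (sobolevTilde_le s Ω) u)

theorem tildeToL2_testToTilde {d : ℕ} {k : ℝ} (hk : 0 < k) (s : ℝ)
    {Ω : Opens (EuclideanSpace ℝ (Fin d))} (φ : 𝓓(Ω, ℂ)) :
    tildeToL2 hk s Ω (testToTilde s Ω φ) = sobolevToL2 hk s (testToSobolev s φ) := rfl

/-- Test functions are dense in `H̃^s(Ω)` for every one of the norms `‖·‖_{H^s_k}`. -/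
theorem exists_norm_tildeToL2_sub_lt {d : ℕ} {k : ℝ} (hk : 0 < k) {s : ℝ}
    {Ω : Opens (EuclideanSpace ℝ (Fin d))} (u : sobolevTilde s Ω) {ε : ℝ} (hε : 0 < ε) :
    ∃ φ : 𝓓(Ω, ℂ), ‖tildeToL2 hk s Ω (u - testToTilde s Ω φ)‖ < ε := by
  obtain ⟨C, hC, h⟩ := exists_norm_sobolevToL2_le hk one_pos d s
  obtain ⟨φ, hφ⟩ := u.2.2 (ε / C) (by positivity)
  refine ⟨φ, ?_⟩
  have h1 := h (Submodule.inclusion (sobolevTilde_le s Ω) (u - testToTilde s Ω φ))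
  rw [norm_sobolevToL2 one_pos] at h1
  refine h1.trans_lt ?_
  rw [lt_div_iff₀ hC, mul_comm] at hφ
  exact hφ

/-- Closed conditions on elements of `H̃^s(Ω)` need only be checked on test functions. -/
theorem tildeToL2_mem_of_isClosed {d : ℕ} {k : ℝ} (hk : 0 < k) {s : ℝ}
    {Ω : Opens (EuclideanSpace ℝ (Fin d))}
    {A : Set (Lp ℂ 2 (volume : Measure (EuclideanSpace ℝ (Fin d))))} (hA : IsClosed A)
    (h : ∀ φ : 𝓓(Ω, ℂ), sobolevToL2 hk s (testToSobolev s φ) ∈ A) (u : sobolevTilde s Ω) :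
    tildeToL2 hk s Ω u ∈ A := by
  refine hA.closure_subset (Metric.mem_closure_iff.2 fun ε hε => ?_)
  obtain ⟨φ, hφ⟩ := exists_norm_tildeToL2_sub_lt hk u hε
  refine ⟨_, h φ, ?_⟩
  rwa [dist_eq_norm, ← tildeToL2_testToTilde, ← map_sub]

theorem sobolevPairing_tilde_eq_inner {d : ℕ} {k : ℝ} (hk : 0 < k) {s : ℝ}
    {Ω : Opens (EuclideanSpace ℝ (Fin d))} (U : sobolevSpace d s) (v : sobolevTilde (-s) Ω) :
    sobolevPairing U.1 v.1 = inner ℂ (tildeToL2 hk (-s) Ω v) (sobolevToL2 hk s U) :=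
  sobolevPairing_eq_inner hk U (Submodule.inclusion (sobolevTilde_le (-s) Ω) v)

/-- A distribution vanishing on `Ω` pairs to zero with `H̃^{-s}(Ω)`. -/
theorem inner_tildeToL2_eq_zero {d : ℕ} {k : ℝ} (hk : 0 < k) {s : ℝ}
    {Ω : Opens (EuclideanSpace ℝ (Fin d))} (U : sobolevSpace d s)
    (hU : restrictDistribution Ω U.1 = 0) (v : sobolevTilde (-s) Ω) :
    inner ℂ (tildeToL2 hk (-s) Ω v) (sobolevToL2 hk s U) = 0 := by
  have hA : IsClosed {h : Lp ℂ 2 (volume : Measure (EuclideanSpace ℝ (Fin d))) |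
      inner ℂ h (sobolevToL2 hk s U) = 0} :=
    isClosed_eq (by fun_prop) continuous_const
  refine tildeToL2_mem_of_isClosed hk hA (fun φ => ?_) v
  rw [Set.mem_ofPred_eq, ← sobolevPairing_eq_inner]
  have h := apply_testToSchwartz_eq_sobolevPairing U (conjTest φ)
  rw [conjTest_conjTest] at h
  rw [testToSobolev, ← h]
  exact LinearMap.congr_fun hU (conjTest φ)

/-- The duality pairing may be computed with any extension of `u`. -/
theorem sobolevOnPairing_eq_inner {d : ℕ} {k : ℝ} (hk : 0 < k) {s : ℝ}
    {Ω : Opens (EuclideanSpace ℝ (Fin d))} (u : sobolevOn s Ω) (U : sobolevSpace d s)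
    (hU : restrictDistribution Ω U.1 = u) (v : sobolevTilde (-s) Ω) :
    sobolevOnPairing u v = inner ℂ (tildeToL2 hk (-s) Ω v) (sobolevToL2 hk s U) := by
  set U' : sobolevSpace d s := ⟨(Submodule.mem_map.1 u.2).choose,
    (Submodule.mem_map.1 u.2).choose_spec.1⟩ with hU'
  have h1 : restrictDistribution Ω U'.1 = u := (Submodule.mem_map.1 u.2).choose_spec.2
  have h2 : sobolevOnPairing u v = sobolevPairing U'.1 v.1 := rfl
  have h3 := inner_tildeToL2_eq_zero hk (U' - U)
    (by rw [Submodule.coe_sub, map_sub, h1, hU, sub_self]) v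
  rw [map_sub, inner_sub_right, sub_eq_zero] at h3
  rw [h2, sobolevPairing_tilde_eq_inner hk, h3]

/-- An element of `H^s(Ω)`, as a distribution, is controlled by its norm. -/
theorem norm_apply_le_sobolevOnNorm {d : ℕ} {k : ℝ} (hk : 0 < k) {s : ℝ}
    {Ω : Opens (EuclideanSpace ℝ (Fin d))} (u : sobolevOn s Ω) (ψ : 𝓓(Ω, ℂ)) :
    ‖(u : 𝓓(Ω, ℂ) →ₗ[ℂ] ℂ) ψ‖ ≤
      ‖sobolevToL2 hk (-s) (testToSobolev (-s) (conjTest ψ))‖ * sobolevOnNorm k s u := by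
  set A := ‖sobolevToL2 hk (-s) (testToSobolev (-s) (conjTest ψ))‖
  have key : ∀ U : sobolevSpace d s, restrictDistribution Ω U.1 = u →
      ‖(u : 𝓓(Ω, ℂ) →ₗ[ℂ] ℂ) ψ‖ ≤ A * sobolevNorm k s U.1 := by
    intro U hU
    have h1 : (u : 𝓓(Ω, ℂ) →ₗ[ℂ] ℂ) ψ = U.1 (testToSchwartz Ω ψ) := by rw [← hU]; rfl
    rw [h1, apply_testToSchwartz_eq_sobolevPairing, ← norm_sobolevToL2 hk]
    have h2 := sobolevPairing_eq_inner hk U (testToSobolev (-s) (conjTest ψ))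
    rw [testToSobolev] at h2
    rw [h2]
    exact norm_inner_le_norm _ _
  obtain ⟨U0, hU0, hU0'⟩ := Submodule.mem_map.1 u.2
  have hne : {r | ∃ U ∈ sobolevSpace d s, restrictDistribution Ω U = u ∧
      r = sobolevNorm k s U}.Nonempty := ⟨_, U0, hU0, hU0', rfl⟩
  have hA0 : 0 ≤ A := norm_nonneg _
  rcases hA0.eq_or_lt with hA | hA
  · have := key ⟨U0, hU0⟩ hU0'
    rw [← hA, zero_mul] at this ⊢
    exact this
  · rw [mul_comm, ← div_le_iff₀ hA]
    refine le_csInf hne ?_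
    rintro r ⟨U, hU, hUu, rfl⟩
    rw [div_le_iff₀ hA, mul_comm]
    exact key ⟨U, hU⟩ hUu

theorem sobolevOnNorm_le {d : ℕ} {k s : ℝ} {Ω : Opens (EuclideanSpace ℝ (Fin d))}
    (u : sobolevOn s Ω) (U : sobolevSpace d s) (hU : restrictDistribution Ω U.1 = u) :
    sobolevOnNorm k s u ≤ sobolevNorm k s U.1 := by
  refine csInf_le ⟨0, ?_⟩ ⟨U.1, U.2, hU, rfl⟩
  rintro r ⟨U, _, _, rfl⟩
  exact Real.sqrt_nonneg _

/-- A bounded linear operator is determined by its values on test functions. -/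
theorem IsSingleLayerOperator.unique {d : ℕ} {k : ℝ} (hk : 0 < k) {Γ : PlanarScreen d}
    {S S' : sobolevTilde (-(1 / 2)) Γ.chart →ₗ[ℂ] sobolevOn (1 / 2) Γ.chart}
    (hS : IsSingleLayerOperator k Γ S) (hS' : IsSingleLayerOperator k Γ S') : S' = S := by
  obtain ⟨C, hC⟩ := hS.bounded
  obtain ⟨C', hC'⟩ := hS'.bounded
  refine LinearMap.ext fun φ => Subtype.ext (LinearMap.ext fun ψ => ?_)
  set A := ‖sobolevToL2 hk (-(1 / 2)) (testToSobolev (-(1 / 2)) (conjTest ψ))‖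
  have hA : 0 ≤ A := norm_nonneg _
  rw [← sub_eq_zero, ← norm_eq_zero]
  refine le_antisymm (le_of_forall_pos_le_add fun ε hε => ?_) (norm_nonneg _)
  obtain ⟨φ', hφ'⟩ := exists_norm_tildeToL2_sub_lt hk φ
    (ε := ε / (A * (|C| + |C'|) + 1)) (by positivity)
  set v := φ - testToTilde (-(1 / 2)) Γ.chart φ' with hv
  have hφ : φ = v + testToTilde (-(1 / 2)) Γ.chart φ' := by rw [hv, sub_add_cancel]
  have h1 : ∀ T : sobolevTilde (-(1 / 2)) Γ.chart →ₗ[ℂ] sobolevOn (1 / 2) Γ.chart, ∀ B : ℝ,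
      sobolevOnNorm k (1 / 2) (T v) ≤ B * sobolevNorm k (-(1 / 2)) v.1 →
      ‖(T v : 𝓓(Γ.chart, ℂ) →ₗ[ℂ] ℂ) ψ‖ ≤ A * (|B| * ‖tildeToL2 hk (-(1 / 2)) Γ.chart v‖) := by
    intro T B hB
    refine (norm_apply_le_sobolevOnNorm hk (T v) ψ).trans
      (mul_le_mul_of_nonneg_left (hB.trans ?_) hA)
    rw [norm_tildeToL2]
    exact mul_le_mul_of_nonneg_right (le_abs_self B) (Real.sqrt_nonneg _)
  have h2 : ∀ T : sobolevTilde (-(1 / 2)) Γ.chart →ₗ[ℂ] sobolevOn (1 / 2) Γ.chart,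
      (T φ : 𝓓(Γ.chart, ℂ) →ₗ[ℂ] ℂ) ψ = (T v : 𝓓(Γ.chart, ℂ) →ₗ[ℂ] ℂ) ψ +
      (T (testToTilde (-(1 / 2)) Γ.chart φ') : 𝓓(Γ.chart, ℂ) →ₗ[ℂ] ℂ) ψ := by
    intro T
    conv_lhs => rw [hφ, map_add]
    rfl
  rw [h2 S, h2 S', hS.apply_test, hS'.apply_test, add_sub_add_right_eq_sub]
  refine (norm_sub_le _ _).trans ?_
  have h3 := h1 S C (hC v)
  have h4 := h1 S' C' (hC' v)
  rw [lt_div_iff₀ (by positivity)] at hφ'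
  nlinarith [norm_nonneg (tildeToL2 hk (-(1 / 2)) Γ.chart v)]

/-! ### Convolution operators with an integrable kernel -/

theorem integral_fourier_mul_eq_integral_mul_fourier {d : ℕ} {f g : EuclideanSpace ℝ (Fin d) → ℂ}
    (hf : Integrable f) (hg : Integrable g) :
    ∫ ξ, 𝓕 f ξ * g ξ = ∫ x, f x * 𝓕 g x := by
  have := VectorFourier.integral_fourierIntegral_smul_eq_flip (L := innerₗ _)
    Real.continuous_fourierChar continuous_inner hf hg
  rw [flip_innerₗ] at this
  simpa only [smul_eq_mul] using! this

/-- `∫ φ(x - z) ψ(x) dx` is the Fourier transform of `𝓕φ · 𝓕⁻ψ`. -/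
theorem fourier_mul_fourierInv_eq {d : ℕ} (φ ψ : 𝓢(EuclideanSpace ℝ (Fin d), ℂ))
    (z : EuclideanSpace ℝ (Fin d)) :
    𝓕 (fun ξ => 𝓕 φ ξ * 𝓕⁻ ψ ξ) z = ∫ x, φ (x - z) * ψ x := by
  have h1 : ∀ ξ, 𝓕 (fun x => φ (x - z)) ξ = Real.fourierChar (-inner ℝ ξ z) • 𝓕 φ ξ := by
    intro ξ
    have := VectorFourier.fourierIntegral_comp_add_right Real.fourierChar volume (innerₗ _)
      (fun x => φ x) (-z)
    have h2 := congrFun this ξ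
    rw [SchwartzMap.fourier_coe]
    simpa [sub_eq_add_neg, real_inner_comm] using! h2
  have h2 : 𝓕 (fun ξ => 𝓕 φ ξ * 𝓕⁻ ψ ξ) z = ∫ ξ, 𝓕 (fun x => φ (x - z)) ξ * 𝓕⁻ ψ ξ := by
    rw [Real.fourier_eq]
    congr 1
    ext ξ
    rw [h1, smul_mul_assoc]
  rw [h2, integral_fourier_mul_eq_integral_mul_fourier (φ.integrable.comp_sub_right z)
    (𝓕⁻ ψ).integrable]
  congr 1
  ext x
  rw [← SchwartzMap.fourier_coe, FourierTransform.fourier_fourierInv_eq]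

theorem integrable_fourier_mul_fourierInv {d : ℕ} (φ ψ : 𝓢(EuclideanSpace ℝ (Fin d), ℂ)) :
    Integrable (fun ξ => 𝓕 φ ξ * 𝓕⁻ ψ ξ) :=
  ((𝓕 φ : 𝓢(_, ℂ)).memLp 2).integrable_mul ((𝓕⁻ ψ : 𝓢(_, ℂ)).memLp 2)

/-- The correlation `z ↦ ∫ φ(x - z) ψ(x) dx`. -/
def correlation {d : ℕ} (φ ψ : 𝓢(EuclideanSpace ℝ (Fin d), ℂ)) (z : EuclideanSpace ℝ (Fin d)) :
    ℂ := ∫ x, φ (x - z) * ψ x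

theorem integral_mul_correlation {d : ℕ} {K : EuclideanSpace ℝ (Fin d) → ℂ} (hK : Integrable K)
    (φ ψ : 𝓢(EuclideanSpace ℝ (Fin d), ℂ)) :
    ∫ z, K z * correlation φ ψ z = ∫ ξ, 𝓕 K ξ * (𝓕 φ ξ * 𝓕⁻ ψ ξ) := by
  rw [integral_fourier_mul_eq_integral_mul_fourier hK (integrable_fourier_mul_fourierInv φ ψ)]
  congr 1
  ext z
  rw [fourier_mul_fourierInv_eq, correlation]

theorem integral_mul_correlation_eq_integral_integral {d : ℕ}
    {K : EuclideanSpace ℝ (Fin d) → ℂ} (hK : Integrable K)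
    (φ ψ : 𝓢(EuclideanSpace ℝ (Fin d), ℂ)) :
    ∫ z, K z * correlation φ ψ z = ∫ x, (∫ y, K (x - y) * φ y) * ψ x := by
  obtain ⟨C, hC⟩ : ∃ C, ∀ x, ‖φ x‖ ≤ C := ⟨_, φ.toBoundedContinuousFunction.norm_coe_le_norm⟩
  have hint : Integrable (fun p : EuclideanSpace ℝ (Fin d) × EuclideanSpace ℝ (Fin d) =>
      φ (p.2 - p.1) * (K p.1 * ψ p.2)) (volume.prod volume) := by
    refine (hK.mul_prod ψ.integrable).bdd_mul (c := C) ?_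
      (Filter.Eventually.of_forall fun p => hC _)
    exact (φ.continuous.comp (by fun_prop)).aestronglyMeasurable
  calc ∫ z, K z * correlation φ ψ z = ∫ z, ∫ x, φ (x - z) * (K z * ψ x) := by
        congr 1; ext z
        rw [correlation, ← integral_const_mul]
        congr 1; ext x; ring
    _ = ∫ x, ∫ z, φ (x - z) * (K z * ψ x) := integral_integral_swap hint
    _ = _ := by
        congr 1; ext x
        rw [← integral_mul_const, ← integral_sub_left_eq_self _ volume x]
        congr 1; ext z
        rw [sub_sub_cancel]; ring

/-- Multiplication by `(k² + |2πη|²)^(1/2) 𝓕K(η)`, as an operator on `L²(ℝ^d)`; it represents the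
convolution with `K` from `H^{-1/2}` to `H^{1/2}`. -/
theorem exists_multiplier {d : ℕ} {k : ℝ} (hk : 0 < k) {K : EuclideanSpace ℝ (Fin d) → ℂ}
    (hK : Integrable K) {C : ℝ} (hC : ∀ η, ‖𝓕 K η‖ ≤ C * sobolevWeight k (-1) η) :
    ∃ M : Lp ℂ 2 (volume : Measure (EuclideanSpace ℝ (Fin d))) →L[ℂ]
      Lp ℂ 2 (volume : Measure (EuclideanSpace ℝ (Fin d))),
      ∀ h, M h =ᵐ[volume] fun η => ((sobolevWeight k 1 η : ℂ) * 𝓕 K η) * h η := by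
  have hm : MemLp (fun η => (sobolevWeight k 1 η : ℂ) * 𝓕 K η) ∞ := by
    refine memLp_top_of_bound (C := C) ?_ (Filter.Eventually.of_forall fun η => ?_)
    · refine ((Complex.continuous_ofReal.comp (continuous_sobolevWeight hk 1)).mul
        ?_).aestronglyMeasurable
      exact VectorFourier.fourierIntegral_continuous Real.continuous_fourierChar
        (by exact continuous_inner) hK
    · rw [norm_mul, Complex.norm_real, Real.norm_of_nonneg (sobolevWeight_pos hk _ η).le]
      calc _ ≤ sobolevWeight k 1 η * (C * sobolevWeight k (-1) η) := by
            gcongr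
            · exact (sobolevWeight_pos hk _ η).le
            · exact hC η
        _ = C * (sobolevWeight k 1 η * sobolevWeight k (-1) η) := by ring
        _ = C := by rw [sobolevWeight_mul_neg hk, mul_one]
  refine ⟨(ContinuousLinearMap.mul ℂ ℂ).holderL volume ∞ 2 2 hm.toLp, fun h => ?_⟩
  rw [ContinuousLinearMap.holderL_apply_apply]
  filter_upwards [(ContinuousLinearMap.mul ℂ ℂ).coeFn_holder (r := 2) hm.toLp h, hm.coeFn_toLp]
    with η h1 h2
  rw [h1, h2, ContinuousLinearMap.mul_apply']

/-- The form of the convolution with `K` on test functions. The pairing is antilinear in the second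
argument, whereas the correlation is bilinear, which accounts for the conjugate of `ψ`. -/
theorem inner_testToSobolev_multiplier {d : ℕ} {k : ℝ} (hk : 0 < k)
    {K : EuclideanSpace ℝ (Fin d) → ℂ} (hK : Integrable K)
    {M : Lp ℂ 2 (volume : Measure (EuclideanSpace ℝ (Fin d))) →L[ℂ]
      Lp ℂ 2 (volume : Measure (EuclideanSpace ℝ (Fin d)))}
    (hM : ∀ h, M h =ᵐ[volume] fun η => ((sobolevWeight k 1 η : ℂ) * 𝓕 K η) * h η)
    {Ω : Opens (EuclideanSpace ℝ (Fin d))} (φ ψ : 𝓓(Ω, ℂ)) :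
    inner ℂ (sobolevToL2 hk (-(1 / 2)) (testToSobolev (-(1 / 2)) (conjTest ψ)))
      (M (sobolevToL2 hk (-(1 / 2)) (testToSobolev (-(1 / 2)) φ))) =
      ∫ z, K z * correlation (testToSchwartz Ω φ) (testToSchwartz Ω ψ) z := by
  rw [integral_mul_correlation hK, L2.inner_def]
  refine integral_congr_ae ?_
  filter_upwards [hM (sobolevToL2 hk (-(1 / 2)) (testToSobolev (-(1 / 2)) φ)),
    sobolevToL2_testToSobolev hk (-(1 / 2)) φ,
    sobolevToL2_testToSobolev hk (-(1 / 2)) (conjTest ψ)] with η h1 h2 h3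
  rw [h1, h2, h3, RCLike.inner_apply, map_mul, Complex.conj_ofReal, conj_fourier_conjTest]
  have h4 : (sobolevWeight k 1 η : ℂ) *
      ((sobolevWeight k (-(1 / 2)) η : ℂ) * (sobolevWeight k (-(1 / 2)) η : ℂ)) = 1 := by
    rw [← Complex.ofReal_mul, ← sobolevWeight_add hk, ← Complex.ofReal_mul]
    norm_num
    exact_mod_cast sobolevWeight_mul_neg hk 1 η
  linear_combination (𝓕 K η * (𝓕 (testToSchwartz Ω φ) η * 𝓕⁻ (testToSchwartz Ω ψ) η)) * h4

/-- Convolution with `K`, as an operator from `H̃^{-1/2}(Ω)` to `H^{1/2}(Ω)`, together with its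
form, which reads `⟨h, M h⟩` on `L²`. -/
theorem exists_convolution_operator {d : ℕ} {k : ℝ} (hk : 0 < k)
    (M : Lp ℂ 2 (volume : Measure (EuclideanSpace ℝ (Fin d))) →L[ℂ]
      Lp ℂ 2 (volume : Measure (EuclideanSpace ℝ (Fin d))))
    (Ω : Opens (EuclideanSpace ℝ (Fin d))) :
    ∃ S : sobolevTilde (-(1 / 2)) Ω →ₗ[ℂ] sobolevOn (1 / 2) Ω,
      (∀ φ, sobolevOnNorm k (1 / 2) (S φ) ≤ ‖M‖ * sobolevNorm k (-(1 / 2)) φ.1) ∧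
      (∀ φ (ψ : 𝓓(Ω, ℂ)), (S φ : 𝓓(Ω, ℂ) →ₗ[ℂ] ℂ) ψ =
        inner ℂ (sobolevToL2 hk (-(1 / 2)) (testToSobolev (-(1 / 2)) (conjTest ψ)))
          (M (tildeToL2 hk (-(1 / 2)) Ω φ))) ∧
      ∀ φ ψ, sobolevOnPairing (S φ) ψ = inner ℂ (tildeToL2 hk (-(1 / 2)) Ω ψ)
        (M (tildeToL2 hk (-(1 / 2)) Ω φ)) := by
  have h0 : (0 : ℝ) ≤ 1 / 2 := by norm_num
  let E : sobolevTilde (-(1 / 2)) Ω →ₗ[ℂ] sobolevSpace d (1 / 2) :=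
    (sobolevEquivL2 hk h0).symm.toLinearMap ∘ₗ M.toLinearMap ∘ₗ tildeToL2 hk (-(1 / 2)) Ω
  have hE : ∀ φ, sobolevToL2 hk (1 / 2) (E φ) = M (tildeToL2 hk (-(1 / 2)) Ω φ) :=
    fun φ => sobolevToL2_sobolevEquivL2_symm hk h0 _
  refine ⟨(restrictDistribution Ω).submoduleMap (sobolevSpace d (1 / 2)) ∘ₗ E,
    fun φ => ?_, fun φ ψ => ?_, fun φ ψ => ?_⟩
  · refine (sobolevOnNorm_le _ (E φ) rfl).trans ?_
    rw [← norm_sobolevToL2 hk, hE, ← norm_tildeToL2 hk]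
    exact M.le_opNorm _
  · rw [← hE]
    have h := sobolevPairing_eq_inner hk (E φ) (testToSobolev (-(1 / 2)) (conjTest ψ))
    rw [← h]
    exact apply_testToSchwartz_eq_sobolevPairing (E φ) ψ
  · rw [← hE]
    exact sobolevOnPairing_eq_inner hk _ (E φ) rfl ψ

/-! ### The integrals `∫₀^∞ t^(s-1) exp (-t - w/t) dt` -/

open Set Filter Topology in
theorem eq_of_hasDerivAt_zero_of_tendsto {g : ℝ → ℂ} {c : ℂ}
    (hg : ∀ w, 0 < w → HasDerivAt g 0 w) (h0 : Tendsto g (𝓝[>] 0) (𝓝 c)) {w : ℝ}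
    (hw : 0 < w) : g w = c := by
  have h1 : ∀ x ∈ Ioi (0 : ℝ), g x = g w := fun x hx =>
    isOpen_Ioi.is_const_of_deriv_eq_zero isPreconnected_Ioi
      (fun y hy => (hg y hy).differentiableAt.differentiableWithinAt)
      (fun y hy => (hg y hy).deriv) hx hw
  refine tendsto_nhds_unique (Tendsto.congr' ?_ tendsto_const_nhds) h0
  filter_upwards [self_mem_nhdsWithin] with x hx
  exact (h1 x hx).symm

/-- The integral `∫₀^∞ t^(s-1) exp (-t - w/t) dt = 2 w^(s/2) K_s(2√w)`. -/
def macdonaldIntegral (s w : ℝ) : ℝ :=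
  ∫ t in Set.Ioi (0 : ℝ), t ^ (s - 1) * Real.exp (-t - w / t)

theorem integrableOn_macdonald (s : ℝ) {w : ℝ} (hw : 0 < w) :
    IntegrableOn (fun t : ℝ => t ^ (s - 1) * Real.exp (-t - w / t)) (Set.Ioi 0) := by
  obtain ⟨p, hp⟩ := exists_nat_gt (-s)
  have h1 := (Real.GammaIntegral_convergent (s := s + p) (by linarith)).const_mul
    ((p.factorial : ℝ) * w⁻¹ ^ p)
  refine Integrable.mono' h1 ?_ ?_
  · refine ContinuousOn.aestronglyMeasurable ?_ measurableSet_Ioi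
    refine ContinuousOn.mul (fun t ht => ?_) (ContinuousOn.rexp (ContinuousOn.sub (by fun_prop)
      (continuousOn_const.div continuousOn_id fun t ht => (ne_of_gt ht))))
    exact (Real.continuousAt_rpow_const _ _ (Or.inl (ne_of_gt ht))).continuousWithinAt
  · filter_upwards [ae_restrict_mem measurableSet_Ioi] with t ht
    have ht : 0 < t := ht
    rw [Real.norm_of_nonneg (by positivity)]
    have h2 : Real.exp (-(w / t)) ≤ p.factorial * w⁻¹ ^ p * t ^ p := by
      have h3 := Real.pow_div_factorial_le_exp (w / t) (by positivity) p
      rw [Real.exp_neg, inv_le_comm₀ (Real.exp_pos _) (by positivity)]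
      refine le_trans (le_of_eq ?_) h3
      rw [div_pow, inv_pow]
      field_simp
    calc t ^ (s - 1) * Real.exp (-t - w / t)
        = t ^ (s - 1) * Real.exp (-t) * Real.exp (-(w / t)) := by
          rw [mul_assoc, ← Real.exp_add]; rfl
      _ ≤ t ^ (s - 1) * Real.exp (-t) * (p.factorial * w⁻¹ ^ p * t ^ p) := by gcongr
      _ = p.factorial * w⁻¹ ^ p * (Real.exp (-t) * (t ^ (s - 1) * t ^ (p : ℝ))) := by
          rw [Real.rpow_natCast]; ring
      _ = _ := by
          rw [← Real.rpow_add ht]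
          ring_nf

theorem hasDerivAt_macdonaldIntegral (s : ℝ) {w : ℝ} (hw : 0 < w) :
    HasDerivAt (macdonaldIntegral s) (-macdonaldIntegral (s - 1) w) w := by
  have hs : Set.Ioi (w / 2) ∈ nhds w := Ioi_mem_nhds (by linarith)
  have h := (hasDerivAt_integral_of_dominated_loc_of_deriv_le (μ := volume.restrict (Set.Ioi 0))
    (F := fun w t => t ^ (s - 1) * Real.exp (-t - w / t))
    (F' := fun w t => -(t ^ (s - 1 - 1) * Real.exp (-t - w / t)))
    (bound := fun t => t ^ (s - 1 - 1) * Real.exp (-t - (w / 2) / t)) hs ?_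
    (integrableOn_macdonald s hw) (integrableOn_macdonald (s - 1) hw).aestronglyMeasurable.neg ?_
    (integrableOn_macdonald (s - 1) (by positivity)) ?_).2
  · rw [integral_neg] at h
    exact h
  · filter_upwards [hs] with x hx
    have hx : w / 2 < x := hx
    exact (integrableOn_macdonald s (by linarith)).aestronglyMeasurable
  · filter_upwards [ae_restrict_mem measurableSet_Ioi] with t ht x hx
    have ht : 0 < t := ht
    have hx : w / 2 < x := hx
    rw [norm_neg, Real.norm_of_nonneg (by positivity)]
    gcongr
  · filter_upwards [ae_restrict_mem measurableSet_Ioi] with t ht x hx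
    have ht : 0 < t := ht
    have h1 : HasDerivAt (fun w => -t - w / t) (-(1 / t)) x := by
      simpa using ((hasDerivAt_id x).div_const t).const_sub (-t)
    have h2 := (h1.exp).const_mul (t ^ (s - 1))
    refine h2.congr_deriv ?_
    rw [Real.rpow_sub_one ht.ne' (s - 1)]
    ring

/-- The substitution `t ↦ w / t`. -/
theorem integral_Ioi_comp_div {w : ℝ} (hw : 0 < w) (g : ℝ → ℝ) :
    ∫ t in Set.Ioi (0 : ℝ), w / t ^ 2 * g (w / t) = ∫ t in Set.Ioi (0 : ℝ), g t := by
  have h1 := integral_comp_rpow_Ioi (fun t => w * g (w * t)) (p := -1) (by norm_num)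
  have h2 := integral_comp_mul_left_Ioi g 0 hw
  rw [mul_zero] at h2
  rw [integral_const_mul, h2, smul_eq_mul, mul_inv_cancel_left₀ hw.ne'] at h1
  rw [← h1]
  refine setIntegral_congr_fun measurableSet_Ioi fun t ht => ?_
  have ht : 0 < t := ht
  have e : t ^ (-1 - 1 : ℝ) = (t ^ 2)⁻¹ := by
    rw [← Real.rpow_natCast, ← Real.rpow_neg ht.le]; norm_num
  simp only [e, Real.rpow_neg_one, smul_eq_mul, abs_neg, abs_one, one_mul]
  rw [div_eq_mul_inv, div_eq_mul_inv]
  ring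

/-- The symmetry `K_{-s} = K_s`. -/
theorem macdonaldIntegral_neg (s : ℝ) {w : ℝ} (hw : 0 < w) :
    macdonaldIntegral (-s) w = w ^ (-s) * macdonaldIntegral s w := by
  rw [macdonaldIntegral, ← integral_Ioi_comp_div hw, macdonaldIntegral, ← integral_const_mul]
  refine setIntegral_congr_fun measurableSet_Ioi fun t ht => ?_
  have ht : 0 < t := ht
  have e1 : (w / t) ^ (-s - 1) = w ^ (-s) * w⁻¹ * (t ^ (s - 1) * t ^ 2) := by
    rw [Real.div_rpow hw.le ht.le, Real.rpow_sub_one hw.ne', Real.rpow_sub_one ht.ne',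
      Real.rpow_sub_one ht.ne', Real.rpow_neg ht.le]
    have := (Real.rpow_pos_of_pos ht s).ne'
    field_simp
  have e2 : -(w / t) - w / (w / t) = -t - w / t := by field_simp; ring
  simp only [e1, e2]
  field_simp

theorem tendsto_macdonaldIntegral_zero {s : ℝ} (hs : 0 < s) :
    Filter.Tendsto (macdonaldIntegral s) (nhdsWithin 0 (Set.Ioi 0)) (nhds (Real.Gamma s)) := by
  rw [Real.Gamma_eq_integral hs]
  refine tendsto_integral_filter_of_dominated_convergence
    (fun t => Real.exp (-t) * t ^ (s - 1)) ?_ ?_ (Real.GammaIntegral_convergent hs) ?_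
  · filter_upwards [self_mem_nhdsWithin] with w hw
    exact (integrableOn_macdonald s hw).aestronglyMeasurable
  · filter_upwards [self_mem_nhdsWithin] with w hw
    filter_upwards [ae_restrict_mem measurableSet_Ioi] with t ht
    have ht : 0 < t := ht
    have hw : 0 < w := hw
    rw [Real.norm_of_nonneg (by positivity), mul_comm]
    gcongr
    have : 0 < w / t := by positivity
    linarith
  · filter_upwards with t
    have h : Continuous fun w : ℝ => t ^ (s - 1) * Real.exp (-t - w / t) := by fun_prop
    have := (h.tendsto 0).mono_left (nhdsWithin_le_nhds (s := Set.Ioi 0))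
    simpa [mul_comm] using this

/-- The elementary form of `K_{1/2}`: by the reflection formula `s ↦ -s` the integral solves a first
order equation. -/
theorem macdonaldIntegral_half {w : ℝ} (hw : 0 < w) :
    macdonaldIntegral (1 / 2) w = √Real.pi * Real.exp (-2 * √w) := by
  have key : ((macdonaldIntegral (1 / 2) w * Real.exp (2 * √w) : ℝ) : ℂ) = (√Real.pi : ℂ) := by
    refine eq_of_hasDerivAt_zero_of_tendsto
      (g := fun w => ((macdonaldIntegral (1 / 2) w * Real.exp (2 * √w) : ℝ) : ℂ))
      (fun w hw => ?_) ?_ hw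
    · have h1 := hasDerivAt_macdonaldIntegral (1 / 2) hw
      have h2 : macdonaldIntegral (1 / 2 - 1) w = (√w)⁻¹ * macdonaldIntegral (1 / 2) w := by
        have := macdonaldIntegral_neg (1 / 2) hw
        rw [Real.rpow_neg hw.le, ← Real.sqrt_eq_rpow] at this
        rw [← this]
        norm_num
      have h3 : HasDerivAt (fun w => Real.exp (2 * √w)) (Real.exp (2 * √w) * (√w)⁻¹) w := by
        have := (((hasDerivAt_id w).sqrt hw.ne').const_mul 2).exp
        refine this.congr_deriv ?_
        simp only [id]
        ring
      have h4 := (h1.mul h3).ofReal_comp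
      refine h4.congr_deriv ?_
      rw [h2]
      push_cast
      ring
    · have h1 := tendsto_macdonaldIntegral_zero (s := 1 / 2) (by norm_num)
      rw [Real.Gamma_one_half_eq] at h1
      have h2 : Continuous fun w => Real.exp (2 * √w) := by fun_prop
      have h3 := h1.mul ((h2.tendsto 0).mono_left (nhdsWithin_le_nhds (s := Set.Ioi 0)))
      simp only [Real.sqrt_zero, mul_zero, Real.exp_zero, mul_one] at h3
      exact (Complex.continuous_ofReal.tendsto _).comp h3
  have h2 : macdonaldIntegral (1 / 2) w * Real.exp (2 * √w) = √Real.pi := by exact_mod_cast key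
  rw [← h2, mul_assoc, ← Real.exp_add]
  simp

theorem abs_log_le_add_inv {t : ℝ} (ht : 0 < t) : |Real.log t| ≤ t + t⁻¹ := by
  have h1 := Real.log_le_sub_one_of_pos ht
  have h2 := Real.log_le_sub_one_of_pos (inv_pos.2 ht)
  rw [Real.log_inv] at h2
  have := inv_pos.2 ht
  exact abs_le.2 ⟨by linarith, by linarith⟩

theorem integrableOn_log_mul_macdonald (s : ℝ) {w : ℝ} (hw : 0 < w) :
    IntegrableOn (fun t : ℝ => Real.log t * (t ^ (s - 1) * Real.exp (-t - w / t)))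
      (Set.Ioi 0) := by
  refine Integrable.mono' ((integrableOn_macdonald (s + 1) hw).add
    (integrableOn_macdonald (s - 1) hw)) ?_ ?_
  · exact (Real.measurable_log.aestronglyMeasurable).mul
      (integrableOn_macdonald s hw).aestronglyMeasurable
  · filter_upwards [ae_restrict_mem measurableSet_Ioi] with t ht
    have ht : 0 < t := ht
    rw [norm_mul, Real.norm_eq_abs, Real.norm_of_nonneg (by positivity)]
    refine (mul_le_mul_of_nonneg_right (abs_log_le_add_inv ht) (by positivity)).trans
      (le_of_eq ?_)
    have e : t ^ (s + 1 - 1) = t ^ (s - 1) * t := by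
      rw [← Real.rpow_add_one ht.ne']; ring_nf
    have e' : t ^ (s - 1 - 1) = t ^ (s - 1) * t⁻¹ := by
      rw [Real.rpow_sub_one ht.ne' (s - 1)]; rfl
    simp only [Pi.add_apply, e, e']
    ring

/-- The logarithmic mean `∫₀^∞ log t exp (-t - w/t) dt`, whose limit for `w → 0` is `Γ'(1)`. -/
def macdonaldLog (w : ℝ) : ℝ :=
  ∫ t in Set.Ioi (0 : ℝ), Real.log t * Real.exp (-t - w / t)

theorem tendsto_log_mul_macdonald_kernel {w : ℝ} (hw : 0 < w) :
    Filter.Tendsto (fun t => Real.log t * Real.exp (-t - w / t)) (nhdsWithin 0 (Set.Ioi 0))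
      (nhds 0) ∧
    Filter.Tendsto (fun t => Real.log t * Real.exp (-t - w / t)) Filter.atTop (nhds 0) := by
  have hb : ∀ t, 0 < t → ‖Real.log t * Real.exp (-t - w / t)‖ ≤
      t * Real.exp (-t) + 2 * w⁻¹ ^ 2 * t := by
    intro t ht
    have h1 : Real.exp (-(w / t)) ≤ 2 * w⁻¹ ^ 2 * t ^ 2 := by
      have h3 := Real.pow_div_factorial_le_exp (w / t) (by positivity) 2
      rw [Real.exp_neg, inv_le_comm₀ (Real.exp_pos _) (by positivity)]
      refine le_trans (le_of_eq ?_) h3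
      rw [div_pow, inv_pow]
      simp only [Nat.factorial]
      push_cast
      field_simp
    have h2 : Real.exp (-(w / t)) ≤ 1 := Real.exp_le_one_iff.2 (by
      have : 0 < w / t := by positivity
      linarith)
    have h3 : Real.exp (-t) ≤ 1 := Real.exp_le_one_iff.2 (by linarith)
    rw [norm_mul, Real.norm_eq_abs, Real.norm_of_nonneg (Real.exp_pos _).le]
    have e : Real.exp (-t - w / t) = Real.exp (-t) * Real.exp (-(w / t)) := by
      rw [← Real.exp_add]; rfl
    calc |Real.log t| * Real.exp (-t - w / t)
        ≤ (t + t⁻¹) * (Real.exp (-t) * Real.exp (-(w / t))) := by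
          rw [e]; gcongr; exact abs_log_le_add_inv ht
      _ = t * (Real.exp (-t) * Real.exp (-(w / t))) +
          t⁻¹ * (Real.exp (-t) * Real.exp (-(w / t))) := by ring
      _ ≤ t * (Real.exp (-t) * 1) + t⁻¹ * (1 * (2 * w⁻¹ ^ 2 * t ^ 2)) := by gcongr
      _ = _ := by field_simp
  have hb' : ∀ t, 1 ≤ t → ‖Real.log t * Real.exp (-t - w / t)‖ ≤ t * Real.exp (-t) := by
    intro t ht
    have ht0 : 0 < t := by linarith
    rw [norm_mul, Real.norm_of_nonneg (Real.log_nonneg ht),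
      Real.norm_of_nonneg (Real.exp_pos _).le]
    have h1 := Real.log_le_sub_one_of_pos ht0
    have h2 : 0 < w / t := by positivity
    have h3 := Real.log_nonneg ht
    gcongr
    · linarith
    · linarith
  constructor
  · refine squeeze_zero_norm' (a := fun t => t * Real.exp (-t) + 2 * w⁻¹ ^ 2 * t) ?_ ?_
    · filter_upwards [self_mem_nhdsWithin] with t ht using hb t ht
    · have h : Continuous fun t : ℝ => t * Real.exp (-t) + 2 * w⁻¹ ^ 2 * t := by fun_prop
      have := (h.tendsto 0).mono_left (nhdsWithin_le_nhds (s := Set.Ioi 0))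
      simpa using this
  · refine squeeze_zero_norm' (a := fun t => t * Real.exp (-t)) ?_ ?_
    · filter_upwards [Filter.eventually_ge_atTop 1] with t ht using hb' t ht
    · simpa using Real.tendsto_pow_mul_exp_neg_atTop_nhds_zero 1

/-- Integration by parts, followed by the substitution `t ↦ w / t` in one of the terms. -/
theorem macdonaldIntegral_zero_eq {w : ℝ} (hw : 0 < w) :
    macdonaldIntegral 0 w = 2 * macdonaldLog w - Real.log w * macdonaldIntegral 1 w := by
  have i0 := integrableOn_macdonald 0 hw
  have i1 : IntegrableOn (fun t => Real.log t * Real.exp (-t - w / t)) (Set.Ioi 0) := by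
    simpa using integrableOn_log_mul_macdonald 1 hw
  have i2 : IntegrableOn (fun t => w / t ^ 2 * (Real.log t * Real.exp (-t - w / t)))
      (Set.Ioi 0) := by
    refine ((integrableOn_log_mul_macdonald (-1) hw).const_mul w).congr ?_
    filter_upwards [ae_restrict_mem measurableSet_Ioi] with t ht
    have ht : 0 < t := ht
    have e : t ^ (-1 - 1 : ℝ) = (t ^ 2)⁻¹ := by
      rw [← Real.rpow_natCast, ← Real.rpow_neg ht.le]; norm_num
    simp only [e]
    rw [div_eq_mul_inv w (t ^ 2)]
    ring
  have hder : ∀ t ∈ Set.Ioi (0 : ℝ), HasDerivAt (fun t => Real.log t * Real.exp (-t - w / t))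
      (t ^ ((0 : ℝ) - 1) * Real.exp (-t - w / t) -
      Real.log t * Real.exp (-t - w / t) + w / t ^ 2 * (Real.log t * Real.exp (-t - w / t))) t := by
    intro t ht
    have ht : 0 < t := ht
    have d1 : HasDerivAt (fun t => -t - w / t) (-1 + w / t ^ 2) t := by
      have := (hasDerivAt_id t).neg.sub ((hasDerivAt_inv ht.ne').const_mul w)
      refine this.congr_deriv ?_
      rw [div_eq_mul_inv]
      ring
    refine ((Real.hasDerivAt_log ht.ne').mul d1.exp).congr_deriv ?_
    rw [Real.rpow_sub_one ht.ne', Real.rpow_zero]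
    ring
  have h2 := integral_Ioi_of_hasDerivAt_of_tendsto (a := (0 : ℝ)) (m := (0 : ℝ))
    (f := Function.update (fun t => Real.log t * Real.exp (-t - w / t)) 0 0) ?_
    (fun t ht => ((hder t ht).congr_of_eventuallyEq ?_)) ((i0.sub i1).add i2) ?_
  · have h3 : ∫ t in Set.Ioi (0 : ℝ), w / t ^ 2 * (Real.log t * Real.exp (-t - w / t)) =
        Real.log w * macdonaldIntegral 1 w - macdonaldLog w := by
      have := integral_Ioi_comp_div hw
        (fun t => Real.log w * Real.exp (-t - w / t) - Real.log t * Real.exp (-t - w / t))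
      have i3 : IntegrableOn (fun t => Real.exp (-t - w / t)) (Set.Ioi 0) := by
        simpa using integrableOn_macdonald 1 hw
      rw [integral_sub (i3.const_mul _) i1, integral_const_mul] at this
      have e : macdonaldIntegral 1 w = ∫ t in Set.Ioi (0 : ℝ), Real.exp (-t - w / t) := by
        simp [macdonaldIntegral]
      rw [e, macdonaldLog, ← this]
      refine setIntegral_congr_fun measurableSet_Ioi fun t ht => ?_
      have ht : 0 < t := ht
      have e2 : -(w / t) - w / (w / t) = -t - w / t := by field_simp; ring
      simp only [e2, Real.log_div hw.ne' ht.ne']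
      ring
    have h4 := integral_add (i0.sub i1) i2
    have h5 := integral_sub i0 i1
    simp only [Pi.sub_apply] at h4
    rw [h4, h5, h3] at h2
    simp only [Function.update_self, sub_zero] at h2
    simp only [macdonaldIntegral, macdonaldLog] at h2 ⊢
    linarith
  · rw [continuousWithinAt_update_same]
    exact (tendsto_log_mul_macdonald_kernel hw).1.mono_left
      (nhdsWithin_mono _ (by intro x hx; exact lt_of_le_of_ne hx.1 (Ne.symm hx.2)))
  · filter_upwards [Ioi_mem_nhds ht] with x hx
    rw [Function.update_of_ne (ne_of_gt hx)]
  · refine (tendsto_log_mul_macdonald_kernel hw).2.congr' ?_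
    filter_upwards [Filter.eventually_gt_atTop 0] with x hx
    rw [Function.update_of_ne (ne_of_gt hx)]

theorem integrableOn_log_mul_exp_neg :
    IntegrableOn (fun t : ℝ => Real.log t * Real.exp (-t)) (Set.Ioi 0) ∧
    ∫ t in Set.Ioi (0 : ℝ), Real.log t * Real.exp (-t) = -Real.eulerMascheroniConstant := by
  have h1 := Complex.hasDerivAt_GammaIntegral (s := 1) (by simp)
  have h2 : HasDerivAt Complex.GammaIntegral (-Real.eulerMascheroniConstant : ℂ) 1 := by
    refine Complex.hasDerivAt_Gamma_one.congr_of_eventuallyEq ?_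
    have : {s : ℂ | 0 < s.re} ∈ nhds (1 : ℂ) :=
      (isOpen_lt continuous_const Complex.continuous_re).mem_nhds (by simp)
    filter_upwards [this] with s hs
    exact (Complex.Gamma_eq_integral hs).symm
  have h3 := h1.unique h2
  have h4 : ∫ t in Set.Ioi (0 : ℝ), Real.log t * Real.exp (-t) =
      -Real.eulerMascheroniConstant := by
    apply Complex.ofReal_injective
    rw [← integral_complex_ofReal]
    push_cast
    simpa using h3
  refine ⟨?_, h4⟩
  -- a non-integrable function has integral `0`
  refine not_imp_comm.1 integral_undef ?_
  rw [h4]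
  have := Real.one_half_lt_eulerMascheroniConstant
  linarith

theorem tendsto_macdonaldLog :
    Filter.Tendsto macdonaldLog (nhdsWithin 0 (Set.Ioi 0))
      (nhds (-Real.eulerMascheroniConstant)) := by
  rw [← integrableOn_log_mul_exp_neg.2]
  refine tendsto_integral_filter_of_dominated_convergence
    (fun t => ‖Real.log t * Real.exp (-t)‖) ?_ ?_ integrableOn_log_mul_exp_neg.1.norm ?_
  · filter_upwards [self_mem_nhdsWithin] with w hw
    have := (integrableOn_log_mul_macdonald 1 hw).aestronglyMeasurable
    simpa using this
  · filter_upwards [self_mem_nhdsWithin] with w hw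
    filter_upwards [ae_restrict_mem measurableSet_Ioi] with t ht
    have ht : 0 < t := ht
    have hw : 0 < w := hw
    rw [norm_mul, norm_mul, Real.norm_of_nonneg (Real.exp_pos _).le,
      Real.norm_of_nonneg (Real.exp_pos _).le]
    gcongr
    have : 0 < w / t := by positivity
    linarith
  · filter_upwards with t
    have h : Continuous fun w : ℝ => Real.log t * Real.exp (-t - w / t) := by fun_prop
    have := (h.tendsto 0).mono_left (nhdsWithin_le_nhds (s := Set.Ioi 0))
    simpa using this

/-! ### The power series `∑ aₘ wᵐ / (m!)²` and the Macdonald function of order zero -/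

/-- The power series `∑ aₘ wᵐ / (m!)²`. -/
def factorialSqSeries (a : ℕ → ℂ) (w : ℂ) : ℂ :=
  ∑' m : ℕ, a m * w ^ m / (m.factorial : ℂ) ^ 2

theorem norm_factorialSqSeries_term_le {a : ℕ → ℂ} (ha : ∀ m, ‖a m‖ ≤ 2 * m.factorial) (w : ℂ)
    (m : ℕ) :
    ‖a m * w ^ m / (m.factorial : ℂ) ^ 2‖ ≤ 2 * (‖w‖ ^ m / m.factorial) := by
  have hm : (0 : ℝ) < m.factorial := by exact_mod_cast m.factorial_pos
  rw [norm_div, norm_mul, norm_pow, norm_pow, Complex.norm_natCast, div_le_iff₀ (by positivity)]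
  calc ‖a m‖ * ‖w‖ ^ m ≤ 2 * m.factorial * ‖w‖ ^ m := by gcongr; exact ha m
    _ = _ := by field_simp

theorem summable_factorialSqSeries {a : ℕ → ℂ} (ha : ∀ m, ‖a m‖ ≤ 2 * m.factorial) (w : ℂ) :
    Summable fun m : ℕ => a m * w ^ m / (m.factorial : ℂ) ^ 2 :=
  Summable.of_norm_bounded ((Real.summable_pow_div_factorial ‖w‖).mul_left 2)
    (norm_factorialSqSeries_term_le ha w)

theorem hasSum_pow_div_factorial_real (x : ℝ) :
    HasSum (fun m : ℕ => x ^ m / (m.factorial : ℝ)) (Real.exp x) := by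
  rw [Real.exp_eq_exp_ℝ]
  exact NormedSpace.expSeries_div_hasSum_exp x

theorem norm_factorialSqSeries_le {a : ℕ → ℂ} (ha : ∀ m, ‖a m‖ ≤ 2 * m.factorial) (w : ℂ) :
    ‖factorialSqSeries a w‖ ≤ 2 * Real.exp ‖w‖ := by
  refine (tsum_of_norm_bounded ((hasSum_pow_div_factorial_real ‖w‖).mul_left 2)
    (norm_factorialSqSeries_term_le ha w))

@[simp]
theorem factorialSqSeries_zero (a : ℕ → ℂ) : factorialSqSeries a 0 = a 0 := by
  rw [factorialSqSeries, tsum_eq_single 0 (fun m hm => by simp [hm])]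
  simp

theorem hasDerivAt_factorialSqSeries {a : ℕ → ℂ} (ha : ∀ m, ‖a m‖ ≤ 2 * m.factorial) (w : ℂ) :
    HasDerivAt (factorialSqSeries a)
      (factorialSqSeries (fun m => a (m + 1) / ((m : ℂ) + 1)) w) w := by
  set R := ‖w‖ + 1
  have hu : Summable fun m : ℕ => 2 * (m * R ^ (m - 1) / (m.factorial : ℝ)) := by
    refine Summable.mul_left 2 ((summable_nat_add_iff 1).1 ?_)
    refine (Real.summable_pow_div_factorial R).congr fun m => ?_
    have hm : (0 : ℝ) < m.factorial := by exact_mod_cast m.factorial_pos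
    rw [Nat.factorial_succ]
    push_cast
    field_simp
  have h := hasDerivAt_tsum_of_isPreconnected hu (Metric.isOpen_ball (x := (0 : ℂ)) (ε := R))
    (convex_ball (0 : ℂ) R).isPreconnected
    (g := fun m (w : ℂ) => a m * w ^ m / (m.factorial : ℂ) ^ 2)
    (g' := fun m (w : ℂ) => a m * (m * w ^ (m - 1)) / (m.factorial : ℂ) ^ 2)
    (fun m w _ => ((hasDerivAt_pow m w).const_mul (a m)).div_const _) ?_
    (Metric.mem_ball_self (by positivity)) (summable_factorialSqSeries ha 0)
    (y := w) (by rw [mem_ball_zero_iff]; exact lt_add_one _)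
  · refine h.congr_deriv ?_
    rw [tsum_eq_zero_add', factorialSqSeries]
    · simp only [CharP.cast_eq_zero, zero_mul, mul_zero, zero_div, zero_add]
      refine tsum_congr fun m => ?_
      have hm : (m.factorial : ℂ) ≠ 0 := by exact_mod_cast m.factorial_ne_zero
      have hm' : (m : ℂ) + 1 ≠ 0 := by exact_mod_cast m.succ_ne_zero
      rw [Nat.factorial_succ]
      push_cast
      field_simp
    · have hs := summable_factorialSqSeries (a := fun m => a (m + 1) / ((m : ℂ) + 1)) ?_ w
      · refine hs.congr fun m => ?_
        have hm : (m.factorial : ℂ) ≠ 0 := by exact_mod_cast m.factorial_ne_zero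
        have hm' : (m : ℂ) + 1 ≠ 0 := by exact_mod_cast m.succ_ne_zero
        rw [Nat.factorial_succ]
        push_cast
        field_simp
      · intro m
        rw [norm_div, ← Nat.cast_succ, Complex.norm_natCast, div_le_iff₀ (by positivity)]
        refine (ha (m + 1)).trans (le_of_eq ?_)
        rw [Nat.factorial_succ]
        push_cast
        ring
  · intro m y hy
    rw [mem_ball_zero_iff] at hy
    have hm : (0 : ℝ) < m.factorial := by exact_mod_cast m.factorial_pos
    rw [norm_div, norm_mul, norm_mul, norm_pow, norm_pow, Complex.norm_natCast,
      Complex.norm_natCast, div_le_iff₀ (by positivity)]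
    calc ‖a m‖ * (m * ‖y‖ ^ (m - 1)) ≤ 2 * m.factorial * (m * R ^ (m - 1)) := by
          gcongr; exact ha m
      _ = _ := by field_simp

/-- Euler's operator `w d/dw` multiplies the coefficients by `m`. -/
theorem mul_factorialSqSeries_shift (a : ℕ → ℂ) (ha : ∀ m : ℕ, ‖(m : ℂ) * a m‖ ≤ 2 * m.factorial)
    (w : ℂ) :
    w * factorialSqSeries (fun m => a (m + 1) / ((m : ℂ) + 1)) w =
      factorialSqSeries (fun m => m * a m) w := by
  rw [factorialSqSeries, factorialSqSeries, (summable_factorialSqSeries ha w).tsum_eq_zero_add,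
    ← tsum_mul_left]
  simp only [CharP.cast_eq_zero, zero_mul, zero_div, zero_add]
  refine tsum_congr fun m => ?_
  have hm : (m.factorial : ℂ) ≠ 0 := by exact_mod_cast m.factorial_ne_zero
  have hm' : (m : ℂ) + 1 ≠ 0 := by exact_mod_cast m.succ_ne_zero
  rw [Nat.factorial_succ]
  push_cast
  field_simp
  ring

theorem differentiable_factorialSqSeries {a : ℕ → ℂ} (ha : ∀ m, ‖a m‖ ≤ 2 * m.factorial) :
    Differentiable ℂ (factorialSqSeries a) :=
  fun w => (hasDerivAt_factorialSqSeries ha w).differentiableAt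

/-- The harmonic numbers, as complex numbers. -/
def harmonicC (m : ℕ) : ℂ := ((harmonic m : ℚ) : ℂ)

theorem harmonicC_succ (m : ℕ) : harmonicC (m + 1) = harmonicC m + 1 / ((m : ℂ) + 1) := by
  simp [harmonicC, harmonic_succ]

theorem norm_harmonicC_le (m : ℕ) : ‖harmonicC m‖ ≤ m := by
  induction m with
  | zero => simp [harmonicC]
  | succ m ih =>
    rw [harmonicC_succ]
    refine (norm_add_le _ _).trans ?_
    push_cast
    refine add_le_add ih ?_
    rw [← Nat.cast_succ, norm_div, norm_one, Complex.norm_natCast,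
      div_le_one (by positivity)]
    simp

theorem nat_mul_self_le_two_mul_factorial (m : ℕ) : m * m ≤ 2 * m.factorial := by
  induction m with
  | zero => simp
  | succ n ih =>
    rcases n with _ | _ | n
    · simp
    · simp [Nat.factorial]
    · rw [Nat.factorial_succ (n + 1 + 1)]
      have h2 : (n + 1 + 1).factorial ≥ n + 1 + 1 := Nat.self_le_factorial _
      nlinarith

theorem norm_coeff_le (m : ℕ) :
    ‖(1 : ℂ)‖ ≤ 2 * m.factorial ∧ ‖(m : ℂ) * 1‖ ≤ 2 * m.factorial ∧
    ‖harmonicC m‖ ≤ 2 * m.factorial ∧ ‖(m : ℂ) * harmonicC m‖ ≤ 2 * m.factorial := by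
  have h1 : (1 : ℝ) ≤ m.factorial := by exact_mod_cast m.factorial_pos
  have h2 : (m : ℝ) ≤ m.factorial := by exact_mod_cast Nat.self_le_factorial m
  have h3 : (m : ℝ) * m ≤ 2 * m.factorial := by
    exact_mod_cast nat_mul_self_le_two_mul_factorial m
  have h4 := norm_harmonicC_le m
  refine ⟨by rw [norm_one]; linarith, by rw [mul_one, Complex.norm_natCast]; linarith,
    by linarith, ?_⟩
  rw [norm_mul, Complex.norm_natCast]
  exact (mul_le_mul_of_nonneg_left h4 (by positivity)).trans h3

/-- `I₀(2√w)`. -/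
def seriesI : ℂ → ℂ := factorialSqSeries fun _ => 1

/-- The power series part `∑ hₘ wᵐ / (m!)²` of `K₀(2√w)`. -/
def seriesH : ℂ → ℂ := factorialSqSeries harmonicC

theorem differentiable_seriesI : Differentiable ℂ seriesI :=
  differentiable_factorialSqSeries fun m => (norm_coeff_le m).1

theorem differentiable_seriesH : Differentiable ℂ seriesH :=
  differentiable_factorialSqSeries fun m => (norm_coeff_le m).2.2.1

theorem hasDerivAt_seriesI {w : ℂ} (hw : w ≠ 0) :
    HasDerivAt seriesI (factorialSqSeries (fun m => (m : ℂ) * 1) w / w) w := by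
  rw [← mul_factorialSqSeries_shift (fun _ => 1) (fun m => (norm_coeff_le m).2.1),
    mul_div_cancel_left₀ _ hw]
  exact hasDerivAt_factorialSqSeries (fun m => (norm_coeff_le m).1) w

theorem hasDerivAt_seriesH {w : ℂ} (hw : w ≠ 0) :
    HasDerivAt seriesH (factorialSqSeries (fun m => (m : ℂ) * harmonicC m) w / w) w := by
  rw [← mul_factorialSqSeries_shift harmonicC (fun m => (norm_coeff_le m).2.2.2),
    mul_div_cancel_left₀ _ hw]
  exact hasDerivAt_factorialSqSeries (fun m => (norm_coeff_le m).2.2.1) w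

theorem hasDerivAt_mul_deriv_seriesI (w : ℂ) :
    HasDerivAt (factorialSqSeries (fun m => (m : ℂ) * 1)) (seriesI w) w := by
  refine (hasDerivAt_factorialSqSeries (fun m => (norm_coeff_le m).2.1) w).congr_deriv ?_
  rw [seriesI]
  congr 1
  ext m
  have hm' : (m : ℂ) + 1 ≠ 0 := by exact_mod_cast m.succ_ne_zero
  push_cast
  field_simp

theorem hasDerivAt_mul_deriv_seriesH {w : ℂ} (hw : w ≠ 0) :
    HasDerivAt (factorialSqSeries (fun m => (m : ℂ) * harmonicC m))
      (seriesH w + factorialSqSeries (fun m => (m : ℂ) * 1) w / w) w := by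
  refine (hasDerivAt_factorialSqSeries (fun m => (norm_coeff_le m).2.2.2) w).congr_deriv ?_
  rw [← mul_factorialSqSeries_shift (fun _ => 1) (fun m => (norm_coeff_le m).2.1),
    mul_div_cancel_left₀ _ hw, seriesH, factorialSqSeries, factorialSqSeries, factorialSqSeries,
    ← (summable_factorialSqSeries (fun m => (norm_coeff_le m).2.2.1) w).tsum_add]
  · refine tsum_congr fun m => ?_
    have hm : (m.factorial : ℂ) ≠ 0 := by exact_mod_cast m.factorial_ne_zero
    have hm' : (m : ℂ) + 1 ≠ 0 := by exact_mod_cast m.succ_ne_zero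
    rw [harmonicC_succ]
    push_cast
    field_simp
  · refine summable_factorialSqSeries (fun m => ?_) w
    have h1 : (1 : ℝ) ≤ m.factorial := by exact_mod_cast m.factorial_pos
    rw [norm_div, norm_one, ← Nat.cast_succ, Complex.norm_natCast]
    refine (div_le_self zero_le_one (by simp)).trans (by linarith)

theorem one_le_re_seriesI {w : ℝ} (hw : 0 ≤ w) : 1 ≤ (seriesI w).re := by
  have hs := summable_factorialSqSeries (a := fun _ => 1) (fun m => (norm_coeff_le m).1) w
  have e : ∀ m : ℕ, (1 * (w : ℂ) ^ m / (m.factorial : ℂ) ^ 2).re =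
      w ^ m / (m.factorial : ℝ) ^ 2 := by
    intro m
    rw [one_mul]
    norm_cast
  rw [seriesI, factorialSqSeries, Complex.re_tsum hs]
  simp only [e]
  have hs' := (Complex.hasSum_re hs.hasSum).summable
  simp only [e] at hs'
  have := hs'.le_tsum 0 (fun m _ => by positivity)
  simpa using this

theorem tendsto_ofReal_nhdsGT_zero {f : ℂ → ℂ} (hf : Continuous f) :
    Filter.Tendsto (fun w : ℝ => f w) (nhdsWithin 0 (Set.Ioi 0)) (nhds (f 0)) := by
  have h : Continuous fun w : ℝ => f w := hf.comp Complex.continuous_ofReal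
  simpa using (h.tendsto 0).mono_left (nhdsWithin_le_nhds (s := Set.Ioi 0))

theorem abs_one_sub_macdonaldIntegral_one_le {w : ℝ} (hw : 0 < w) :
    |1 - macdonaldIntegral 1 w| ≤ √w * √Real.pi := by
  have i1 : IntegrableOn (fun t => Real.exp (-t - w / t)) (Set.Ioi 0) := by
    simpa using integrableOn_macdonald 1 hw
  have e : macdonaldIntegral 1 w = ∫ t in Set.Ioi (0 : ℝ), Real.exp (-t - w / t) := by
    simp [macdonaldIntegral]
  have i2 := Real.GammaIntegral_convergent (s := 1 / 2) (by norm_num)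
  rw [e, ← integral_exp_neg_Ioi_zero, ← integral_sub (integrableOn_exp_neg_Ioi 0) i1,
    ← Real.Gamma_one_half_eq, Real.Gamma_eq_integral (by norm_num), ← integral_const_mul,
    ← Real.norm_eq_abs]
  refine norm_integral_le_of_norm_le (i2.const_mul _) ?_
  filter_upwards [ae_restrict_mem measurableSet_Ioi] with t ht
  have ht : 0 < t := ht
  have h0 : 0 < w / t := by positivity
  have h1 : Real.exp (-t - w / t) = Real.exp (-t) * Real.exp (-(w / t)) := by
    rw [← Real.exp_add]; rfl
  have h2 : Real.exp (-(w / t)) ≤ 1 := Real.exp_le_one_iff.2 (by linarith)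
  have h3 : 1 - Real.exp (-(w / t)) ≤ √(w / t) := by
    rcases le_total (w / t) 1 with h | h
    · have h4 := Real.add_one_le_exp (-(w / t))
      have h5 : w / t ≤ √(w / t) := Real.le_sqrt_of_sq_le (by nlinarith)
      linarith
    · have h5 : 1 ≤ √(w / t) := Real.one_le_sqrt.2 h
      have := Real.exp_pos (-(w / t))
      linarith
  have h4 : t ^ ((1 : ℝ) / 2 - 1) = (√t)⁻¹ := by
    rw [Real.sqrt_eq_rpow, ← Real.rpow_neg ht.le]
    norm_num
  rw [h1, ← mul_one_sub, Real.norm_of_nonneg (mul_nonneg (Real.exp_pos _).le (by linarith)), h4]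
  calc _ ≤ Real.exp (-t) * √(w / t) := by gcongr
    _ = _ := by rw [Real.sqrt_div hw.le, div_eq_mul_inv]; ring

theorem tendsto_log_mul_sqrt :
    Filter.Tendsto (fun w => Real.log w * √w) (nhdsWithin 0 (Set.Ioi 0)) (nhds 0) := by
  simpa only [Real.sqrt_eq_rpow] using tendsto_log_mul_rpow_nhdsGT_zero (r := 1 / 2) (by norm_num)

theorem tendsto_log_mul_self :
    Filter.Tendsto (fun w => Real.log w * w) (nhdsWithin 0 (Set.Ioi 0)) (nhds 0) := by
  simpa only [Real.rpow_one] using tendsto_log_mul_rpow_nhdsGT_zero (r := 1) (by norm_num)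

/-- `log w · (g w - g 0) → 0` as `w → 0+`. -/
theorem tendsto_log_mul_sub {g : ℂ → ℂ} (hg : DifferentiableAt ℂ g 0) :
    Filter.Tendsto (fun w : ℝ => (Real.log w : ℂ) * (g w - g 0)) (nhdsWithin 0 (Set.Ioi 0))
      (nhds 0) := by
  have h1 : Filter.Tendsto (fun w : ℝ => dslope g 0 w) (nhdsWithin 0 (Set.Ioi 0))
      (nhds (dslope g 0 0)) := by
    have : ContinuousAt (dslope g 0) ((0 : ℝ) : ℂ) := by
      rw [Complex.ofReal_zero]; exact continuousAt_dslope_same.2 hg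
    have h := (this.comp (f := fun w : ℝ => (w : ℂ))
      Complex.continuous_ofReal.continuousAt).tendsto
    simpa [Function.comp_def] using h.mono_left (nhdsWithin_le_nhds (s := Set.Ioi 0))
  have h2 := ((Complex.continuous_ofReal.tendsto _).comp tendsto_log_mul_self).mul h1
  simp only [Complex.ofReal_zero, zero_mul, Function.comp_def] at h2
  refine h2.congr fun w => ?_
  have := sub_smul_dslope g 0 (w : ℂ)
  rw [sub_zero, smul_eq_mul] at this
  rw [← this]
  push_cast
  ring

set_option maxHeartbeats 800000 in
/-- The classical series of `2 K₀(2√w)`. Both sides solve `(w u')' = u`, and so does `I₀(2√w)`;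
the Wronskian of the difference of the two sides with `I₀(2√w)` is constant and vanishes at
`w = 0`, where also the difference itself vanishes. -/
theorem macdonaldIntegral_zero_eq_series {w : ℝ} (hw : 0 < w) :
    (macdonaldIntegral 0 w : ℂ) =
      -((Real.log w : ℂ) + 2 * Real.eulerMascheroniConstant) * seriesI w + 2 * seriesH w := by
  set γ : ℂ := ((Real.eulerMascheroniConstant : ℝ) : ℂ) with hγ
  set I1 : ℂ → ℂ := factorialSqSeries (fun m => (m : ℂ) * 1) with hI1
  set H1 : ℂ → ℂ := factorialSqSeries (fun m => (m : ℂ) * harmonicC m) with hH1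
  set D : ℝ → ℂ := fun w => (macdonaldIntegral 0 w : ℂ) -
    (-((Real.log w : ℂ) + 2 * γ) * seriesI w + 2 * seriesH w) with hD
  set N : ℝ → ℂ := fun w => (macdonaldIntegral 1 w : ℂ) -
    (seriesI w + ((Real.log w : ℂ) + 2 * γ) * I1 w - 2 * H1 w) with hN
  have hlog : ∀ w : ℝ, 0 < w → HasDerivAt (fun w : ℝ => (Real.log w : ℂ) + 2 * γ) (1 / w) w :=
    fun w hw => by
      have := ((Real.hasDerivAt_log hw.ne').ofReal_comp).add_const (2 * γ)
      refine this.congr_deriv (by push_cast; rw [one_div])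
  have hc : ∀ w : ℝ, 0 < w → (w : ℂ) ≠ 0 := fun w hw => by exact_mod_cast hw.ne'
  have hdI : ∀ w : ℝ, 0 < w → HasDerivAt (fun w : ℝ => seriesI w) (I1 w / w) w :=
    fun w hw => (hasDerivAt_seriesI (hc w hw)).comp_ofReal
  have hdI1 : ∀ w : ℝ, 0 < w → HasDerivAt (fun w : ℝ => I1 w) (seriesI w) w :=
    fun w hw => (hasDerivAt_mul_deriv_seriesI w).comp_ofReal
  have hdD : ∀ w, 0 < w → HasDerivAt D (-N w / w) w := by
    intro w hw
    have h1 := (hasDerivAt_macdonaldIntegral 0 hw).ofReal_comp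
    have h2 : macdonaldIntegral (0 - 1) w = macdonaldIntegral 1 w / w := by
      rw [zero_sub, macdonaldIntegral_neg 1 hw, Real.rpow_neg_one]
      ring
    rw [h2] at h1
    have h3 := (hasDerivAt_seriesH (hc w hw)).comp_ofReal
    refine (h1.sub (((hlog w hw).neg.mul (hdI w hw)).add (h3.const_mul 2))).congr_deriv ?_
    simp only [hN, Pi.neg_apply, ← hH1]
    push_cast
    ring
  have hdN : ∀ w, 0 < w → HasDerivAt N (-D w) w := by
    intro w hw
    have h1 := (hasDerivAt_macdonaldIntegral 1 hw).ofReal_comp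
    rw [sub_self] at h1
    have h3 := (hasDerivAt_mul_deriv_seriesH (hc w hw)).comp_ofReal
    refine (h1.sub (((hdI w hw).add ((hlog w hw).mul (hdI1 w hw))).sub
      (h3.const_mul 2))).congr_deriv ?_
    simp only [hD, ← hI1]
    push_cast
    ring
  have cI : Continuous seriesI := differentiable_seriesI.continuous
  have cH : Continuous seriesH := differentiable_seriesH.continuous
  have dI1 : Differentiable ℂ I1 := fun w => (hasDerivAt_mul_deriv_seriesI w).differentiableAt
  have dH1 : Differentiable ℂ H1 :=
    differentiable_factorialSqSeries fun m => (norm_coeff_le m).2.2.2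
  have I0 : seriesI 0 = 1 := by simp [seriesI]
  have H0 : seriesH 0 = 0 := by simp [seriesH, harmonicC]
  have I10 : I1 0 = 0 := by simp [hI1]
  have H10 : H1 0 = 0 := by simp [hH1]
  have tI := tendsto_ofReal_nhdsGT_zero cI
  have tH := tendsto_ofReal_nhdsGT_zero cH
  have tI1 := tendsto_ofReal_nhdsGT_zero dI1.continuous
  have tH1 := tendsto_ofReal_nhdsGT_zero dH1.continuous
  rw [I0] at tI; rw [H0] at tH; rw [I10] at tI1; rw [H10] at tH1
  have tlI := tendsto_log_mul_sub differentiable_seriesI.differentiableAt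
  have tlI1 := tendsto_log_mul_sub dI1.differentiableAt
  have tE : Filter.Tendsto (fun w : ℝ => ((macdonaldIntegral 1 w : ℝ) : ℂ))
      (nhdsWithin 0 (Set.Ioi 0)) (nhds 1) := by
    have := (Complex.continuous_ofReal.tendsto _).comp
      (tendsto_macdonaldIntegral_zero (s := 1) one_pos)
    simpa [Function.comp_def] using this
  have tN : Filter.Tendsto N (nhdsWithin 0 (Set.Ioi 0)) (nhds 0) := by
    have := tE.sub ((tI.add (tlI1.add (tI1.const_mul (2 * γ)))).sub (tH1.const_mul 2))
    simp only [I10, sub_zero, mul_zero, add_zero, sub_self] at this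
    refine this.congr fun w => ?_
    simp only [hN]
    ring
  have tD : Filter.Tendsto D (nhdsWithin 0 (Set.Ioi 0)) (nhds 0) := by
    have t1 : Filter.Tendsto (fun w : ℝ => ((Real.log w * (1 - macdonaldIntegral 1 w) : ℝ) : ℂ))
        (nhdsWithin 0 (Set.Ioi 0)) (nhds 0) := by
      have h0 : Filter.Tendsto (fun w : ℝ => Real.log w * (1 - macdonaldIntegral 1 w))
          (nhdsWithin 0 (Set.Ioi 0)) (nhds 0) := by
        refine squeeze_zero_norm' (a := fun w => |Real.log w * √w| * √Real.pi) ?_ ?_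
        · filter_upwards [self_mem_nhdsWithin] with w hw
          rw [norm_mul, Real.norm_eq_abs, Real.norm_eq_abs, abs_mul, mul_assoc,
            abs_of_nonneg (Real.sqrt_nonneg w)]
          gcongr
          exact abs_one_sub_macdonaldIntegral_one_le hw
        · simpa using (tendsto_log_mul_sqrt.abs).mul_const (√Real.pi)
      simpa [Function.comp_def] using (Complex.continuous_ofReal.tendsto _).comp h0
    have t2 := (Complex.continuous_ofReal.tendsto _).comp tendsto_macdonaldLog
    have := (((t2.const_mul 2).add t1).add (tlI.add (tI.const_mul (2 * γ)))).sub (tH.const_mul 2)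
    simp only [Complex.ofReal_neg, ← hγ, mul_zero, sub_zero, mul_one, add_zero, zero_add] at this
    rw [show 2 * -γ + 2 * γ = 0 by ring] at this
    refine this.congr' ?_
    filter_upwards [self_mem_nhdsWithin] with w hw
    simp only [hD, macdonaldIntegral_zero_eq hw, Function.comp_def, I0]
    push_cast
    ring
  have hW : ∀ w : ℝ, 0 < w → seriesI w * N w + D w * I1 w = 0 := by
    intro w hw
    refine eq_of_hasDerivAt_zero_of_tendsto (g := fun w : ℝ => seriesI w * N w + D w * I1 w)
      (fun w hw => ?_) ?_ hw
    · refine (((hdI w hw).mul (hdN w hw)).add ((hdD w hw).mul (hdI1 w hw))).congr_deriv ?_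
      ring
    · simpa using (tI.mul tN).add (tD.mul tI1)
  have hI : ∀ w : ℝ, 0 < w → seriesI w ≠ 0 := by
    intro w hw h
    have := one_le_re_seriesI hw.le
    rw [h, Complex.zero_re] at this
    linarith
  have hfin : D w / seriesI w = 0 := by
    refine eq_of_hasDerivAt_zero_of_tendsto (g := fun w : ℝ => D w / seriesI w)
      (fun w hw => ?_) ?_ hw
    · refine ((hdD w hw).div (hdI w hw) (hI w hw)).congr_deriv ?_
      have e : -N w / w * seriesI w - D w * (I1 w / w) =
          -(seriesI w * N w + D w * I1 w) / w := by ring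
      rw [e, hW w hw]
      simp
    · have := tD.div tI one_ne_zero
      rw [zero_div] at this
      exact this
  have h0 : D w = 0 := by simpa [hI w hw] using hfin
  exact sub_eq_zero.1 h0

/-! ### The fundamental solution with a complex spectral parameter -/

/-- The radial profile of the fundamental solution of `-Δ + z` in `ℝ^(d+1)`, for `d = 1` and
`d = 2`: a holomorphic function of `z ∈ ℂ \ (-∞, 0]`. For `d = 1` it is `K₀(r √z) / (2π)`, written
as a series. -/
def yukawaKernel (d : ℕ) (z : ℂ) (r : ℝ) : ℂ :=
  if d = 1 then
    1 / (4 * Real.pi) * (-(Complex.log z + 2 * (Real.log (r / 2) : ℂ) +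
      2 * (Real.eulerMascheroniConstant : ℂ)) * seriesI (z * ((r ^ 2 / 4 : ℝ) : ℂ)) +
      2 * seriesH (z * ((r ^ 2 / 4 : ℝ) : ℂ)))
  else Complex.exp (-z ^ (1 / 2 : ℂ) * r) / (4 * Real.pi * r)

/-- The radial profile of the fundamental solution of the Helmholtz equation in `ℝ^(d+1)`. -/
def helmholtzRadial (d : ℕ) (k r : ℝ) : ℂ :=
  if d + 1 = 3 then
    Complex.exp (Complex.I * ((k * r : ℝ) : ℂ)) / ((4 * Real.pi * r : ℝ) : ℂ)
  else Complex.I / 4 * hankelZero (k * r)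

/-- The integral over `t > 0` of the heat kernel of `ℝ^(d+1)` at distance `r`, with weight
`exp (-l t)`. -/
def heatIntegral (d : ℕ) (l r : ℝ) : ℝ :=
  ∫ t in Set.Ioi (0 : ℝ), (4 * Real.pi * t) ^ (-((d : ℝ) + 1) / 2) *
    Real.exp (-(r ^ 2 / (4 * t)) - l * t)

theorem heatIntegral_eq_macdonaldIntegral (d : ℕ) {l : ℝ} (hl : 0 < l) (r : ℝ) :
    heatIntegral d l r = (4 * Real.pi) ^ (-((d : ℝ) + 1) / 2) * l ^ (((d : ℝ) - 1) / 2) *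
      macdonaldIntegral ((1 - d) / 2) (l * (r ^ 2 / 4)) := by
  have hp := Real.pi_pos
  have h1 := integral_comp_mul_left_Ioi
    (fun t => t ^ ((1 - (d : ℝ)) / 2 - 1) * Real.exp (-t - l * (r ^ 2 / 4) / t)) 0 hl
  rw [mul_zero, smul_eq_mul] at h1
  have h2 : macdonaldIntegral ((1 - d) / 2) (l * (r ^ 2 / 4)) =
      l * ∫ t in Set.Ioi (0 : ℝ), (l * t) ^ ((1 - (d : ℝ)) / 2 - 1) *
        Real.exp (-(l * t) - l * (r ^ 2 / 4) / (l * t)) := by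
    rw [h1, mul_inv_cancel_left₀ hl.ne', macdonaldIntegral]
  rw [h2, ← mul_assoc, ← integral_const_mul, heatIntegral]
  refine setIntegral_congr_fun measurableSet_Ioi fun t ht => ?_
  have ht : 0 < t := ht
  have e1 : (1 - (d : ℝ)) / 2 - 1 = -((d : ℝ) + 1) / 2 := by ring
  have e2 : -(l * t) - l * (r ^ 2 / 4) / (l * t) = -(r ^ 2 / (4 * t)) - l * t := by
    field_simp
    ring
  have e3 : l ^ (((d : ℝ) - 1) / 2) * l * l ^ (-((d : ℝ) + 1) / 2) = 1 := by
    rw [← Real.rpow_add_one hl.ne', ← Real.rpow_add hl]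
    ring_nf
    simp
  simp only [e1, e2]
  rw [Real.mul_rpow (by positivity) ht.le, Real.mul_rpow hl.le ht.le]
  linear_combination -((4 * Real.pi) ^ (-((d : ℝ) + 1) / 2) * t ^ (-((d : ℝ) + 1) / 2) *
    Real.exp (-(r ^ 2 / (4 * t)) - l * t)) * e3

theorem yukawaKernel_ofReal {d : ℕ} (hd : d = 1 ∨ d = 2) {l r : ℝ} (hl : 0 < l) (hr : 0 < r) :
    yukawaKernel d l r = (heatIntegral d l r : ℂ) := by
  have hp := Real.pi_pos
  rw [heatIntegral_eq_macdonaldIntegral d hl]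
  rcases hd with rfl | rfl
  · have e1 : Real.log (l * (r ^ 2 / 4)) = Real.log l + 2 * Real.log (r / 2) := by
      rw [show r ^ 2 / 4 = (r / 2) ^ 2 by ring, Real.log_mul hl.ne' (by positivity), Real.log_pow]
      norm_num
    simp only [yukawaKernel, if_true, Nat.cast_one, sub_self, zero_div, Real.rpow_zero, mul_one]
    rw [Complex.ofReal_mul, macdonaldIntegral_zero_eq_series (by positivity), e1,
      show (-(1 + 1) / 2 : ℝ) = -1 by norm_num, Real.rpow_neg_one, ← Complex.ofReal_log hl.le]
    push_cast
    rw [one_div]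
  · have hw : 0 < l * (r ^ 2 / 4) := by positivity
    have e1 : √(l * (r ^ 2 / 4)) = √l * r / 2 := by
      rw [show l * (r ^ 2 / 4) = l * (r / 2) ^ 2 by ring, Real.sqrt_mul hl.le,
        Real.sqrt_sq (by positivity)]
      ring
    have e2 : (4 * Real.pi) ^ (-(((2 : ℕ) : ℝ) + 1) / 2) = (4 * Real.pi * (2 * √Real.pi))⁻¹ := by
      rw [show (-(((2 : ℕ) : ℝ) + 1) / 2) = -(1 + 1 / 2) by norm_num,
        Real.rpow_neg (by positivity), Real.rpow_add (by positivity), Real.rpow_one,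
        ← Real.sqrt_eq_rpow, Real.sqrt_mul (by norm_num)]
      norm_num
    have e3 : l ^ ((((2 : ℕ) : ℝ) - 1) / 2) = √l := by
      rw [Real.sqrt_eq_rpow]; norm_num
    have e4 : macdonaldIntegral ((1 - ((2 : ℕ) : ℝ)) / 2) (l * (r ^ 2 / 4)) =
        2 * √Real.pi / (√l * r) * Real.exp (-(√l * r)) := by
      rw [show ((1 - ((2 : ℕ) : ℝ)) / 2) = -(1 / 2) by norm_num, macdonaldIntegral_neg _ hw,
        macdonaldIntegral_half hw, Real.rpow_neg hw.le, ← Real.sqrt_eq_rpow, e1]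
      have : -2 * (√l * r / 2) = -(√l * r) := by ring
      rw [this]
      field_simp
    have e5 : (l : ℂ) ^ (1 / 2 : ℂ) = ((√l : ℝ) : ℂ) := by
      rw [Real.sqrt_eq_rpow, Complex.ofReal_cpow hl.le]
      norm_num
    have hsl : 0 < √l := Real.sqrt_pos.2 hl
    have hsp : 0 < √Real.pi := Real.sqrt_pos.2 hp
    have e6 : (4 * Real.pi * (2 * √Real.pi))⁻¹ * √l *
        (2 * √Real.pi / (√l * r) * Real.exp (-(√l * r))) =
        Real.exp (-(√l * r)) / (4 * Real.pi * r) := by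
      field_simp
    rw [e2, e3, e4, e6]
    simp only [yukawaKernel, OfNat.ofNat_ne_one, if_false, e5]
    push_cast
    rw [neg_mul]

theorem differentiableOn_yukawaKernel (d : ℕ) (r : ℝ) :
    DifferentiableOn ℂ (fun z => yukawaKernel d z r) Complex.slitPlane := by
  intro z hz
  refine DifferentiableAt.differentiableWithinAt ?_
  have h1 := differentiable_seriesI
  have h2 := differentiable_seriesH
  have h3 : DifferentiableAt ℂ Complex.log z := Complex.differentiableAt_log hz
  have h4 : DifferentiableAt ℂ (fun z : ℂ => z ^ (1 / 2 : ℂ)) z :=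
    differentiableAt_id.cpow_const hz
  unfold yukawaKernel
  split_ifs <;> fun_prop

theorem continuousOn_yukawaKernel (d : ℕ) (z : ℂ) :
    ContinuousOn (yukawaKernel d z) (Set.Ioi 0) := by
  have h1 := differentiable_seriesI.continuous
  have h2 := differentiable_seriesH.continuous
  have h3 : ContinuousOn (fun r : ℝ => Real.log (r / 2)) (Set.Ioi 0) :=
    ContinuousOn.log (by fun_prop) fun r hr => (half_pos hr).ne'
  have h4 : ContinuousOn (fun r : ℝ => ((Real.log (r / 2) : ℝ) : ℂ)) (Set.Ioi 0) :=
    Complex.continuous_ofReal.comp_continuousOn h3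
  unfold yukawaKernel
  split_ifs
  · fun_prop
  · refine ContinuousOn.div (by fun_prop) (by fun_prop) fun r hr => ?_
    have h5 : (r : ℂ) ≠ 0 := by exact_mod_cast (ne_of_gt hr)
    have h6 : (Real.pi : ℂ) ≠ 0 := by exact_mod_cast Real.pi_ne_zero
    exact mul_ne_zero (mul_ne_zero (by norm_num) h6) h5

theorem re_cpow_half_nonneg (z : ℂ) : 0 ≤ (z ^ (1 / 2 : ℂ)).re := by
  rcases eq_or_ne z 0 with rfl | hz
  · simp
  · rw [Complex.cpow_def_of_ne_zero hz, Complex.exp_re]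
    refine mul_nonneg (Real.exp_pos _).le (Real.cos_nonneg_of_mem_Icc ?_)
    have h : (Complex.log z * (1 / 2)).im = Complex.arg z / 2 := by
      simp [Complex.mul_im, Complex.log_im]
      ring
    have h1 := Complex.neg_pi_lt_arg z
    have h2 := Complex.arg_le_pi z
    rw [h]
    constructor <;> linarith

/-- The singularity `r^(-d/2)` is not sharp for `d = 1`, where the kernel is logarithmic; it is a
common integrable bound, locally uniform in `z ≠ 0`. -/
theorem exists_norm_yukawaKernel_le {d : ℕ} (hd : d = 1 ∨ d = 2) {D : ℝ} (hD : 0 < D) :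
    ∃ B : ℂ → ℝ, ContinuousOn B {0}ᶜ ∧ ∀ z, ∀ r, 0 < r → r ≤ D →
      ‖yukawaKernel d z r‖ ≤ B z * r ^ (-(d : ℝ) / 2) := by
  have hp := Real.pi_pos
  have hγ : 0 < Real.eulerMascheroniConstant := by
    linarith [Real.one_half_lt_eulerMascheroniConstant]
  rcases hd with rfl | rfl
  · set T := √D with hT
    have hT0 : 0 < T := Real.sqrt_pos.2 hD
    refine ⟨fun z => 1 / (4 * Real.pi) * (((|Real.log ‖z‖| + Real.pi + 2 * Real.log 2 +
      2 * Real.eulerMascheroniConstant) * T + 4 * (T ^ 2 + 1)) *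
        (2 * Real.exp (‖z‖ * (D ^ 2 / 4))) + 2 * (2 * Real.exp (‖z‖ * (D ^ 2 / 4))) * T),
      ?_, fun z r hr hrD => ?_⟩
    · have h1 : ContinuousOn (fun z : ℂ => Real.log ‖z‖) {0}ᶜ :=
        ContinuousOn.log (by fun_prop) fun z hz => norm_ne_zero_iff.2 hz
      fun_prop
    set s := √r with hs
    have hs0 : 0 < s := Real.sqrt_pos.2 hr
    have hsT : s ≤ T := Real.sqrt_le_sqrt hrD
    have hr1 : r ^ (-((1 : ℕ) : ℝ) / 2) = s⁻¹ := by
      rw [hs, Real.sqrt_eq_rpow, ← Real.rpow_neg hr.le]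
      norm_num
    have hlogr : |Real.log r| ≤ 2 * (s + s⁻¹) := by
      have e : Real.log r = 2 * Real.log s := by
        rw [hs, Real.log_sqrt hr.le]; ring
      rw [e, abs_mul, abs_two]
      exact mul_le_mul_of_nonneg_left (abs_log_le_add_inv hs0) zero_le_two
    have harg : ‖z * ((r ^ 2 / 4 : ℝ) : ℂ)‖ ≤ ‖z‖ * (D ^ 2 / 4) := by
      rw [norm_mul, Complex.norm_real, Real.norm_of_nonneg (by positivity)]
      gcongr
    have hI : ‖seriesI (z * ((r ^ 2 / 4 : ℝ) : ℂ))‖ ≤ 2 * Real.exp (‖z‖ * (D ^ 2 / 4)) :=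
      (norm_factorialSqSeries_le (fun m => (norm_coeff_le m).1) _).trans (by gcongr)
    have hH : ‖seriesH (z * ((r ^ 2 / 4 : ℝ) : ℂ))‖ ≤ 2 * Real.exp (‖z‖ * (D ^ 2 / 4)) :=
      (norm_factorialSqSeries_le (fun m => (norm_coeff_le m).2.2.1) _).trans (by gcongr)
    have hlogz : ‖Complex.log z‖ ≤ |Real.log ‖z‖| + Real.pi := by
      refine (Complex.norm_le_abs_re_add_abs_im _).trans ?_
      rw [Complex.log_re, Complex.log_im]
      gcongr
      exact Complex.abs_arg_le_pi z
    have hlog2 : ‖(2 * (Real.log (r / 2) : ℂ))‖ ≤ 4 * (s + s⁻¹) + 2 * Real.log 2 := by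
      rw [norm_mul, Complex.norm_real, Real.norm_eq_abs, Real.log_div hr.ne' two_ne_zero]
      have h1 := abs_sub (Real.log r) (Real.log 2)
      rw [abs_of_nonneg (Real.log_nonneg one_le_two)] at h1
      rw [Complex.norm_two]
      linarith
    have hγn : ‖(2 * (Real.eulerMascheroniConstant : ℂ))‖ = 2 * Real.eulerMascheroniConstant := by
      rw [norm_mul, Complex.norm_real, Real.norm_of_nonneg hγ.le, Complex.norm_two]
    have hsum : ‖-(Complex.log z + 2 * (Real.log (r / 2) : ℂ) +
        2 * (Real.eulerMascheroniConstant : ℂ))‖ ≤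
        ((|Real.log ‖z‖| + Real.pi + 2 * Real.log 2 + 2 * Real.eulerMascheroniConstant) * T +
          4 * (T ^ 2 + 1)) * s⁻¹ := by
      rw [norm_neg]
      refine (norm_add₃_le).trans ?_
      rw [hγn]
      have h1 : 1 ≤ T * s⁻¹ := by rw [← div_eq_mul_inv, one_le_div hs0]; exact hsT
      have h2 : s ≤ T ^ 2 * s⁻¹ := by
        rw [← div_eq_mul_inv, le_div_iff₀ hs0]; nlinarith
      have h3 : 0 ≤ |Real.log ‖z‖| + Real.pi + 2 * Real.log 2 +
          2 * Real.eulerMascheroniConstant := by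
        have := Real.log_nonneg one_le_two
        positivity
      nlinarith [mul_le_mul_of_nonneg_left h1 h3]
    simp only [yukawaKernel, if_true, hr1]
    rw [norm_mul, mul_assoc]
    have hn : ‖(1 / (4 * Real.pi) : ℂ)‖ = 1 / (4 * Real.pi) := by
      rw [norm_div, norm_one, norm_mul, Complex.norm_real, Real.norm_of_nonneg hp.le]
      norm_num
    rw [hn]
    refine mul_le_mul_of_nonneg_left ((norm_add_le _ _).trans ?_) (by positivity)
    rw [norm_mul, norm_mul, Complex.norm_two, add_mul]
    refine add_le_add ?_ ?_
    · calc _ ≤ _ := mul_le_mul hsum hI (norm_nonneg _) ((norm_nonneg _).trans hsum)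
        _ = _ := by ring
    · have h1 : 1 ≤ T * s⁻¹ := by rw [← div_eq_mul_inv, one_le_div hs0]; exact hsT
      have h2 := Real.exp_pos (‖z‖ * (D ^ 2 / 4))
      calc _ ≤ 2 * (2 * Real.exp (‖z‖ * (D ^ 2 / 4))) * 1 := by linarith
        _ ≤ 2 * (2 * Real.exp (‖z‖ * (D ^ 2 / 4))) * (T * s⁻¹) := by gcongr
        _ = _ := by ring
  · refine ⟨fun _ => 1 / (4 * Real.pi), continuousOn_const, fun z r hr _ => ?_⟩
    have h1 : r ^ (-((2 : ℕ) : ℝ) / 2) = r⁻¹ := by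
      rw [show (-((2 : ℕ) : ℝ) / 2) = -1 by norm_num, Real.rpow_neg_one]
    simp only [yukawaKernel, OfNat.ofNat_ne_one, if_false, h1]
    rw [norm_div, Complex.norm_exp, norm_mul, norm_mul, Complex.norm_real, Complex.norm_real,
      Real.norm_of_nonneg hp.le, Real.norm_of_nonneg hr.le]
    have h2 : (-z ^ (1 / 2 : ℂ) * r).re ≤ 0 := by
      rw [Complex.re_mul_ofReal, Complex.neg_re]
      have := mul_nonneg (re_cpow_half_nonneg z) hr.le
      linarith
    have h3 : ‖(4 : ℂ)‖ = 4 := by norm_num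
    rw [h3]
    calc _ ≤ 1 / (4 * Real.pi * r) := by
          gcongr; exact Real.exp_le_one_iff.2 h2
      _ = _ := by field_simp

/-- The points `k² exp (-i(π - ε))`, which for `ε → 0+` tend to `-k²` from below the cut of the
logarithm. -/
def limitingPoint (k ε : ℝ) : ℂ :=
  Complex.exp (2 * (Real.log k : ℂ) - ((Real.pi - ε : ℝ) : ℂ) * Complex.I)

theorem continuous_limitingPoint (k : ℝ) : Continuous (limitingPoint k) := by
  unfold limitingPoint; fun_prop

theorem limitingPoint_eq {k : ℝ} (hk : 0 < k) (ε : ℝ) :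
    limitingPoint k ε =
      ((k ^ 2 : ℝ) : ℂ) * Complex.exp (((-(Real.pi - ε) : ℝ) : ℂ) * Complex.I) := by
  have : ((k ^ 2 : ℝ) : ℂ) = Complex.exp (2 * (Real.log k : ℂ)) := by
    rw [← Real.exp_log hk, ← Real.exp_nat_mul]
    push_cast
    simp
  rw [limitingPoint, this, ← Complex.exp_add]
  push_cast
  ring_nf

theorem limitingPoint_zero {k : ℝ} (hk : 0 < k) : limitingPoint k 0 = ((-k ^ 2 : ℝ) : ℂ) := by
  rw [limitingPoint_eq hk, sub_zero, Complex.ofReal_neg, neg_mul, Complex.exp_neg,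
    Complex.exp_pi_mul_I]
  norm_num

theorem norm_limitingPoint {k : ℝ} (hk : 0 < k) (ε : ℝ) : ‖limitingPoint k ε‖ = k ^ 2 := by
  rw [limitingPoint_eq hk, norm_mul, Complex.norm_exp_ofReal_mul_I, Complex.norm_real,
    Real.norm_of_nonneg (by positivity), mul_one]

theorem limitingPoint_im_neg {k ε : ℝ} (hk : 0 < k) (hε : 0 < ε) (hε' : ε < Real.pi) :
    (limitingPoint k ε).im < 0 := by
  rw [limitingPoint_eq hk, Complex.im_ofReal_mul,
    Complex.exp_ofReal_mul_I_im, Real.sin_neg]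
  have := Real.sin_pos_of_pos_of_lt_pi (x := Real.pi - ε) (by linarith) (by linarith)
  have hk2 : 0 < k ^ 2 := by positivity
  nlinarith

theorem log_limitingPoint {k ε : ℝ} (hε : 0 < ε) (hε' : ε < Real.pi) :
    Complex.log (limitingPoint k ε) =
      2 * (Real.log k : ℂ) - ((Real.pi - ε : ℝ) : ℂ) * Complex.I := by
  have him : (2 * (Real.log k : ℂ) - ((Real.pi - ε : ℝ) : ℂ) * Complex.I).im =
      -(Real.pi - ε) := by
    rw [Complex.sub_im, Complex.im_ofReal_mul, Complex.I_im, Complex.mul_im]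
    simp
  rw [limitingPoint, Complex.log_exp]
  · rw [him]; linarith
  · rw [him]; linarith [Real.pi_pos]

theorem besselJZero_eq (x : ℝ) : (besselJZero x : ℂ) = seriesI (-((x ^ 2 / 4 : ℝ) : ℂ)) := by
  rw [besselJZero, seriesI, factorialSqSeries, Complex.ofReal_tsum]
  refine tsum_congr fun m => ?_
  push_cast
  rw [one_mul, neg_pow ((x : ℂ) ^ 2 / 4)]

theorem besselYZero_eq (x : ℝ) : (besselYZero x : ℂ) =
    2 / Real.pi * ((Real.log (x / 2) : ℂ) + Real.eulerMascheroniConstant) *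
      seriesI (-((x ^ 2 / 4 : ℝ) : ℂ)) - 2 / Real.pi * seriesH (-((x ^ 2 / 4 : ℝ) : ℂ)) := by
  rw [besselYZero, Complex.ofReal_sub, Complex.ofReal_mul, besselJZero_eq, Complex.ofReal_mul,
    Complex.ofReal_mul, Complex.ofReal_tsum, seriesH, factorialSqSeries]
  push_cast
  congr 2
  refine tsum_congr fun m => ?_
  rw [harmonicC, neg_pow ((x : ℂ) ^ 2 / 4)]
  ring

theorem helmholtzRadial_one {k r : ℝ} (hk : 0 < k) (hr : 0 < r) :
    helmholtzRadial 1 k r = 1 / (4 * Real.pi) * (-(2 * (Real.log k : ℂ) - Real.pi * Complex.I +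
      2 * (Real.log (r / 2) : ℂ) + 2 * (Real.eulerMascheroniConstant : ℂ)) *
      seriesI (-((k ^ 2 : ℝ) : ℂ) * ((r ^ 2 / 4 : ℝ) : ℂ)) +
      2 * seriesH (-((k ^ 2 : ℝ) : ℂ) * ((r ^ 2 / 4 : ℝ) : ℂ))) := by
  have e1 : -(((k * r) ^ 2 / 4 : ℝ) : ℂ) = -((k ^ 2 : ℝ) : ℂ) * ((r ^ 2 / 4 : ℝ) : ℂ) := by
    push_cast; ring
  have e2 : Real.log (k * r / 2) = Real.log k + Real.log (r / 2) := by
    rw [mul_div_assoc, Real.log_mul hk.ne' (by positivity)]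
  have hp : (Real.pi : ℂ) ≠ 0 := by exact_mod_cast Real.pi_ne_zero
  simp only [helmholtzRadial, hankelZero, besselJZero_eq, besselYZero_eq, e1, e2]
  norm_num
  field_simp
  ring_nf
  simp only [Complex.I_sq]
  ring

/-- Limiting absorption: on approaching `-k²` from below, `yukawaKernel` tends to the fundamental
solution of the Helmholtz equation. -/
theorem tendsto_yukawaKernel_limitingPoint {d : ℕ} (hd : d = 1 ∨ d = 2) {k r : ℝ} (hk : 0 < k)
    (hr : 0 < r) :
    Filter.Tendsto (fun ε => yukawaKernel d (limitingPoint k ε) r) (nhdsWithin 0 (Set.Ioi 0))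
      (nhds (helmholtzRadial d k r)) := by
  have hmem : Set.Ioo (0 : ℝ) Real.pi ∈ nhdsWithin 0 (Set.Ioi 0) :=
    Ioo_mem_nhdsGT Real.pi_pos
  have h1 := differentiable_seriesI.continuous
  have h2 := differentiable_seriesH.continuous
  have h3 := continuous_limitingPoint k
  rcases hd with rfl | rfl
  · have hc : Continuous fun ε : ℝ => 1 / (4 * Real.pi) *
        (-(2 * (Real.log k : ℂ) - ((Real.pi - ε : ℝ) : ℂ) * Complex.I +
        2 * (Real.log (r / 2) : ℂ) + 2 * (Real.eulerMascheroniConstant : ℂ)) *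
        seriesI (limitingPoint k ε * ((r ^ 2 / 4 : ℝ) : ℂ)) +
        2 * seriesH (limitingPoint k ε * ((r ^ 2 / 4 : ℝ) : ℂ))) := by fun_prop
    have ht := (hc.tendsto 0).mono_left (nhdsWithin_le_nhds (s := Set.Ioi 0))
    rw [limitingPoint_zero hk, sub_zero, Complex.ofReal_neg, ← helmholtzRadial_one hk hr] at ht
    refine ht.congr' ?_
    filter_upwards [hmem] with ε hε
    simp only [yukawaKernel, if_true, log_limitingPoint hε.1 hε.2]
  · have hc : Continuous fun ε : ℝ => Complex.exp (-Complex.exp ((2 * (Real.log k : ℂ) -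
        ((Real.pi - ε : ℝ) : ℂ) * Complex.I) * (1 / 2)) * r) / (4 * Real.pi * r) := by fun_prop
    have ht := (hc.tendsto 0).mono_left (nhdsWithin_le_nhds (s := Set.Ioi 0))
    have e : Complex.exp ((2 * (Real.log k : ℂ) - ((Real.pi - 0 : ℝ) : ℂ) * Complex.I) * (1 / 2)) =
        -Complex.I * k := by
      rw [show (2 * (Real.log k : ℂ) - ((Real.pi - 0 : ℝ) : ℂ) * Complex.I) * (1 / 2) =
        (Real.log k : ℂ) + -(Real.pi / 2 * Complex.I) by push_cast; ring, Complex.exp_add,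
        Complex.exp_neg, Complex.exp_pi_div_two_mul_I, ← Complex.ofReal_exp, Real.exp_log hk,
        Complex.inv_I]
      ring
    rw [e] at ht
    have e2 : helmholtzRadial 2 k r = Complex.exp (-(-Complex.I * k) * r) / (4 * Real.pi * r) := by
      simp only [helmholtzRadial, Nat.reduceAdd, if_true]
      push_cast
      ring_nf
    rw [e2]
    refine ht.congr' ?_
    filter_upwards [hmem] with ε hε
    have hne : limitingPoint k ε ≠ 0 := Complex.exp_ne_zero _
    simp only [yukawaKernel, OfNat.ofNat_ne_one, if_false]
    rw [Complex.cpow_def_of_ne_zero hne, log_limitingPoint hε.1 hε.2]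

/-- The least regular term `r² log r` in the difference of two fundamental solutions, `d = 1`. -/
theorem contDiff_sq_mul_log : ContDiff ℝ 1 fun r : ℝ => r * (r * Real.log r) := by
  have hd : ∀ r : ℝ,
      HasDerivAt (fun r : ℝ => r * (r * Real.log r)) (2 * (r * Real.log r) + r) r := by
    intro r
    rcases eq_or_ne r 0 with rfl | hr
    · rw [hasDerivAt_iff_tendsto_slope]
      have h := (Real.continuous_mul_log.tendsto 0).mono_left
        (nhdsWithin_le_nhds (s := {(0 : ℝ)}ᶜ))
      simp only [zero_mul, mul_zero, add_zero] at h ⊢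
      refine h.congr' ?_
      filter_upwards [self_mem_nhdsWithin] with x hx
      have hx : x ≠ 0 := hx
      simp [slope_def_field, hx]
    · refine ((hasDerivAt_id r).mul ((hasDerivAt_id r).mul
        (Real.hasDerivAt_log hr))).congr_deriv ?_
      simp only [id, Pi.mul_apply]
      field_simp
      ring
  refine contDiff_one_iff_deriv.2 ⟨fun r => (hd r).differentiableAt, ?_⟩
  have : deriv (fun r : ℝ => r * (r * Real.log r)) = fun r => 2 * (r * Real.log r) + r :=
    funext fun r => (hd r).deriv
  rw [this]
  have := Real.continuous_mul_log
  fun_prop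

theorem contDiff_comp_ofReal {f : ℂ → ℂ} (hf : Differentiable ℂ f) {p : ℝ → ℝ}
    (hp : ContDiff ℝ 1 p) : ContDiff ℝ 1 fun r : ℝ => f (p r) :=
  ((hf.contDiff (n := 1)).restrict_scalars ℝ).comp (Complex.ofRealCLM.contDiff.comp hp)

theorem differentiable_dslope {f : ℂ → ℂ} (hf : Differentiable ℂ f) (c : ℂ) :
    Differentiable ℂ (dslope f c) := by
  rw [← differentiableOn_univ, Complex.differentiableOn_dslope Filter.univ_mem]
  exact hf.differentiableOn

/-- The fundamental solutions for `-k²` and `k²` have the same singularity. -/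
theorem exists_contDiff_helmholtzRadial_eq {d : ℕ} (hd : d = 1 ∨ d = 2) {k : ℝ} (hk : 0 < k) :
    ∃ R : ℝ → ℂ, ContDiff ℝ 1 R ∧ ∀ r, 0 < r →
      helmholtzRadial d k r = yukawaKernel d ((k ^ 2 : ℝ) : ℂ) r + R r := by
  have hpc : (Real.pi : ℂ) ≠ 0 := by exact_mod_cast Real.pi_ne_zero
  rcases hd with rfl | rfl
  · set q : ℂ → ℂ := fun w => seriesI w - seriesI (-w) with hq
    have hI := differentiable_seriesI
    have hH := differentiable_seriesH
    have hqd : Differentiable ℂ q := by fun_prop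
    have hw : ContDiff ℝ 1 fun r : ℝ => k ^ 2 * (r ^ 2 / 4) := by fun_prop
    have hIn : Differentiable ℂ fun w => seriesI (-w) := by fun_prop
    have hHn : Differentiable ℂ fun w => seriesH (-w) - seriesH w := by fun_prop
    have c1 := contDiff_comp_ofReal hqd hw
    have c2 := contDiff_comp_ofReal hIn hw
    have c3 := contDiff_comp_ofReal hHn hw
    have c4 := contDiff_comp_ofReal (differentiable_dslope hqd 0) hw
    have c5 : ContDiff ℝ 1 fun r : ℝ => ((r * (r * Real.log r) : ℝ) : ℂ) :=
      Complex.ofRealCLM.contDiff.comp contDiff_sq_mul_log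
    set c : ℂ := (Real.log k : ℂ) - (Real.log 2 : ℂ) + (Real.eulerMascheroniConstant : ℂ) with hc
    refine ⟨fun r => 1 / (4 * Real.pi) * (2 * ((k ^ 2 / 4 : ℝ) * ((r * (r * Real.log r) : ℝ) : ℂ) *
      dslope q 0 ((k ^ 2 * (r ^ 2 / 4) : ℝ) : ℂ)) + 2 * c * q ((k ^ 2 * (r ^ 2 / 4) : ℝ) : ℂ) +
      Real.pi * Complex.I * seriesI (-((k ^ 2 * (r ^ 2 / 4) : ℝ) : ℂ)) +
      2 * (seriesH (-((k ^ 2 * (r ^ 2 / 4) : ℝ) : ℂ)) -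
        seriesH ((k ^ 2 * (r ^ 2 / 4) : ℝ) : ℂ))), ?_, fun r hr => ?_⟩
    · refine contDiff_const.mul ((((contDiff_const.mul ((contDiff_const.mul c5).mul c4)).add
        (contDiff_const.mul c1)).add (contDiff_const.mul c2)).add (contDiff_const.mul c3))
    · have hs := sub_smul_dslope q 0 ((k ^ 2 * (r ^ 2 / 4) : ℝ) : ℂ)
      have hq0 : q 0 = 0 := by simp [hq]
      rw [hq0, sub_zero, sub_zero, smul_eq_mul] at hs
      have e1 : (2 : ℂ) * ((k ^ 2 / 4 : ℝ) * ((r * (r * Real.log r) : ℝ) : ℂ) *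
          dslope q 0 ((k ^ 2 * (r ^ 2 / 4) : ℝ) : ℂ)) =
          2 * (Real.log r : ℂ) * q ((k ^ 2 * (r ^ 2 / 4) : ℝ) : ℂ) := by
        rw [← hs]; push_cast; ring
      have e2 : -((k ^ 2 : ℝ) : ℂ) * ((r ^ 2 / 4 : ℝ) : ℂ) = -((k ^ 2 * (r ^ 2 / 4) : ℝ) : ℂ) := by
        push_cast; ring
      have e3 : Complex.log ((k ^ 2 : ℝ) : ℂ) = 2 * (Real.log k : ℂ) := by
        rw [← Complex.ofReal_log (by positivity), Real.log_pow]; push_cast; ring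
      have e4 : ((k ^ 2 : ℝ) : ℂ) * ((r ^ 2 / 4 : ℝ) : ℂ) = ((k ^ 2 * (r ^ 2 / 4) : ℝ) : ℂ) := by
        push_cast; ring
      rw [helmholtzRadial_one hk hr]
      simp only [yukawaKernel, if_true]
      rw [e1, e2, e3, e4, Real.log_div hr.ne' two_ne_zero]
      simp only [hq, hc]
      push_cast
      ring
  · set g : ℂ → ℂ := fun z => Complex.exp (Complex.I * (k * z)) - Complex.exp (-(k * z)) with hg
    have hgd : Differentiable ℂ g := by fun_prop
    refine ⟨fun r => 1 / (4 * Real.pi) * dslope g 0 (r : ℂ),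
      contDiff_const.mul (contDiff_comp_ofReal (differentiable_dslope hgd 0) contDiff_id),
      fun r hr => ?_⟩
    have hrc : (r : ℂ) ≠ 0 := by exact_mod_cast hr.ne'
    have hs := sub_smul_dslope g 0 (r : ℂ)
    have hg0 : g 0 = 0 := by simp [hg]
    rw [hg0, sub_zero, sub_zero, smul_eq_mul] at hs
    have e1 : dslope g 0 (r : ℂ) = g r / r := by rw [← hs]; field_simp
    have e2 : (((k ^ 2 : ℝ) : ℂ)) ^ (1 / 2 : ℂ) = k := by
      have := Complex.ofReal_cpow (x := k ^ 2) (by positivity) (1 / 2)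
      rw [← Real.sqrt_eq_rpow, Real.sqrt_sq hk.le] at this
      rw [this]
      norm_num
    beta_reduce
    rw [e1]
    simp only [helmholtzRadial, yukawaKernel, Nat.reduceAdd, if_true, OfNat.ofNat_ne_one, if_false,
      e2, hg]
    push_cast
    rw [neg_mul]
    field_simp
    ring

/-! ### Fourier transform of the kernel for positive spectral parameter -/

theorem integrable_heat_prod {d : ℕ} {l : ℝ} (hl : 0 < l) :
    Integrable (fun p : EuclideanSpace ℝ (Fin d) × ℝ =>
      (4 * Real.pi * p.2) ^ (-((d : ℝ) + 1) / 2) *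
        Real.exp (-(‖p.1‖ ^ 2 / (4 * p.2)) - l * p.2))
      (volume.prod (volume.restrict (Set.Ioi 0))) := by
  have hp := Real.pi_pos
  have hmeas : AEStronglyMeasurable (fun p : EuclideanSpace ℝ (Fin d) × ℝ =>
      (4 * Real.pi * p.2) ^ (-((d : ℝ) + 1) / 2) *
        Real.exp (-(‖p.1‖ ^ 2 / (4 * p.2)) - l * p.2))
      (volume.prod (volume.restrict (Set.Ioi 0))) :=
    Measurable.aestronglyMeasurable (by fun_prop)
  have hexp : ∀ t : ℝ, ∀ x : EuclideanSpace ℝ (Fin d),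
      Real.exp (-(‖x‖ ^ 2 / (4 * t)) - l * t) =
      Real.exp (-(l * t)) * Real.exp (-(1 / (4 * t)) * ‖x‖ ^ 2) := by
    intro t x
    rw [← Real.exp_add]
    congr 1
    ring
  refine (integrable_prod_iff' hmeas).2 ⟨?_, ?_⟩
  · filter_upwards [ae_restrict_mem measurableSet_Ioi] with t ht
    have ht : 0 < t := ht
    have h := (GaussianFourier.integrable_cexp_neg_mul_sq_norm_add
      (V := EuclideanSpace ℝ (Fin d)) (b := ((1 / (4 * t) : ℝ) : ℂ))
      (by rw [Complex.ofReal_re]; positivity) 0 0).norm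
    simp only [hexp]
    refine Integrable.const_mul (Integrable.const_mul (h.congr ?_) _) _
    refine Filter.Eventually.of_forall fun x => ?_
    beta_reduce
    rw [zero_mul, add_zero, Complex.norm_exp]
    congr 1
    norm_cast
  · refine (integrableOn_rpow_mul_exp_neg_mul_rpow (s := -1 / 2) (p := 1) (b := l) (by norm_num)
      one_pos hl).const_mul ((4 * Real.pi) ^ (-(1 : ℝ) / 2)) |>.congr ?_
    filter_upwards [ae_restrict_mem measurableSet_Ioi] with t ht
    have ht : 0 < t := ht
    have h1 : ∫ x : EuclideanSpace ℝ (Fin d), ‖(4 * Real.pi * t) ^ (-((d : ℝ) + 1) / 2) *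
        Real.exp (-(‖x‖ ^ 2 / (4 * t)) - l * t)‖ =
        (4 * Real.pi * t) ^ (-((d : ℝ) + 1) / 2) * (Real.exp (-(l * t)) *
          (4 * Real.pi * t) ^ ((d : ℝ) / 2)) := by
      have h2 := GaussianFourier.integral_rexp_neg_mul_sq_norm (V := EuclideanSpace ℝ (Fin d))
        (b := 1 / (4 * t)) (by positivity)
      rw [finrank_euclideanSpace, Fintype.card_fin, show Real.pi / (1 / (4 * t)) =
        4 * Real.pi * t by field_simp] at h2
      rw [← h2, ← integral_const_mul, ← integral_const_mul]
      congr 1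
      ext x
      rw [Real.norm_of_nonneg (by positivity), hexp]
    rw [h1, Real.rpow_one]
    have e : (4 * Real.pi * t) ^ (-((d : ℝ) + 1) / 2) * (4 * Real.pi * t) ^ ((d : ℝ) / 2) =
        (4 * Real.pi) ^ (-(1 : ℝ) / 2) * t ^ (-1 / 2 : ℝ) := by
      rw [← Real.rpow_add (by positivity), ← Real.mul_rpow (by positivity) ht.le]
      congr 1
      ring
    rw [neg_mul]
    linear_combination (-Real.exp (-(l * t))) * e

theorem integrable_heatIntegral {d : ℕ} {l : ℝ} (hl : 0 < l) :
    Integrable (fun x : EuclideanSpace ℝ (Fin d) => (heatIntegral d l ‖x‖ : ℂ)) :=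
  (integrable_heat_prod hl).integral_prod_left.ofReal

theorem integral_rpow_neg_half_mul_exp {a : ℝ} (ha : 0 < a) :
    ∫ t in Set.Ioi (0 : ℝ), (4 * Real.pi * t) ^ (-(1 : ℝ) / 2) * Real.exp (-(a * t)) =
      1 / 2 * a ^ (-(1 : ℝ) / 2) := by
  have hp := Real.pi_pos
  have h := Real.integral_rpow_mul_exp_neg_mul_Ioi (a := 1 / 2) (by norm_num) ha
  have h1 : ∫ t in Set.Ioi (0 : ℝ), (4 * Real.pi * t) ^ (-(1 : ℝ) / 2) * Real.exp (-(a * t)) =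
      (4 * Real.pi) ^ (-(1 : ℝ) / 2) *
        ∫ t in Set.Ioi (0 : ℝ), t ^ ((1 : ℝ) / 2 - 1) * Real.exp (-(a * t)) := by
    rw [← integral_const_mul]
    refine setIntegral_congr_fun measurableSet_Ioi fun t ht => ?_
    have ht : 0 < t := ht
    rw [Real.mul_rpow (by positivity) ht.le, show (1 : ℝ) / 2 - 1 = -1 / 2 by norm_num]
    ring
  rw [h1, h, Real.Gamma_one_half_eq, one_div, Real.inv_rpow ha.le, ← Real.rpow_neg ha.le,
    Real.mul_rpow (by norm_num) hp.le, neg_div, Real.rpow_neg (by norm_num),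
    Real.rpow_neg hp.le, ← Real.sqrt_eq_rpow, ← Real.sqrt_eq_rpow,
    show (4 : ℝ) = 2 ^ 2 by norm_num, Real.sqrt_sq (by norm_num)]
  have := (Real.sqrt_pos.2 hp).ne'
  rw [one_div]
  field_simp

/-- The Fourier transform of the Gaussian on `ℝ^d` absorbs all but one of the `d + 1` factors
`(4πt)^(-1/2)`, which leaves a Gamma integral. -/
theorem fourier_heatIntegral {d : ℕ} {l : ℝ} (hl : 0 < l) (ξ : EuclideanSpace ℝ (Fin d)) :
    𝓕 (fun x : EuclideanSpace ℝ (Fin d) => (heatIntegral d l ‖x‖ : ℂ)) ξ =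
      ((1 / 2 * (l + (2 * Real.pi * ‖ξ‖) ^ 2) ^ (-(1 : ℝ) / 2) : ℝ) : ℂ) := by
  have hp := Real.pi_pos
  have hint := (integrable_heat_prod (d := d) hl).ofReal (𝕜 := ℂ)
  have hint2 : Integrable (fun p : EuclideanSpace ℝ (Fin d) × ℝ =>
      Real.fourierChar (-inner ℝ p.1 ξ) • (((4 * Real.pi * p.2) ^ (-((d : ℝ) + 1) / 2) *
        Real.exp (-(‖p.1‖ ^ 2 / (4 * p.2)) - l * p.2) : ℝ) : ℂ))
      (volume.prod (volume.restrict (Set.Ioi 0))) := by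
    have hc : Continuous fun p : EuclideanSpace ℝ (Fin d) × ℝ =>
        (Real.fourierChar (-inner ℝ p.1 ξ) : ℂ) :=
      continuous_subtype_val.comp (Real.continuous_fourierChar.comp (by fun_prop))
    simp only [Circle.smul_def, smul_eq_mul]
    exact hint.bdd_mul (c := 1) hc.aestronglyMeasurable
      (Filter.Eventually.of_forall fun p => (Circle.norm_coe _).le)
  rw [← integral_rpow_neg_half_mul_exp (by positivity), Real.fourier_eq, ← integral_complex_ofReal]
  calc ∫ x, Real.fourierChar (-inner ℝ x ξ) • (heatIntegral d l ‖x‖ : ℂ)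
      = ∫ x, ∫ t in Set.Ioi (0 : ℝ), Real.fourierChar (-inner ℝ x ξ) •
        (((4 * Real.pi * t) ^ (-((d : ℝ) + 1) / 2) *
          Real.exp (-(‖x‖ ^ 2 / (4 * t)) - l * t) : ℝ) : ℂ) := by
        congr 1
        ext x
        simp only [Circle.smul_def, smul_eq_mul]
        rw [heatIntegral, integral_const_mul, integral_complex_ofReal]
    _ = ∫ t in Set.Ioi (0 : ℝ), ∫ x, Real.fourierChar (-inner ℝ x ξ) •
        (((4 * Real.pi * t) ^ (-((d : ℝ) + 1) / 2) *
          Real.exp (-(‖x‖ ^ 2 / (4 * t)) - l * t) : ℝ) : ℂ) := integral_integral_swap hint2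
    _ = _ := by
        refine setIntegral_congr_fun measurableSet_Ioi fun t ht => ?_
        have ht : 0 < t := ht
        beta_reduce
        have h1 := fourier_gaussian_innerProductSpace (V := EuclideanSpace ℝ (Fin d))
          (b := ((1 / (4 * t) : ℝ) : ℂ)) (by rw [Complex.ofReal_re]; positivity) ξ
        rw [finrank_euclideanSpace, Fintype.card_fin] at h1
        have h2 : ((Real.pi : ℂ) / ((1 / (4 * t) : ℝ) : ℂ)) ^ ((d : ℂ) / 2) *
            Complex.exp (-(Real.pi : ℂ) ^ 2 * (‖ξ‖ : ℂ) ^ 2 / ((1 / (4 * t) : ℝ) : ℂ)) =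
            (((4 * Real.pi * t) ^ ((d : ℝ) / 2) *
              Real.exp (-((2 * Real.pi * ‖ξ‖) ^ 2 * t)) : ℝ) : ℂ) := by
          have e1 : (Real.pi : ℂ) / ((1 / (4 * t) : ℝ) : ℂ) = ((4 * Real.pi * t : ℝ) : ℂ) := by
            rw [← Complex.ofReal_div]; congr 1; field_simp
          have e2 : (-(Real.pi : ℂ) ^ 2 * (‖ξ‖ : ℂ) ^ 2 / ((1 / (4 * t) : ℝ) : ℂ)) =
              ((-((2 * Real.pi * ‖ξ‖) ^ 2 * t) : ℝ) : ℂ) := by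
            have : -((2 * Real.pi * ‖ξ‖) ^ 2 * t) = -Real.pi ^ 2 * ‖ξ‖ ^ 2 / (1 / (4 * t)) := by
              field_simp; ring
            rw [this]; push_cast; ring
          rw [e1, e2, Complex.ofReal_mul (_ ^ _), Complex.ofReal_exp,
            Complex.ofReal_cpow (by positivity), Complex.ofReal_div, Complex.ofReal_natCast,
            Complex.ofReal_ofNat]
        rw [h2, Real.fourier_eq] at h1
        have h3 : ∀ x : EuclideanSpace ℝ (Fin d), Real.fourierChar (-inner ℝ x ξ) •
            (((4 * Real.pi * t) ^ (-((d : ℝ) + 1) / 2) *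
              Real.exp (-(‖x‖ ^ 2 / (4 * t)) - l * t) : ℝ) : ℂ) =
            (((4 * Real.pi * t) ^ (-((d : ℝ) + 1) / 2) * Real.exp (-(l * t)) : ℝ) : ℂ) *
            (Real.fourierChar (-inner ℝ x ξ) •
              Complex.exp (-((1 / (4 * t) : ℝ) : ℂ) * (‖x‖ : ℂ) ^ 2)) := by
          intro x
          have e3 : Complex.exp (-((1 / (4 * t) : ℝ) : ℂ) * (‖x‖ : ℂ) ^ 2) =
              ((Real.exp (-(1 / (4 * t)) * ‖x‖ ^ 2) : ℝ) : ℂ) := by push_cast; rfl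
          have e4 : Real.exp (-(‖x‖ ^ 2 / (4 * t)) - l * t) =
              Real.exp (-(l * t)) * Real.exp (-(1 / (4 * t)) * ‖x‖ ^ 2) := by
            rw [← Real.exp_add]; congr 1; ring
          rw [e3, e4]
          simp only [Circle.smul_def, smul_eq_mul]
          push_cast
          ring
        simp only [h3]
        rw [integral_const_mul, h1, ← Complex.ofReal_mul]
        congr 1
        have e : (4 * Real.pi * t) ^ (-((d : ℝ) + 1) / 2) * (4 * Real.pi * t) ^ ((d : ℝ) / 2) =
            (4 * Real.pi * t) ^ (-(1 : ℝ) / 2) := by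
          rw [← Real.rpow_add (by positivity)]
          congr 1
          ring
        have e5 : Real.exp (-((l + (2 * Real.pi * ‖ξ‖) ^ 2) * t)) =
            Real.exp (-(l * t)) * Real.exp (-((2 * Real.pi * ‖ξ‖) ^ 2 * t)) := by
          rw [← Real.exp_add]; congr 1; ring
        rw [e5, ← e]
        ring

/-! ### Holomorphic dependence on the spectral parameter -/

/-- Integrals of holomorphic functions with a locally uniform integrable bound are holomorphic. -/
theorem differentiableOn_integral_of_dominated {α : Type*} [MeasurableSpace α] {μ : Measure α}
    {U : Set ℂ} (hU : IsOpen U) {F : ℂ → α → ℂ}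
    (hmeas : ∀ z ∈ U, AEStronglyMeasurable (F z) μ)
    (hdiff : ∀ᵐ a ∂μ, DifferentiableOn ℂ (fun z => F z a) U)
    (hbound : ∀ z₀ ∈ U, ∃ ε > 0, Metric.closedBall z₀ ε ⊆ U ∧ ∃ b : α → ℝ, Integrable b μ ∧
      ∀ᵐ a ∂μ, ∀ z ∈ Metric.closedBall z₀ ε, ‖F z a‖ ≤ b a) :
    DifferentiableOn ℂ (fun z => ∫ a, F z a ∂μ) U := by
  intro z₀ hz₀
  obtain ⟨ε, hε, hεU, b, hb, hFb⟩ := hbound z₀ hz₀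
  have hball : Metric.ball z₀ (ε / 2) ∈ nhds z₀ := Metric.ball_mem_nhds _ (by positivity)
  have hUz : ∀ z ∈ Metric.ball z₀ (ε / 2), z ∈ U := fun z hz =>
    hεU (Metric.ball_subset_closedBall (Metric.ball_subset_ball (by linarith) hz))
  refine ((hasDerivAt_integral_of_dominated_loc_of_deriv_le
    (F' := fun z a => deriv (fun z => F z a) z)
    (bound := fun a => b a / (ε / 2)) hball ?_ ?_ ?_ ?_ (hb.div_const _) ?_).2
    ).differentiableAt.differentiableWithinAt
  · filter_upwards [hball] with z hz using hmeas z (hUz z hz)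
  · refine hb.mono' (hmeas z₀ hz₀) ?_
    filter_upwards [hFb] with a ha using ha z₀ (Metric.mem_closedBall_self hε.le)
  · -- the derivative is a limit of difference quotients
    obtain ⟨h, hh⟩ : ∃ h : ℕ → ℂ, ∀ n, h n ≠ 0 ∧ z₀ + h n ∈ U ∧ ‖h n‖ ≤ ((n : ℝ) + 1)⁻¹ := by
      refine ⟨fun n => ((min ε ((n : ℝ) + 1)⁻¹ : ℝ) : ℂ), fun n => ?_⟩
      have h0 : 0 < min ε ((n : ℝ) + 1)⁻¹ := lt_min hε (by positivity)
      refine ⟨Complex.ofReal_ne_zero.2 h0.ne', hεU ?_, ?_⟩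
      · rw [Metric.mem_closedBall, dist_eq_norm, add_sub_cancel_left, Complex.norm_real,
          Real.norm_of_nonneg h0.le]
        exact min_le_left _ _
      · rw [Complex.norm_real, Real.norm_of_nonneg h0.le]
        exact min_le_right _ _
    have hh0 : Filter.Tendsto h Filter.atTop (nhdsWithin 0 {0}ᶜ) := by
      refine tendsto_nhdsWithin_iff.2 ⟨?_, Filter.Eventually.of_forall fun n => (hh n).1⟩
      refine squeeze_zero_norm (fun n => (hh n).2.2) ?_
      simpa [one_div] using tendsto_one_div_add_atTop_nhds_zero_nat (𝕜 := ℝ)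
    refine aestronglyMeasurable_of_tendsto_ae Filter.atTop
      (f := fun n a => (h n)⁻¹ • (F (z₀ + h n) a - F z₀ a))
      (fun n => ((hmeas _ (hh n).2.1).sub (hmeas _ hz₀)).const_smul (h n)⁻¹) ?_
    filter_upwards [hdiff] with a ha
    have := (ha.differentiableAt (hU.mem_nhds hz₀)).hasDerivAt
    exact this.tendsto_slope_zero.comp hh0
  · filter_upwards [hdiff, hFb] with a ha hba z hz
    refine Complex.norm_deriv_le_of_forall_mem_sphere_norm_le (by positivity) ?_ ?_
    · refine (ha.mono fun w hw => hεU ?_).diffContOnCl_ball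
        (U := Metric.closedBall z (ε / 2)) le_rfl
      rw [Metric.mem_closedBall] at hw ⊢
      have hz' := Metric.mem_ball.1 hz
      linarith [dist_triangle w z z₀]
    · intro w hw
      refine hba w ?_
      rw [Metric.mem_sphere] at hw
      rw [Metric.mem_closedBall]
      have hz' := Metric.mem_ball.1 hz
      linarith [dist_triangle w z z₀]
  · filter_upwards [hdiff] with a ha z hz
    exact (ha.differentiableAt (hU.mem_nhds (hUz z hz))).hasDerivAt

theorem integrableOn_norm_rpow_neg_half {d : ℕ} (hd : 0 < d) {D : ℝ} (hD : 0 < D) :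
    IntegrableOn (fun x : EuclideanSpace ℝ (Fin d) => ‖x‖ ^ (-(d : ℝ) / 2))
      (Metric.ball 0 D) := by
  have : Nonempty (Fin d) := ⟨⟨0, hd⟩⟩
  have h := (integrableOn_fun_norm_addHaar (E := EuclideanSpace ℝ (Fin d)) volume
    (f := fun r => r ^ (-(d : ℝ) / 2)) (r := D)).2
  refine h ?_
  have hd1 : (1 : ℝ) ≤ d := by exact_mod_cast hd
  refine ((intervalIntegral.integrableOn_Ioo_rpow_iff (s := (d : ℝ) / 2 - 1) hD).2
    (by linarith)).congr ?_
  filter_upwards [ae_restrict_mem measurableSet_Ioo] with r hr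
  have hr : 0 < r := hr.1
  rw [finrank_euclideanSpace, Fintype.card_fin, smul_eq_mul, ← Real.rpow_natCast,
    ← Real.rpow_add hr, Nat.cast_sub (by omega)]
  congr 1
  push_cast
  ring

/-! ### The quadratic form of the Helmholtz kernel -/

theorem correlation_eq_fourier {d : ℕ} (φ ψ : 𝓢(EuclideanSpace ℝ (Fin d), ℂ)) :
    correlation φ ψ = 𝓕 (fun ξ => 𝓕 φ ξ * 𝓕⁻ ψ ξ) := by
  ext z
  rw [fourier_mul_fourierInv_eq, correlation]

theorem continuous_correlation {d : ℕ} (φ ψ : 𝓢(EuclideanSpace ℝ (Fin d), ℂ)) :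
    Continuous (correlation φ ψ) := by
  rw [correlation_eq_fourier]
  exact VectorFourier.fourierIntegral_continuous Real.continuous_fourierChar
    (by exact continuous_inner) (integrable_fourier_mul_fourierInv φ ψ)

theorem exists_norm_correlation_le {d : ℕ} (φ ψ : 𝓢(EuclideanSpace ℝ (Fin d), ℂ)) :
    ∃ C, ∀ z, ‖correlation φ ψ z‖ ≤ C := by
  rw [correlation_eq_fourier]
  exact ⟨_, fun z => VectorFourier.norm_fourierIntegral_le_integral_norm _ _ _ _ z⟩

theorem testFunction_eq_zero {d : ℕ} {Ω : Opens (EuclideanSpace ℝ (Fin d))} (φ : 𝓓(Ω, ℂ))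
    {x : EuclideanSpace ℝ (Fin d)} (hx : x ∉ Ω) : φ x = 0 :=
  image_eq_zero_of_notMem_tsupport fun h => hx (φ.tsupport_subset h)

theorem correlation_testToSchwartz_eq_zero {d : ℕ} {Ω : Opens (EuclideanSpace ℝ (Fin d))} {D : ℝ}
    (hD : ∀ x ∈ Ω, ∀ y ∈ Ω, ‖x - y‖ < D) (φ ψ : 𝓓(Ω, ℂ)) {z : EuclideanSpace ℝ (Fin d)}
    (hz : D ≤ ‖z‖) : correlation (testToSchwartz Ω φ) (testToSchwartz Ω ψ) z = 0 := by
  rw [correlation, ← integral_zero (EuclideanSpace ℝ (Fin d)) ℂ]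
  congr 1
  ext x
  rw [testToSchwartz_apply, testToSchwartz_apply]
  by_cases h1 : x ∈ Ω
  · by_cases h2 : x - z ∈ Ω
    · have := hD x h1 _ h2
      rw [sub_sub_cancel] at this
      exact absurd this hz.not_gt
    · rw [testFunction_eq_zero φ h2, zero_mul]
  · rw [testFunction_eq_zero ψ h1, mul_zero]

theorem aestronglyMeasurable_comp_norm {d : ℕ} (hd : 0 < d) {f : ℝ → ℂ}
    (hf : ContinuousOn f (Set.Ioi 0)) :
    AEStronglyMeasurable (fun x : EuclideanSpace ℝ (Fin d) => f ‖x‖) := by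
  have : Nonempty (Fin d) := ⟨⟨0, hd⟩⟩
  have h : ContinuousOn (fun x : EuclideanSpace ℝ (Fin d) => f ‖x‖) {0}ᶜ :=
    hf.comp continuous_norm.continuousOn fun x hx => norm_pos_iff.2 hx
  have := h.aestronglyMeasurable (μ := volume) (measurableSet_singleton _).compl
  rwa [restrict_compl_singleton] at this

/-- Kernels with at most the singularity `‖x‖^{-d/2}`, cut off at radius `D`, are dominated by this
function. -/
theorem integrable_indicator_norm_rpow {d : ℕ} (hd : 0 < d) {D : ℝ} (hD : 0 < D) (C : ℝ) :
    Integrable (fun x : EuclideanSpace ℝ (Fin d) =>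
      C * (Metric.ball 0 D).indicator (fun x => ‖x‖ ^ (-(d : ℝ) / 2)) x) :=
  ((integrable_indicator_iff Metric.isOpen_ball.measurableSet).2
    (integrableOn_norm_rpow_neg_half hd hD)).const_mul C

theorem norm_kernel_mul_le {d : ℕ} {D : ℝ} {c : EuclideanSpace ℝ (Fin d) → ℂ} {C : ℝ}
    (hC : ∀ x, ‖c x‖ ≤ C) (hc : ∀ x, D ≤ ‖x‖ → c x = 0) {f : ℝ → ℂ} {b : ℝ}
    (hf : ∀ r, 0 < r → r ≤ D → ‖f r‖ ≤ b * r ^ (-(d : ℝ) / 2))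
    {x : EuclideanSpace ℝ (Fin d)} (hx : x ≠ 0) :
    ‖f ‖x‖ * c x‖ ≤
      (b * C) * (Metric.ball 0 D).indicator (fun x => ‖x‖ ^ (-(d : ℝ) / 2)) x := by
  rcases lt_or_ge ‖x‖ D with h | h
  · rw [Set.indicator_of_mem (by simpa using h), norm_mul]
    have h1 := hf _ (norm_pos_iff.2 hx) h.le
    calc ‖f ‖x‖‖ * ‖c x‖ ≤ (b * ‖x‖ ^ (-(d : ℝ) / 2)) * C :=
          mul_le_mul h1 (hC x) (norm_nonneg _) ((norm_nonneg _).trans h1)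
      _ = _ := by ring
  · rw [Set.indicator_of_notMem (by simpa using h), hc x h, mul_zero, mul_zero, norm_zero]

theorem ae_ne_zero {d : ℕ} (hd : 0 < d) : ∀ᵐ x : EuclideanSpace ℝ (Fin d), x ≠ 0 := by
  have : Nonempty (Fin d) := ⟨⟨0, hd⟩⟩
  exact compl_mem_ae_iff.2 (measure_singleton _)

theorem differentiableOn_integral_yukawaKernel {d : ℕ} (hd : d = 1 ∨ d = 2) {D : ℝ} (hD : 0 < D)
    {c : EuclideanSpace ℝ (Fin d) → ℂ} (hcont : Continuous c) {C : ℝ}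
    (hC : ∀ x, ‖c x‖ ≤ C) (hc : ∀ x, D ≤ ‖x‖ → c x = 0) :
    DifferentiableOn ℂ (fun z => ∫ x, yukawaKernel d z ‖x‖ * c x) Complex.slitPlane := by
  have hd0 : 0 < d := by omega
  obtain ⟨B, hB, hyB⟩ := exists_norm_yukawaKernel_le hd hD
  refine differentiableOn_integral_of_dominated Complex.isOpen_slitPlane (fun z _ => ?_) ?_ ?_
  · exact (aestronglyMeasurable_comp_norm hd0 (continuousOn_yukawaKernel d z)).mul
      hcont.aestronglyMeasurable
  · exact Filter.Eventually.of_forall fun x =>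
      (differentiableOn_yukawaKernel d ‖x‖).mul_const (c x)
  · intro z₀ hz₀
    obtain ⟨ε, hε, hεU⟩ := Metric.nhds_basis_closedBall.mem_iff.1
      (Complex.isOpen_slitPlane.mem_nhds hz₀)
    have hsub : Metric.closedBall z₀ ε ⊆ {0}ᶜ := fun z hz h => by
      rw [Set.mem_singleton_iff] at h
      exact Complex.zero_notMem_slitPlane (h ▸ hεU hz)
    obtain ⟨B₀, hB₀⟩ := (isCompact_closedBall z₀ ε).exists_bound_of_continuousOn (hB.mono hsub)
    refine ⟨ε, hε, hεU, _, integrable_indicator_norm_rpow hd0 hD (B₀ * C), ?_⟩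
    filter_upwards [ae_ne_zero hd0] with x hx z hz
    refine norm_kernel_mul_le hC hc (fun r hr hrD => (hyB z r hr hrD).trans ?_) hx
    exact mul_le_mul_of_nonneg_right ((le_abs_self _).trans (hB₀ z hz)) (by positivity)

theorem ofReal_add_mem_slitPlane {z : ℂ} (hz : z ∈ Complex.slitPlane) {t : ℝ} (ht : 0 ≤ t) :
    (t : ℂ) + z ∈ Complex.slitPlane := by
  rw [Complex.mem_slitPlane_iff] at hz ⊢
  simp only [Complex.add_re, Complex.ofReal_re, Complex.add_im, Complex.ofReal_im, zero_add]
  exact hz.imp (fun h => by linarith) id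

theorem differentiableOn_integral_cpow {d : ℕ} {g : EuclideanSpace ℝ (Fin d) → ℂ}
    (hg : Integrable g) :
    DifferentiableOn ℂ (fun z : ℂ => ∫ ξ, ((((2 * Real.pi * ‖ξ‖) ^ 2 : ℝ) : ℂ) + z) ^
      ((-(1 : ℝ) / 2 : ℝ) : ℂ) * g ξ) Complex.slitPlane := by
  refine differentiableOn_integral_of_dominated Complex.isOpen_slitPlane (fun z hz => ?_) ?_ ?_
  · refine AEStronglyMeasurable.mul (Continuous.aestronglyMeasurable ?_) hg.aestronglyMeasurable
    refine Continuous.cpow (by fun_prop) continuous_const fun ξ => ?_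
    exact ofReal_add_mem_slitPlane hz (sq_nonneg _)
  · refine Filter.Eventually.of_forall fun ξ => DifferentiableOn.mul_const (fun z hz => ?_) _
    refine DifferentiableAt.differentiableWithinAt ?_
    exact (differentiableAt_id.const_add _).cpow_const
      (ofReal_add_mem_slitPlane hz (sq_nonneg _))
  · intro z₀ hz₀
    obtain ⟨ε, hε, hεU⟩ := Metric.isOpen_iff.1 Complex.isOpen_slitPlane z₀ hz₀
    refine ⟨ε / 2, by positivity, (Metric.closedBall_subset_ball (by linarith)).trans hεU, _,
      hg.norm.const_mul ((ε / 2) ^ (-(1 : ℝ) / 2)), ?_⟩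
    refine Filter.Eventually.of_forall fun ξ z hz => ?_
    rw [norm_mul, Complex.norm_cpow_real]
    refine mul_le_mul_of_nonneg_right ?_ (norm_nonneg _)
    refine Real.rpow_le_rpow_of_nonpos (by positivity) ?_ (by norm_num)
    -- otherwise the point `-(2π‖ξ‖)²` of the cut would lie within `ε` of `z₀`
    by_contra! h
    have h1 : ((-(2 * Real.pi * ‖ξ‖) ^ 2 : ℝ) : ℂ) ∈ Metric.ball z₀ ε := by
      rw [Metric.mem_ball]
      have h2 : dist ((-(2 * Real.pi * ‖ξ‖) ^ 2 : ℝ) : ℂ) z < ε / 2 := by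
        rw [dist_comm, dist_eq_norm, Complex.ofReal_neg, sub_neg_eq_add, add_comm]
        exact h
      linarith [dist_triangle ((-(2 * Real.pi * ‖ξ‖) ^ 2 : ℝ) : ℂ) z z₀,
        Metric.mem_closedBall.1 hz]
    have h3 := hεU h1
    rw [Complex.mem_slitPlane_iff] at h3
    simp only [Complex.ofReal_re, Complex.ofReal_im, ne_eq, not_true_eq_false, or_false] at h3
    have := sq_nonneg (2 * Real.pi * ‖ξ‖)
    linarith

/-- Fourier side of the form with kernel `yukawaKernel d z`, off the cut: both sides are
holomorphic in `z`, and they agree for `z > 0`. -/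
theorem integral_yukawaKernel_mul_correlation {d : ℕ} (hd : d = 1 ∨ d = 2) {D : ℝ} (hD : 0 < D)
    (φ ψ : 𝓢(EuclideanSpace ℝ (Fin d), ℂ)) (hc : ∀ x, D ≤ ‖x‖ → correlation φ ψ x = 0)
    {z : ℂ} (hz : z ∈ Complex.slitPlane) :
    ∫ x, yukawaKernel d z ‖x‖ * correlation φ ψ x =
      1 / 2 * ∫ ξ, ((((2 * Real.pi * ‖ξ‖) ^ 2 : ℝ) : ℂ) + z) ^ ((-(1 : ℝ) / 2 : ℝ) : ℂ) *
        (𝓕 φ ξ * 𝓕⁻ ψ ξ) := by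
  obtain ⟨C, hC⟩ := exists_norm_correlation_le φ ψ
  have h1 := (differentiableOn_integral_yukawaKernel hd hD (continuous_correlation φ ψ) hC
    hc).analyticOnNhd Complex.isOpen_slitPlane
  have h2 := ((differentiableOn_integral_cpow (integrable_fourier_mul_fourierInv φ ψ)).const_mul
    (1 / 2)).analyticOnNhd Complex.isOpen_slitPlane
  refine h1.eqOn_of_preconnected_of_frequently_eq h2
    (Complex.starConvex_one_slitPlane.isPathConnected
      Complex.one_mem_slitPlane).isConnected.isPreconnected Complex.one_mem_slitPlane ?_ hz
  have hreal : ∀ l : ℝ, 0 < l → ∫ x, yukawaKernel d (l : ℂ) ‖x‖ * correlation φ ψ x =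
      1 / 2 * ∫ ξ, ((((2 * Real.pi * ‖ξ‖) ^ 2 : ℝ) : ℂ) + (l : ℂ)) ^ ((-(1 : ℝ) / 2 : ℝ) : ℂ) *
        (𝓕 φ ξ * 𝓕⁻ ψ ξ) := by
    intro l hl
    have h3 := integral_mul_correlation (integrable_heatIntegral (d := d) hl) φ ψ
    rw [← integral_const_mul]
    calc _ = ∫ x, (heatIntegral d l ‖x‖ : ℂ) * correlation φ ψ x := by
          refine integral_congr_ae ?_
          filter_upwards [ae_ne_zero (d := d) (by omega)] with x hx
          rw [yukawaKernel_ofReal hd hl (norm_pos_iff.2 hx)]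
      _ = _ := by
          rw [h3]
          congr 1
          ext ξ
          rw [fourier_heatIntegral hl, ← Complex.ofReal_add,
            ← Complex.ofReal_cpow (by positivity), add_comm l]
          push_cast
          ring
  have htend : Filter.Tendsto (fun t : ℝ => (1 : ℂ) + (t : ℂ)) (nhdsWithin 0 (Set.Ioi 0))
      (nhdsWithin 1 {1}ᶜ) := by
    refine tendsto_nhdsWithin_iff.2 ⟨?_, ?_⟩
    · have : Continuous fun t : ℝ => (1 : ℂ) + (t : ℂ) := by fun_prop
      simpa using (this.tendsto 0).mono_left nhdsWithin_le_nhds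
    · filter_upwards [self_mem_nhdsWithin] with t ht
      simpa using (ne_of_gt ht)
  refine htend.frequently (Filter.Eventually.frequently ?_)
  filter_upwards [self_mem_nhdsWithin] with t ht
  have ht : 0 < t := ht
  have := hreal (1 + t) (by linarith)
  simpa using this

/-- For `Im w < 0` the argument of `w^(-1/2)` lies in `(0, π/2)`. -/
theorem norm_cpow_le_re_add_im {w : ℂ} (hw : w.im < 0) :
    ‖w‖ ^ (-(1 : ℝ) / 2) ≤
      (w ^ ((-(1 : ℝ) / 2 : ℝ) : ℂ)).re + (w ^ ((-(1 : ℝ) / 2 : ℝ) : ℂ)).im := by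
  have hw0 : w ≠ 0 := fun h => by simp [h] at hw
  have harg : w.arg < 0 := Complex.arg_neg_iff.2 hw
  have harg' := Complex.neg_pi_lt_arg w
  rw [Complex.cpow_ofReal_re, Complex.cpow_ofReal_im, ← mul_add]
  refine le_mul_of_one_le_right (by positivity) ?_
  have hc : 0 ≤ Real.cos (w.arg * (-1 / 2)) :=
    Real.cos_nonneg_of_mem_Icc ⟨by linarith, by linarith⟩
  have hs : 0 ≤ Real.sin (w.arg * (-1 / 2)) :=
    Real.sin_nonneg_of_nonneg_of_le_pi (by linarith) (by linarith)
  nlinarith [Real.sin_sq_add_cos_sq (w.arg * (-1 / 2)), mul_nonneg hc hs]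

theorem re_add_im_le (w : ℂ) : w.re + w.im ≤ √2 * ‖w‖ := by
  rw [Complex.norm_eq_sqrt_sq_add_sq, ← Real.sqrt_mul (by norm_num)]
  exact Real.le_sqrt_of_sq_le (by nlinarith [sq_nonneg (w.re - w.im)])

/-- In the open lower half plane `(ρ + z)^{-1/2}` takes values in the closed first quadrant, so no
cancellation occurs in the integral beyond the factor `√2`. -/
theorem le_norm_integral_cpow {d : ℕ} {k : ℝ} (hk : 0 < k) {z : ℂ} (hz : z.im < 0)
    (hzk : ‖z‖ = k ^ 2) {g : EuclideanSpace ℝ (Fin d) → ℝ} (hg : Integrable g)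
    (hg0 : ∀ ξ, 0 ≤ g ξ) :
    1 / √2 * ∫ ξ, sobolevWeight k (-1) ξ * g ξ ≤
      ‖∫ ξ, ((((2 * Real.pi * ‖ξ‖) ^ 2 : ℝ) : ℂ) + z) ^ ((-(1 : ℝ) / 2 : ℝ) : ℂ) * (g ξ : ℂ)‖ := by
  have hzs : z ∈ Complex.slitPlane := Complex.mem_slitPlane_iff.2 (Or.inr hz.ne)
  set F : EuclideanSpace ℝ (Fin d) → ℂ := fun ξ =>
    ((((2 * Real.pi * ‖ξ‖) ^ 2 : ℝ) : ℂ) + z) ^ ((-(1 : ℝ) / 2 : ℝ) : ℂ) with hF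
  have him : ∀ ξ : EuclideanSpace ℝ (Fin d), ((((2 * Real.pi * ‖ξ‖) ^ 2 : ℝ) : ℂ) + z).im < 0 := by
    intro ξ
    rw [Complex.add_im, Complex.ofReal_im, zero_add]
    exact hz
  have hFc : Continuous F := Continuous.cpow (by fun_prop) continuous_const fun ξ =>
    ofReal_add_mem_slitPlane hzs (sq_nonneg _)
  have hint : Integrable fun ξ => F ξ * (g ξ : ℂ) := by
    refine hg.ofReal.bdd_mul (c := |z.im| ^ (-(1 : ℝ) / 2)) hFc.aestronglyMeasurable
      (Filter.Eventually.of_forall fun ξ => ?_)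
    rw [hF, Complex.norm_cpow_real]
    refine Real.rpow_le_rpow_of_nonpos (abs_pos.2 hz.ne) ?_ (by norm_num)
    have h := Complex.abs_im_le_norm ((((2 * Real.pi * ‖ξ‖) ^ 2 : ℝ) : ℂ) + z)
    rwa [Complex.add_im, Complex.ofReal_im, zero_add] at h
  rw [one_div, ← div_eq_inv_mul, div_le_iff₀' (by positivity)]
  refine le_trans ?_ (re_add_im_le _)
  have hre := integral_re hint
  have himm := integral_im hint
  simp only [RCLike.re_to_complex, RCLike.im_to_complex] at hre himm
  rw [← hre, ← himm]
  refine le_of_le_of_eq ?_ (integral_add hint.re hint.im)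
  refine integral_mono_of_nonneg (Filter.Eventually.of_forall fun ξ =>
    mul_nonneg (sobolevWeight_pos hk _ _).le (hg0 ξ)) (hint.re.add hint.im)
    (Filter.Eventually.of_forall fun ξ => ?_)
  simp only [Complex.re_mul_ofReal, Complex.im_mul_ofReal]
  rw [← add_mul]
  refine mul_le_mul_of_nonneg_right (le_trans ?_ (norm_cpow_le_re_add_im (him ξ))) (hg0 ξ)
  rw [sobolevWeight]
  refine Real.rpow_le_rpow_of_nonpos
    (norm_pos_iff.2 fun h => (him ξ).ne (by rw [h, Complex.zero_im])) ?_ (by norm_num)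
  refine (norm_add_le _ _).trans ?_
  rw [hzk, Complex.norm_real, Real.norm_of_nonneg (sq_nonneg _), add_comm]

theorem tendsto_integral_yukawaKernel {d : ℕ} (hd : d = 1 ∨ d = 2) {D : ℝ} (hD : 0 < D) {k : ℝ}
    (hk : 0 < k) {c : EuclideanSpace ℝ (Fin d) → ℂ} (hcont : Continuous c) {C : ℝ}
    (hC : ∀ x, ‖c x‖ ≤ C) (hc : ∀ x, D ≤ ‖x‖ → c x = 0) :
    Filter.Tendsto (fun ε => ∫ x, yukawaKernel d (limitingPoint k ε) ‖x‖ * c x)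
      (nhdsWithin 0 (Set.Ioi 0)) (nhds (∫ x, helmholtzRadial d k ‖x‖ * c x)) := by
  have hd0 : 0 < d := by omega
  obtain ⟨B, hB, hyB⟩ := exists_norm_yukawaKernel_le hd hD
  have hBt : Filter.Tendsto (fun ε => B (limitingPoint k ε)) (nhdsWithin 0 (Set.Ioi 0))
      (nhds (B (limitingPoint k 0))) := by
    have h0 : limitingPoint k 0 ∈ ({0}ᶜ : Set ℂ) := fun h => by
      have := norm_limitingPoint hk 0
      rw [Set.mem_singleton_iff.1 h, norm_zero] at this
      exact (pow_pos hk 2).ne this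
    exact ((hB.continuousAt (isOpen_compl_singleton.mem_nhds h0)).comp
      (continuous_limitingPoint k).continuousAt).tendsto.mono_left nhdsWithin_le_nhds
  refine tendsto_integral_filter_of_dominated_convergence _
    (Filter.Eventually.of_forall fun ε => ?_) ?_
    (integrable_indicator_norm_rpow hd0 hD ((B (limitingPoint k 0) + 1) * C)) ?_
  · exact (aestronglyMeasurable_comp_norm hd0 (continuousOn_yukawaKernel d _)).mul
      hcont.aestronglyMeasurable
  · filter_upwards [hBt.eventually_le_const (lt_add_one _)] with ε hε
    filter_upwards [ae_ne_zero hd0] with x hx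
    exact norm_kernel_mul_le hC hc (fun r hr hrD => (hyB _ r hr hrD).trans
      (mul_le_mul_of_nonneg_right hε (by positivity))) hx
  · filter_upwards [ae_ne_zero hd0] with x hx
    exact (tendsto_yukawaKernel_limitingPoint hd hk (norm_pos_iff.2 hx)).mul_const _

/-- Coercivity on test functions: the estimate holds at each `limitingPoint k ε`, with a constant
that does not depend on `ε`, and passes to the limit `ε → 0`. -/
theorem le_norm_integral_helmholtzRadial {d : ℕ} (hd : d = 1 ∨ d = 2) {D : ℝ} (hD : 0 < D) {k : ℝ}
    (hk : 0 < k) (φ ψ : 𝓢(EuclideanSpace ℝ (Fin d), ℂ))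
    (hc : ∀ x, D ≤ ‖x‖ → correlation φ ψ x = 0)
    (hψ : ∀ ξ, 𝓕⁻ ψ ξ = (starRingEnd ℂ) (𝓕 φ ξ)) :
    1 / (2 * √2) * ∫ ξ, sobolevWeight k (-1) ξ * ‖𝓕 φ ξ‖ ^ 2 ≤
      ‖∫ x, helmholtzRadial d k ‖x‖ * correlation φ ψ x‖ := by
  obtain ⟨C, hC⟩ := exists_norm_correlation_le φ ψ
  refine ge_of_tendsto (tendsto_integral_yukawaKernel hd hD hk (continuous_correlation φ ψ) hC
    hc).norm ?_
  have hg : ∀ ξ, 𝓕 φ ξ * 𝓕⁻ ψ ξ = ((‖𝓕 φ ξ‖ ^ 2 : ℝ) : ℂ) := fun ξ => by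
    rw [hψ, RCLike.mul_conj]
    push_cast
    rfl
  have hgi : Integrable fun ξ => ‖𝓕 φ ξ‖ ^ 2 := by
    refine (integrable_fourier_mul_fourierInv φ ψ).norm.congr
      (Filter.Eventually.of_forall fun ξ => ?_)
    simp only [hg, Complex.norm_real, norm_pow, norm_norm]
  filter_upwards [Ioo_mem_nhdsGT Real.pi_pos] with ε hε
  have him := limitingPoint_im_neg hk hε.1 hε.2
  rw [integral_yukawaKernel_mul_correlation hd hD φ ψ hc
    (Complex.mem_slitPlane_iff.2 (Or.inr him.ne)), norm_mul]
  have h := le_norm_integral_cpow hk him (norm_limitingPoint hk ε) hgi fun ξ => sq_nonneg _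
  simp only [hg]
  have e : 1 / (2 * √2) = ‖(1 / 2 : ℂ)‖ * (1 / √2) := by norm_num; ring
  rw [e, mul_assoc]
  exact mul_le_mul_of_nonneg_left h (norm_nonneg _)

/-! ### An integrable kernel that agrees with the Helmholtz kernel on the screen -/

theorem integrable_of_continuous_of_eq_zero {d : ℕ} {Q : EuclideanSpace ℝ (Fin d) → ℂ} {ρ : ℝ}
    (hQ : Continuous Q) (h0 : ∀ x, ρ ≤ ‖x‖ → Q x = 0) : Integrable Q := by
  refine hQ.integrable_of_hasCompactSupport (HasCompactSupport.intro
    (isCompact_closedBall (0 : EuclideanSpace ℝ (Fin d)) ρ) fun x hx => h0 x ?_)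
  rw [mem_closedBall_zero_iff, not_le] at hx
  exact hx.le

/-- The Fourier transform of a compactly supported Lipschitz function decays like `‖ξ‖⁻¹`: it is
half that of the difference of the function and its translate by `ξ / (2 ‖ξ‖²)`. -/
theorem exists_norm_mul_norm_fourier_le {d : ℕ} {Q : EuclideanSpace ℝ (Fin d) → ℂ} {L : NNReal}
    (hQ : LipschitzWith L Q) {ρ : ℝ} (h0 : ∀ x, ρ ≤ ‖x‖ → Q x = 0) :
    ∃ C, ∀ ξ, ‖ξ‖ * ‖𝓕 Q ξ‖ ≤ C := by
  have hint := integrable_of_continuous_of_eq_zero hQ.continuous h0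
  set V := volume.real (Metric.ball (0 : EuclideanSpace ℝ (Fin d)) (ρ + 1)) with hV
  refine ⟨max (∫ x, ‖Q x‖) (L * V), fun ξ => ?_⟩
  rcases le_or_gt ‖ξ‖ 1 with h | h
  · refine le_trans ?_ (le_max_left _ _)
    have h1 : ‖𝓕 Q ξ‖ ≤ ∫ x, ‖Q x‖ := VectorFourier.norm_fourierIntegral_le_integral_norm _ _ _ _ _
    exact (mul_le_of_le_one_left (norm_nonneg _) h).trans h1
  · refine le_trans ?_ (le_max_right _ _)
    have hξ0 : 0 < ‖ξ‖ := zero_lt_one.trans h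
    set w : EuclideanSpace ℝ (Fin d) := (1 / (2 * ‖ξ‖ ^ 2) : ℝ) • ξ with hw
    have hwn : ‖w‖ = 1 / (2 * ‖ξ‖) := by
      rw [hw, norm_smul, Real.norm_of_nonneg (by positivity)]
      field_simp
    have hw1 : ‖w‖ ≤ 1 := by
      rw [hwn, div_le_one (by positivity)]
      linarith
    rw [Real.fourier_eq,
      fourierIntegral_eq_half_sub_half_period_translate (norm_pos_iff.1 hξ0) hint]
    rw [norm_smul, ← setIntegral_eq_integral_of_forall_compl_eq_zero (s := Metric.ball 0 (ρ + 1))]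
    · have h2 : ‖∫ v in Metric.ball (0 : EuclideanSpace ℝ (Fin d)) (ρ + 1),
          Real.fourierChar (-inner ℝ v ξ) • (Q v - Q (v + w))‖ ≤ (L * ‖w‖) * V := by
        refine norm_setIntegral_le_of_norm_le_const measure_ball_lt_top fun v _ => ?_
        rw [Circle.norm_smul]
        have := hQ.norm_sub_le v (v + w)
        rwa [sub_add_cancel_left, norm_neg] at this
      calc ‖ξ‖ * (‖(1 / 2 : ℂ)‖ * _) ≤ ‖ξ‖ * (‖(1 / 2 : ℂ)‖ * ((L * ‖w‖) * V)) := by gcongr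
        _ = 1 / 4 * (L * V) := by
            rw [hwn]
            norm_num
            field_simp
            ring
        _ ≤ L * V := mul_le_of_le_one_left (mul_nonneg L.2 measureReal_nonneg) (by norm_num)
    · intro v hv
      rw [mem_ball_zero_iff, not_lt] at hv
      have h3 : ρ ≤ ‖v + w‖ := by
        have := norm_sub_le (v + w) w
        rw [add_sub_cancel_right] at this
        linarith
      rw [h0 v (by linarith), h0 _ h3, sub_zero, smul_zero]

theorem norm_le_mul_sobolevWeight {d : ℕ} {k : ℝ} (hk : 0 < k) {a A B : ℝ} (ha : 0 ≤ a)
    {ξ : EuclideanSpace ℝ (Fin d)} (hA : a ≤ A) (hB : ‖ξ‖ * a ≤ B) :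
    a ≤ (k * A + 2 * Real.pi * B) * sobolevWeight k (-1) ξ := by
  have hp := Real.pi_pos
  have h1 : sobolevWeight k 1 ξ ≤ k + 2 * Real.pi * ‖ξ‖ := by
    rw [sobolevWeight, ← Real.sqrt_eq_rpow]
    refine Real.sqrt_le_iff.2 ⟨by positivity, ?_⟩
    have : 0 ≤ k * (2 * Real.pi * ‖ξ‖) := by positivity
    nlinarith
  calc a = sobolevWeight k 1 ξ * a * sobolevWeight k (-1) ξ := by
        linear_combination (-a) * sobolevWeight_mul_neg hk 1 ξ
    _ ≤ _ := by
        refine mul_le_mul_of_nonneg_right ?_ (sobolevWeight_pos hk _ _).le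
        nlinarith [mul_le_mul_of_nonneg_right h1 ha]

/-- Beyond the diameter of the screen the Helmholtz kernel may be changed at will. It differs from
the exponentially decaying kernel `heatIntegral d k²` by a `C¹` function of the distance, which is
cut off. -/
theorem exists_integrable_eq_helmholtzRadial {d : ℕ} (hd : d = 1 ∨ d = 2) {k D : ℝ} (hk : 0 < k)
    (hD : 0 < D) : ∃ K : EuclideanSpace ℝ (Fin d) → ℂ, Integrable K ∧
      (∃ C, ∀ ξ, ‖𝓕 K ξ‖ ≤ C * sobolevWeight k (-1) ξ) ∧
      ∀ x, x ≠ 0 → ‖x‖ ≤ D → K x = helmholtzRadial d k ‖x‖ := by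
  obtain ⟨R, hR, hRk⟩ := exists_contDiff_helmholtzRadial_eq hd hk
  let χ : ContDiffBump (0 : ℝ) := ⟨D, D + 1, hD, lt_add_one D⟩
  have hχR : ContDiff ℝ 1 fun r => (χ r : ℝ) • R r := χ.contDiff.smul hR
  obtain ⟨L, hL⟩ := hχR.lipschitzWith_of_hasCompactSupport (𝕂 := ℝ)
    (χ.hasCompactSupport.smul_right) one_ne_zero
  have hQL : LipschitzWith (L * 1) fun x : EuclideanSpace ℝ (Fin d) => (χ ‖x‖ : ℝ) • R ‖x‖ :=
    hL.comp lipschitzWith_one_norm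
  have hQ0 : ∀ x : EuclideanSpace ℝ (Fin d), D + 1 ≤ ‖x‖ → (χ ‖x‖ : ℝ) • R ‖x‖ = 0 := by
    intro x hx
    rw [χ.zero_of_le_dist (by simpa using hx), zero_smul]
  have hQi := integrable_of_continuous_of_eq_zero hQL.continuous hQ0
  have hk2 : 0 < k ^ 2 := by positivity
  have hHi := integrable_heatIntegral (d := d) hk2
  refine ⟨fun x => (heatIntegral d (k ^ 2) ‖x‖ : ℂ) + (χ ‖x‖ : ℝ) • R ‖x‖, hHi.add hQi, ?_,
    fun x hx hxD => ?_⟩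
  · obtain ⟨B, hB⟩ := exists_norm_mul_norm_fourier_le hQL hQ0
    refine ⟨1 / 2 + (k * (∫ x : EuclideanSpace ℝ (Fin d), ‖(χ ‖x‖ : ℝ) • R ‖x‖‖) +
      2 * Real.pi * B), fun ξ => ?_⟩
    have h1 : 𝓕 (fun x : EuclideanSpace ℝ (Fin d) => (heatIntegral d (k ^ 2) ‖x‖ : ℂ) +
        (χ ‖x‖ : ℝ) • R ‖x‖) ξ =
        𝓕 (fun x : EuclideanSpace ℝ (Fin d) => (heatIntegral d (k ^ 2) ‖x‖ : ℂ)) ξ +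
        𝓕 (fun x : EuclideanSpace ℝ (Fin d) => (χ ‖x‖ : ℝ) • R ‖x‖) ξ := by
      rw [Real.fourier_eq, Real.fourier_eq, Real.fourier_eq, ← integral_add
        ((Real.fourierIntegral_convergent_iff ξ).2 hHi)
        ((Real.fourierIntegral_convergent_iff ξ).2 hQi)]
      simp only [smul_add]
    rw [h1, add_mul]
    refine (norm_add_le _ _).trans (add_le_add (le_of_eq ?_) ?_)
    · rw [fourier_heatIntegral hk2, Complex.norm_real, Real.norm_of_nonneg (by positivity)]
      rfl
    · exact norm_le_mul_sobolevWeight hk (norm_nonneg _)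
        (VectorFourier.norm_fourierIntegral_le_integral_norm _ _ _ _ _) (hB ξ)
  · have hx0 := norm_pos_iff.2 hx
    have h1 : χ ‖x‖ = 1 := χ.one_of_mem_closedBall (by simpa [χ] using hxD)
    simp only [hRk _ hx0, yukawaKernel_ofReal hd hk2 hx0, h1, one_smul]

/-! ### The single-layer operator of a planar screen -/

theorem norm_planeEmbedding {d : ℕ} (x : EuclideanSpace ℝ (Fin d)) :
    ‖planeEmbedding x‖ = ‖x‖ := by
  rw [EuclideanSpace.norm_eq, EuclideanSpace.norm_eq, Fin.sum_univ_castSucc]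
  simp [planeEmbedding]

theorem planeEmbedding_sub {d : ℕ} (x y : EuclideanSpace ℝ (Fin d)) :
    planeEmbedding x - planeEmbedding y = planeEmbedding (x - y) := by
  ext i
  refine Fin.lastCases ?_ (fun j => ?_) i <;> simp [planeEmbedding]

theorem helmholtzFundamental_planeEmbedding {d : ℕ} (k : ℝ) (x y : EuclideanSpace ℝ (Fin d)) :
    helmholtzFundamental k (planeEmbedding x) (planeEmbedding y) =
      helmholtzRadial d k ‖x - y‖ := by
  rw [helmholtzFundamental, planeEmbedding_sub, norm_planeEmbedding, helmholtzRadial]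

theorem PlanarScreen.exists_norm_sub_lt {d : ℕ} (Γ : PlanarScreen d) :
    ∃ D, 0 < D ∧ ∀ x ∈ Γ.chart, ∀ y ∈ Γ.chart, ‖x - y‖ < D := by
  obtain ⟨R, hR, hΓ⟩ := Γ.isBounded.exists_pos_norm_lt
  refine ⟨2 * R, by positivity, fun x hx y hy => ?_⟩
  have h1 := hΓ _ hx
  have h2 := hΓ _ hy
  rw [norm_planeEmbedding] at h1 h2
  linarith [norm_sub_le x y]

theorem integral_mul_correlation_eq_singleLayerIntegral {d : ℕ} (hd : 0 < d) {k D : ℝ}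
    {Γ : PlanarScreen d} (hD : ∀ x ∈ Γ.chart, ∀ y ∈ Γ.chart, ‖x - y‖ < D)
    {K : EuclideanSpace ℝ (Fin d) → ℂ} (hK : Integrable K)
    (hKh : ∀ x, x ≠ 0 → ‖x‖ ≤ D → K x = helmholtzRadial d k ‖x‖) (φ ψ : 𝓓(Γ.chart, ℂ)) :
    ∫ z, K z * correlation (testToSchwartz Γ.chart φ) (testToSchwartz Γ.chart ψ) z =
      ∫ x in (Γ.chart : Set (EuclideanSpace ℝ (Fin d))), singleLayerIntegral k Γ φ x * ψ x := by
  have : Nonempty (Fin d) := ⟨⟨0, hd⟩⟩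
  rw [integral_mul_correlation_eq_integral_integral hK,
    setIntegral_eq_integral_of_forall_compl_eq_zero fun x hx => by
      rw [testFunction_eq_zero ψ hx, mul_zero]]
  congr 1
  ext x
  rw [testToSchwartz_apply]
  by_cases hx : x ∈ Γ.chart
  · rw [singleLayerIntegral, setIntegral_eq_integral_of_forall_compl_eq_zero fun y hy => by
      rw [testFunction_eq_zero φ hy, mul_zero]]
    congr 1
    refine integral_congr_ae ?_
    filter_upwards [compl_mem_ae_iff.2 (measure_singleton x)] with y hy
    rw [testToSchwartz_apply, helmholtzFundamental_planeEmbedding]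
    by_cases hyΓ : y ∈ Γ.chart
    · rw [hKh _ (sub_ne_zero.2 (Ne.symm hy)) (hD x hx y hyΓ).le]
    · rw [testFunction_eq_zero φ hyΓ, mul_zero, mul_zero]
  · rw [testFunction_eq_zero ψ hx, mul_zero, mul_zero]

theorem integral_helmholtzRadial_mul_congr {d : ℕ} (hd : 0 < d) {k D : ℝ}
    {K c : EuclideanSpace ℝ (Fin d) → ℂ} (hc : ∀ x, D ≤ ‖x‖ → c x = 0)
    (hKh : ∀ x, x ≠ 0 → ‖x‖ ≤ D → K x = helmholtzRadial d k ‖x‖) :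
    ∫ x, helmholtzRadial d k ‖x‖ * c x = ∫ x, K x * c x := by
  refine integral_congr_ae ?_
  filter_upwards [ae_ne_zero hd] with x hx
  rcases le_or_gt ‖x‖ D with h | h
  · rw [hKh x hx h]
  · rw [hc x h.le, mul_zero, mul_zero]

theorem norm_sobolevToL2_testToSobolev_sq {d : ℕ} {k : ℝ} (hk : 0 < k)
    {Ω : Opens (EuclideanSpace ℝ (Fin d))} (φ : 𝓓(Ω, ℂ)) :
    ‖sobolevToL2 hk (-(1 / 2)) (testToSobolev (-(1 / 2)) φ)‖ ^ 2 =
      ∫ ξ, sobolevWeight k (-1) ξ * ‖𝓕 (testToSchwartz Ω φ) ξ‖ ^ 2 := by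
  have h := L2.inner_def (𝕜 := ℂ) (sobolevToL2 hk (-(1 / 2)) (testToSobolev (-(1 / 2)) φ))
    (sobolevToL2 hk (-(1 / 2)) (testToSobolev (-(1 / 2)) φ))
  rw [inner_self_eq_norm_sq_to_K] at h
  rw [← Complex.ofReal_inj, ← integral_complex_ofReal, Complex.ofReal_pow]
  refine h.trans (integral_congr_ae ?_)
  filter_upwards [sobolevToL2_testToSobolev hk (-(1 / 2)) φ] with ξ hξ
  have e : sobolevWeight k (-1) ξ = sobolevWeight k (-(1 / 2)) ξ ^ 2 := by
    rw [sq, ← sobolevWeight_add hk]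
    norm_num
  rw [inner_self_eq_norm_sq_to_K, hξ, norm_mul, Complex.norm_real,
    Real.norm_of_nonneg (sobolevWeight_pos hk _ _).le, e]
  simp [mul_pow]

end

theorem theorem1p7 (d : ℕ) (hd : d = 1 ∨ d = 2) (Γ : PlanarScreen d) (k : ℝ) (hk : 0 < k) :
    ∃ S : sobolevTilde (-(1 / 2)) Γ.chart →ₗ[ℂ] sobolevOn (1 / 2) Γ.chart,
      IsSingleLayerOperator k Γ S ∧
      (∀ S' : sobolevTilde (-(1 / 2)) Γ.chart →ₗ[ℂ] sobolevOn (1 / 2) Γ.chart,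
        IsSingleLayerOperator k Γ S' → S' = S) ∧
      ∃ a : sobolevTilde (-(1 / 2)) Γ.chart →ₗ[ℂ] sobolevTilde (-(1 / 2)) Γ.chart →ₗ⋆[ℂ] ℂ,
        (∀ φ ψ : sobolevTilde (-(1 / 2)) Γ.chart, a φ ψ = sobolevOnPairing (S φ) ψ) ∧
        ∀ φ : sobolevTilde (-(1 / 2)) Γ.chart,
          1 / (2 * √2) * sobolevNorm k (-(1 / 2)) φ.1 ^ 2 ≤ ‖a φ φ‖ := by
  have hd0 : 0 < d := by omega
  obtain ⟨D, hD, hΓ⟩ := Γ.exists_norm_sub_lt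
  obtain ⟨K, hK, ⟨C, hC⟩, hKh⟩ := exists_integrable_eq_helmholtzRadial hd hk hD
  obtain ⟨M, hM⟩ := exists_multiplier hk hK hC
  obtain ⟨S, hSb, hSt, hSp⟩ := exists_convolution_operator hk M Γ.chart
  have hS : IsSingleLayerOperator k Γ S := by
    refine ⟨⟨_, hSb⟩, fun φ ψ => ?_⟩
    rw [hSt, tildeToL2_testToTilde, inner_testToSobolev_multiplier hk hK hM]
    exact integral_mul_correlation_eq_singleLayerIntegral hd0 hΓ hK hKh φ ψ
  refine ⟨S, hS, fun S' hS' => IsSingleLayerOperator.unique hk hS hS', ?_⟩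
  refine ⟨LinearMap.mk₂'ₛₗ (RingHom.id ℂ) (starRingEnd ℂ) (fun φ ψ =>
    inner ℂ (tildeToL2 hk (-(1 / 2)) Γ.chart ψ) (M (tildeToL2 hk (-(1 / 2)) Γ.chart φ)))
    (fun φ φ' ψ => by rw [map_add, map_add, inner_add_right])
    (fun c φ ψ => by rw [map_smul, map_smul, inner_smul_right]; rfl)
    (fun φ ψ ψ' => by rw [map_add, inner_add_left])
    (fun c φ ψ => by rw [map_smul, inner_smul_left]; rfl), fun φ ψ => (hSp φ ψ).symm, fun φ => ?_⟩
  rw [LinearMap.mk₂'ₛₗ_apply, ← norm_tildeToL2 hk]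
  refine tildeToL2_mem_of_isClosed hk
    (A := {h | 1 / (2 * √2) * ‖h‖ ^ 2 ≤ ‖(inner ℂ h (M h) : ℂ)‖})
    (isClosed_le (by fun_prop) (by fun_prop)) (fun φ => ?_) φ
  have hc : ∀ x, D ≤ ‖x‖ → correlation (testToSchwartz Γ.chart φ)
      (testToSchwartz Γ.chart (conjTest φ)) x = 0 := fun x hx =>
    correlation_testToSchwartz_eq_zero hΓ φ (conjTest φ) hx
  have h := le_norm_integral_helmholtzRadial hd hD hk (testToSchwartz Γ.chart φ)
    (testToSchwartz Γ.chart (conjTest φ)) hc fun ξ => by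
      rw [← conj_fourier_conjTest, conjTest_conjTest]
  rw [integral_helmholtzRadial_mul_congr hd0 hc hKh, ← inner_testToSobolev_multiplier hk hK hM,
    conjTest_conjTest, ← norm_sobolevToL2_testToSobolev_sq hk] at h
  exact h
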